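/- **Theorem (Hankel transform for the standard $L$-function of $\mathrm{GL}_n$).** Let $F$ be a local field with normalized absolute value $|\cdot|$, let $\psi$ be a nontrivial continuous unitary character of $F$, let $dx$ be the self-dual Haar measure on $F$ with respect to $\psi$, and $d^\times x=dx/|x|$. Let $G=\mathrm{GL}_n(F)$, let $N\subset G$ be the group of upper triangular unipotent matrices, on which $\psi$ also denotes the character $\psi(u)=\psi\big(\sum_{i=1}^{n-1}u_{i,i+1}\big)$, let $T=(F^\times)^n$ be the group of diagonal matrices, $\delta(t)=\prod_i|t_i|^{n+1-2i}$, and let $w$ be the antidiagonal matrix with antidiagonal entries $1$. The spaces $\mathrm{Mat}_n$, $N$ and $T$ carry the measures $\prod dx_{ij}$, $\prod_{i<j}du_{ij}$ and $dt=\prod d^\times t_i$, and $G$ carries $dg=|\det g|^{-n}\prod dg_{ij}$. Half-densities on $\mathrm{Mat}_n$, $G$, $T$ are written as functions times the square roots of these measures. For a half-density $\varphi\,(dg)^{1/2}$ on $G$ set $$p_!\big(\varphi\,(dg)^{1/2}\big)(t)=\delta^{1/2}(t)\int_{N\times N}\varphi(n_1\,w\,t\,n_2)\,\psi^{-1}(n_1n_2)\,dn_1\,dn_2\;(dt)^{1/2}\qquad(t\in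 T).$$ Let $\mathcal D(\mathrm{Mat}_n)$ be the space of Schwartz half-densities $\Phi\,(dx)^{1/2}$ on $\mathrm{Mat}_n(F)$ ($\Phi$ locally constant with compact support if $F$ is nonarchimedean, a Schwartz function if $F=\mathbb R$ or $\mathbb C$), restricted to $G$ through $G\subset\mathrm{Mat}_n$ as $|\det g|^{n/2}\Phi(g)(dg)^{1/2}$. Let $\mathcal D(\mathrm{Mat}_n^\vee)$ be the space of Schwartz half-densities $\Psi\,(dy)^{1/2}$ on the dual space, identified with $\mathrm{Mat}_n$ by $\langle x,y\rangle=\operatorname{tr}(xy)$, restricted to $G$ through the embedding $g\mapsto g^{-1}$ as $|\det g|^{-n/2}\Psi(g^{-1})(dg)^{1/2}$. Let $\mathcal D^-_{L(\mathrm{Std},1/2)}$ and $\mathcal D^-_{L(\mathrm{Std}^\vee,1/2)}$ be the images of $\mathcal D(\mathrm{Mat}_n)$ and $\mathcal D(\mathrm{Mat}_n^\vee)$ under restriction followed by $p_!$; they are spaces of half-densities on $T$. Let $$\mathcal F:\mathcal D(\mathrm{Mat}_n)\to\mathcal D(\mathrm{Mat}_n^\vee),\qquad \mathcal F\big(\Phi(dx)^{1/2}\big)(y)=\Big(\int_{\mathrm{Mat}_n}\Phi(x)\,\psi(\langle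 x,y\rangle)\,dx\Big)(dy)^{1/2}.$$ For a cocharacter $\check\lambda:F^\times\to T$ and $s\in\mathbb C$, let $\mathscr F_{\check\lambda,s}$ be the convolution with the push-forward of $|x|^s\psi(x)\,d^\times x$ along $\check\lambda$, i.e. $(\mathscr F_{\check\lambda,s}f)(t)=\int_{F^\times}|x|^s\psi(x)\,f(\check\lambda(x)^{-1}t)\,d^\times x$. Let $\check\epsilon_i:F^\times\to T$ be the $i$-th coordinate cocharacter (cocharacters are written additively), and let $\psi(-e^{-\alpha_i})$ denote multiplication by the function $t\mapsto\psi(-t_{i+1}/t_i)$. Then $\mathcal F$ maps $\mathcal D(\mathrm{Mat}_n)$ into $\mathcal D(\mathrm{Mat}_n^\vee)$, the integrals defining the two push-forwards converge absolutely for every $t\in T$ (so that the two images are linear subspaces), and there is a linear isomorphism $$\mathcal H_{\mathrm{Std}}:\mathcal D^-_{L(\mathrm{Std},1/2)}\xrightarrow{\ \sim\ }\mathcal D^-_{L(\mathrm{Std}^\vee,1/2)}$$ such that, for every $\varphi\in\mathcal D(\mathrm{Mat}_n)$, $\mathcal H_{\mathrm{Std}}$ maps the push-forward of $\varphi$ to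 the push-forward of $\mathcal F(\varphi)$. Moreover $$\mathcal H_{\mathrm{Std}}=\mathscr F_{-\check\epsilon_1,\frac12}\circ\psi(-e^{-\alpha_1})\circ\mathscr F_{-\check\epsilon_2,\frac12}\circ\cdots\circ\psi(-e^{-\alpha_{n-1}})\circ\mathscr F_{-\check\epsilon_n,\frac12},$$ where, for $f\in\mathcal D^-_{L(\mathrm{Std},1/2)}$, the integral over $F^\times$ defining each successive transform converges absolutely at every point of $T$. -/

import Mathlib

open MeasureTheory

namespace Kuznetsov

noncomputable section

/-- A topological field (whose topology comes from a nontrivial norm) is a local field if it is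
locally compact and either nonarchimedean, or isomorphic as a topological field to `ℝ` or `ℂ`. -/
def IsLocalField (F : Type*) [NontriviallyNormedField F] : Prop :=
  LocallyCompactSpace F ∧
    (IsUltrametricDist F ∨
      (∃ e : F ≃+* ℝ, Continuous e ∧ Continuous e.symm) ∨
      (∃ e : F ≃+* ℂ, Continuous e ∧ Continuous e.symm))

/-- Schwartz functions on `Mat_n(F)`: locally constant and compactly supported if `F` is
nonarchimedean, Schwartz functions on the real vector space `Mat_n(F)` if `F` is `ℝ` or `ℂ`.
(Exactly one of the three clauses is not vacuous for a given local field, and the condition in the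
last two does not depend on the isomorphism `e`.) -/
def schwartz (F : Type*) [NontriviallyNormedField F] (n : ℕ) :
    Submodule ℂ (Matrix (Fin n) (Fin n) F → ℂ) where
  carrier := {Φ |
    (IsUltrametricDist F → IsLocallyConstant Φ ∧ HasCompactSupport Φ) ∧
    (∀ e : F ≃+* ℝ, Continuous e → Continuous e.symm →
      ∃ g : SchwartzMap (Fin n → Fin n → ℝ) ℂ, ∀ X, Φ X = g (fun i j => e (X i j))) ∧
    (∀ e : F ≃+* ℂ, Continuous e → Continuous e.symm →
      ∃ g : SchwartzMap (Fin n → Fin n → ℂ) ℂ, ∀ X, Φ X = g (fun i j => e (X i j)))}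
  zero_mem' :=
    ⟨fun _ => ⟨IsLocallyConstant.const 0, HasCompactSupport.zero⟩,
      fun _ _ _ => ⟨0, fun _ => rfl⟩, fun _ _ _ => ⟨0, fun _ => rfl⟩⟩
  add_mem' := by
    rintro Φ Ψ ⟨h1, h2, h3⟩ ⟨k1, k2, k3⟩
    refine ⟨fun u => ⟨(h1 u).1.add (k1 u).1, (h1 u).2.add (k1 u).2⟩, fun e he he' => ?_,
      fun e he he' => ?_⟩
    · obtain ⟨g, hg⟩ := h2 e he he'
      obtain ⟨k, hk⟩ := k2 e he he'
      exact ⟨g + k, fun X => by simp [hg, hk]⟩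
    · obtain ⟨g, hg⟩ := h3 e he he'
      obtain ⟨k, hk⟩ := k3 e he he'
      exact ⟨g + k, fun X => by simp [hg, hk]⟩
  smul_mem' := by
    rintro c Φ ⟨h1, h2, h3⟩
    refine ⟨fun u => ⟨(h1 u).1.comp (c * ·), (h1 u).2.mul_left (f := fun _ => c)⟩,
      fun e he he' => ?_, fun e he he' => ?_⟩
    · obtain ⟨g, hg⟩ := h2 e he he'
      exact ⟨c • g, fun X => by simp [hg]⟩
    · obtain ⟨g, hg⟩ := h3 e he he'
      exact ⟨c • g, fun X => by simp [hg]⟩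

/-- The torus `T(F) = (Fˣ)ⁿ` of diagonal matrices. -/
abbrev Torus (F : Type*) [Field F] (n : ℕ) : Type _ := Fin n → Fˣ

/-- Coordinates on the group `N(F)` of upper triangular unipotent matrices. -/
abbrev UCoord (F : Type*) (n : ℕ) : Type _ := {p : Fin n × Fin n // p.1 < p.2} → F

section algebra

variable {F : Type*} [Field F] {n : ℕ}

/-- The matrix `diag(t_1, …, t_n)` in `GL_n(F)`. -/
def diag (t : Torus F n) : GL (Fin n) F where
  val := Matrix.diagonal fun i => (t i : F)
  inv := Matrix.diagonal fun i => ((t i)⁻¹ : F)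
  val_inv := by simp
  inv_val := by simp

theorem antidiag_mul_self (F : Type*) [Field F] (n : ℕ) :
    (Matrix.of fun i j : Fin n => if j = i.rev then (1 : F) else 0) *
      (Matrix.of fun i j : Fin n => if j = i.rev then (1 : F) else 0) = 1 := by
  ext i j
  simp only [Matrix.mul_apply, Matrix.of_apply, Matrix.one_apply]
  rw [Finset.sum_eq_single i.rev]
  · simp [eq_comm]
  · intro b _ hb
    simp [hb]
  · simp

/-- The anti-diagonal matrix `w_n` whose anti-diagonal entries are `1`. -/
def antidiag (F : Type*) [Field F] (n : ℕ) : GL (Fin n) F where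
  val := Matrix.of fun i j => if j = i.rev then 1 else 0
  inv := Matrix.of fun i j => if j = i.rev then 1 else 0
  val_inv := antidiag_mul_self F n
  inv_val := antidiag_mul_self F n

/-- The upper triangular unipotent matrix with the given entries above the diagonal. -/
def unipMatrix (u : UCoord F n) : Matrix (Fin n) (Fin n) F :=
  Matrix.of fun i j => if h : i < j then u ⟨(i, j), h⟩ else if i = j then 1 else 0

theorem det_unipMatrix (u : UCoord F n) : (unipMatrix u).det = 1 := by
  rw [Matrix.det_of_isUpperTriangular]
  · simp [unipMatrix]
  · intro i j hij
    have hij' : j < i := hij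
    simp [unipMatrix, not_lt.2 hij'.le, hij'.ne']

/-- `unipMatrix u` as an element of `GL_n(F)`. -/
def unip (u : UCoord F n) : GL (Fin n) F :=
  Matrix.GeneralLinearGroup.mkOfDetNeZero (unipMatrix u) (by simp [det_unipMatrix])

/-- The sum of the `(i, i+1)`-entries of the unipotent matrix with coordinates `u`. -/
def superSum (u : UCoord F n) : F :=
  ∑ p : {p : Fin n × Fin n // p.1 < p.2}, if p.1.1.val + 1 = p.1.2.val then u p else 0

end algebra

variable {F : Type*} [NontriviallyNormedField F] [LocallyCompactSpace F]

/-- The normalized absolute value on `Fˣ`: the factor by which multiplication by `x` scales the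
additive Haar measures of `F`. -/
def modulus (x : Fˣ) : ℝ := distribHaarChar F x

variable [MeasurableSpace F] [BorelSpace F] {n : ℕ}

/-- `μ` is self-dual with respect to `ψ`: for the Fourier transform
`Φ ↦ (z ↦ ∫ Φ(y) ψ(yz) dμ(y))`, the inversion formula holds with the same measure `μ`. -/
def IsSelfDual (ψ : AddChar F Circle) (μ : Measure F) : Prop :=
  ∀ Φ : F → ℂ, Continuous Φ → Integrable Φ μ →
    Integrable (fun z => ∫ y, Φ y * (ψ (y * z) : ℂ) ∂μ) μ →
    ∀ x, ∫ z, (∫ y, Φ y * (ψ (y * z) : ℂ) ∂μ) * (ψ (z * x) : ℂ) ∂μ = Φ (-x)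

/-- The multiplicative Haar measure `d^×x = dx / |x|` on `Fˣ`. -/
def mulHaar (μ : Measure F) : Measure Fˣ :=
  (μ.comap Units.val).withDensity fun x => ENNReal.ofReal (modulus x)⁻¹

/-! Half-densities on `Mat_n`, `Mat_n^∨`, `G = GL_n` and `T` are recorded by their coefficient
functions with respect to the Haar half-densities `(dx)^{1/2}`, `(dy)^{1/2}`, `(dg)^{1/2}`,
`(dt)^{1/2}`, where `dx`, `dy` are the products of the self-dual measure of `F`,
`dg = |det g|^{-n} dx` and `dt = d^×t_1 ⋯ d^×t_n`. The dual space `Mat_n^∨` is identified with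
`Mat_n` through the trace pairing. -/

/-- The Fourier transform from half-densities on `Mat_n` to half-densities on `Mat_n^∨`. -/
def fourierMat (ψ : AddChar F Circle) (μ : Measure F) (Φ : Matrix (Fin n) (Fin n) F → ℂ) :
    Matrix (Fin n) (Fin n) F → ℂ := fun Y =>
  ∫ X : Fin n → Fin n → F, Φ (Matrix.of X) * (ψ (Matrix.trace (Matrix.of X * Y)) : ℂ)
    ∂(Measure.pi fun _ => Measure.pi fun _ => μ)

/-- Restriction of the half-density `Φ (dx)^{1/2}` along `GL_n ⊂ Mat_n`. -/
def restrictMat (Φ : Matrix (Fin n) (Fin n) F → ℂ) (g : GL (Fin n) F) : ℂ :=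
  ((modulus (Matrix.GeneralLinearGroup.det g) ^ ((n : ℝ) / 2) : ℝ) : ℂ) * Φ g.val

/-- Restriction of the half-density `Φ (dy)^{1/2}` along the equivariant embedding
`GL_n → Mat_n^∨`, `g ↦ g⁻¹`. -/
def restrictMatDual (Φ : Matrix (Fin n) (Fin n) F → ℂ) (g : GL (Fin n) F) : ℂ :=
  ((modulus (Matrix.GeneralLinearGroup.det g) ^ (-((n : ℝ) / 2)) : ℝ) : ℂ) * Φ (g⁻¹).val

/-- The Haar measure on `N × N` (in coordinates). -/
def haarNN (μ : Measure F) (n : ℕ) : Measure (UCoord F n × UCoord F n) :=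
  (Measure.pi fun _ => μ).prod (Measure.pi fun _ => μ)

/-- The integrand `(n_1, n_2) ↦ φ(n_1 w t n_2) ψ^{-1}(n_1 n_2)` of the orbital integral. -/
def orbitalIntegrand (ψ : AddChar F Circle) (φ : GL (Fin n) F → ℂ) (t : Torus F n)
    (u : UCoord F n × UCoord F n) : ℂ :=
  φ (unip u.1 * (antidiag F n * diag t) * unip u.2) *
    (ψ (-(superSum u.1 + superSum u.2)) : ℂ)

/-- The orbital integral `O_t(φ)`. -/
def orbital (ψ : AddChar F Circle) (μ : Measure F) (φ : GL (Fin n) F → ℂ) (t : Torus F n) : ℂ :=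
  ∫ u, orbitalIntegrand ψ φ t u ∂(haarNN μ n)

/-- `δ^{1/2}(t)`, with `δ` the modular character of the upper triangular Borel subgroup:
`δ(t) = ∏_{i=1}^n |t_i|^{n+1-2i}` (here `i` runs from `0` to `n-1`). -/
def deltaHalf (t : Torus F n) : ℝ :=
  ∏ i : Fin n, modulus (t i) ^ (((n : ℝ) - 1 - 2 * (i : ℝ)) / 2)

/-- The twisted push-forward `p_!` of half-densities from `G` to the torus,
`φ (dg)^{1/2} ↦ δ^{1/2}(t) O_t(φ) (dt)^{1/2}`. -/
def push (ψ : AddChar F Circle) (μ : Measure F) (φ : GL (Fin n) F → ℂ) : Torus F n → ℂ :=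
  fun t => (deltaHalf t : ℂ) * orbital ψ μ φ t

/-- The push-forward of half-densities from `Mat_n`. -/
def pushMat (ψ : AddChar F Circle) (μ : Measure F) (Φ : Matrix (Fin n) (Fin n) F → ℂ) :
    Torus F n → ℂ := push ψ μ (restrictMat Φ)

/-- The push-forward of half-densities from `Mat_n^∨`. -/
def pushMatDual (ψ : AddChar F Circle) (μ : Measure F) (Φ : Matrix (Fin n) (Fin n) F → ℂ) :
    Torus F n → ℂ := push ψ μ (restrictMatDual Φ)

/-- The space `D^-_{L(Std,1/2)}(N,ψ\G/N,ψ)`, the image of the Schwartz half-densities on `Mat_n`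
(which is its own span: see the theorem). -/
def DStd (ψ : AddChar F Circle) (μ : Measure F) (n : ℕ) : Submodule ℂ (Torus F n → ℂ) :=
  Submodule.span ℂ (pushMat ψ μ '' (schwartz F n : Set (Matrix (Fin n) (Fin n) F → ℂ)))

/-- The space `D^-_{L(Std^∨,1/2)}(N,ψ\G/N,ψ)`, the image of the Schwartz half-densities on
`Mat_n^∨` (which is its own span: see the theorem). -/
def DStdDual (ψ : AddChar F Circle) (μ : Measure F) (n : ℕ) : Submodule ℂ (Torus F n → ℂ) :=
  Submodule.span ℂ (pushMatDual ψ μ '' (schwartz F n : Set (Matrix (Fin n) (Fin n) F → ℂ)))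

/-- The integrand on `Fˣ` of the convolution of `f` with the push-forward along the cocharacter
`lam` of the distribution `|x|^s ψ(x) d^×x`, at the point `t`. -/
def eqFourierIntegrand (ψ : AddChar F Circle) (lam : Fˣ →* Torus F n) (s : ℂ)
    (f : Torus F n → ℂ) (t : Torus F n) (x : Fˣ) : ℂ :=
  (modulus x : ℂ) ^ s * (ψ (x : F) : ℂ) * f ((lam x)⁻¹ * t)

/-- The equivariant Fourier transform `ℱ_{lam,s}`. -/
def eqFourier (ψ : AddChar F Circle) (μ : Measure F) (lam : Fˣ →* Torus F n) (s : ℂ)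
    (f : Torus F n → ℂ) : Torus F n → ℂ :=
  fun t => ∫ x, eqFourierIntegrand ψ lam s f t x ∂(mulHaar μ)

/-- The cocharacter `-ε_i`: `x ↦ diag(1, …, x⁻¹, …, 1)`. -/
def negEps (F : Type*) [Field F] {n : ℕ} (i : Fin n) : Fˣ →* Torus F n :=
  (MonoidHom.mulSingle (fun _ : Fin n => Fˣ) i)⁻¹

/-- Multiplication by `ψ(-e^{-α_i})`, that is by `ψ(-t_{i+1}/t_i)`, for a simple root `α_i`;
for the last index `i`, where there is no such root, the identity. -/
def mulPsiRoot (ψ : AddChar F Circle) (i : Fin n) (f : Torus F n → ℂ) : Torus F n → ℂ :=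
  fun t => if h : i.val + 1 < n then
    (ψ (-((t ⟨i.val + 1, h⟩ : F) / (t i : F))) : ℂ) * f t else f t

/-- `ℱ_{-ε_i,1/2} ∘ ψ(-e^{-α_i})` (just `ℱ_{-ε_n,1/2}` for the last index). -/
def hankelStep (ψ : AddChar F Circle) (μ : Measure F) (i : Fin n) (f : Torus F n → ℂ) :
    Torus F n → ℂ :=
  eqFourier ψ μ (negEps F i) (1 / 2) (mulPsiRoot ψ i f)

/-- The composite of the operators `hankelStep` with (zero-based) indices `k, k+1, …, n-1`, the one
with index `n-1` being applied first. -/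
def hankelFrom (ψ : AddChar F Circle) (μ : Measure F) (k : ℕ) (f : Torus F n → ℂ) :
    Torus F n → ℂ :=
  ((List.finRange n).drop k).foldr (hankelStep ψ μ) f

/-- `ℱ_{-ε_1,1/2} ∘ ψ(-e^{-α_1}) ∘ ℱ_{-ε_2,1/2} ∘ ⋯ ∘ ψ(-e^{-α_{n-1}}) ∘ ℱ_{-ε_n,1/2}`. -/
def hankelFormula (ψ : AddChar F Circle) (μ : Measure F) (f : Torus F n → ℂ) : Torus F n → ℂ :=
  hankelFrom ψ μ 0 f

/-- All the integrals in `hankelFormula ψ μ f` converge absolutely, at every point. -/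
def HankelConverges (ψ : AddChar F Circle) (μ : Measure F) (f : Torus F n → ℂ) : Prop :=
  ∀ (i : Fin n) (t : Torus F n),
    Integrable (eqFourierIntegrand ψ (negEps F i) (1 / 2)
      (mulPsiRoot ψ i (hankelFrom ψ μ (i.val + 1) f)) t) (mulHaar μ)

end

end Kuznetsov

/-! The proof is an induction on the size, peeling off the last torus coordinate. In size m+1 write
the torus element as (t, s), let n₁ have first row (1, r) and lower block n₁', and let n₂ have last
column (b, 1) and upper block n₂'. Then n₁ w (t, s) n₂ has lower left block X = n₁' w t n₂', first
row r w t n₂', last column n₁' w t b, and corner r w t b + s (`bruhat_tsnoc`). So s enters only the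
corner, additively, and the transform along -ε_{m+1}, which replaces s by xs and integrates against
ψ(x), is a partial Fourier transform in the corner at frequency s⁻¹.

Translating the corner by r w t b leaves a phase bilinear in (r, b). An affine substitution b = b(β)
(`phase_lastShift`) turns the r-integral into a Fourier transform of the first row at frequency β,
with the last column evaluated at -s(Xβ + e₁), and releases the scalar ψ(s/t_m). Fourier inversion
in the last column, with dual variable γ, expresses this evaluation as an integral of Schwartz
functions of X. Hence the transformed push-forward at (t, s) is ψ(s/t_m) times the push-forward at t
of a Schwartz function `descend` on smaller matrices (`eqFourier_last_pushMat`). The factor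
ψ(-e^{-α_m}) cancels exactly this scalar, and the remaining transforms fix s, so the induction
hypothesis applies for each s separately.

On the dual side, g ↦ g⁻¹ identifies the push-forward with the ordinary one for ψ⁻¹ at the reversed
inverse torus element (`pushMatDual_eq`), where s⁻¹ comes first. The phase sγXβ in `descend` is the
trace of X against a rank one matrix, so the Fourier transform of `descend` integrates that of Φ
over Y + sβγᵗ, which is the shape of a Bruhat element with s⁻¹ in the other corner (`bruhat_tcons`).
Thus push-forwards of Fourier transforms obey the same recursion (`pushMat_fourierMat_tcons`), and
`hankel_pushMat` follows.

The analysis rests on one class of functions, `IsSB`, stable under injective affine pull-back,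
partial Fourier transform and multiplication by ψ of a polynomial. Its members are dominated by
products of integrable functions of the matrix entries, which gives absolute convergence and all
uses of Fubini. Finally, the formula shows that the kernel of the push-forward lies in the kernel of
its Fourier-dual counterpart; the formula for ψ⁻¹ gives the reverse inclusion. Equal kernels yield
the isomorphism of images. -/

namespace Kuznetsov

/-! ### Partial Fourier transforms of Schwartz functions on real vector spaces -/

noncomputable section

open scoped SchwartzMap LineDeriv

/-- A set of bounded functions on a finite-dimensional real vector space that is stable under
directional derivatives and under multiplication by linear forms consists of Schwartz functions. -/
theorem exists_schwartzMap_of_closed {E : Type*} [NormedAddCommGroup E] [NormedSpace ℝ E]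
    [FiniteDimensional ℝ E] (S : Set (E → ℂ)) (hb : ∀ f ∈ S, ∃ C : ℝ, ∀ x, ‖f x‖ ≤ C)
    (hm : ∀ f ∈ S, ∀ l : E →L[ℝ] ℝ, (fun x => (l x : ℂ) * f x) ∈ S)
    (hd : ∀ f ∈ S, Differentiable ℝ f ∧ ∀ v, (fun x => fderiv ℝ f x v) ∈ S) {f : E → ℂ}
    (hf : f ∈ S) : ∃ g : 𝓢(E, ℂ), ∀ x, g x = f x := by
  classical
  let b := Module.finBasis ℝ E
  let c : Fin (Module.finrank ℝ E) → E →L[ℝ] ℝ := fun i => LinearMap.toContinuousLinearMap (b.coord i)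
  have hsum : ∀ x : E, ∑ i, c i x • b i = x := fun x => b.sum_repr x
  let R : Fin (Module.finrank ℝ E) → ℂ →L[ℝ] E →L[ℝ] ℂ :=
    fun i => ContinuousLinearMap.smulRightL ℝ E ℂ (c i)
  -- The derivative is a fixed linear combination of the directional derivatives along a basis, and
  -- these lie in S again. Both inductions on the order of differentiation run on this identity.
  have hfd : ∀ f ∈ S, fderiv ℝ f = fun x => ∑ i, R i (fderiv ℝ f x (b i)) := by
    intro f _
    ext x v
    conv_lhs => rw [← hsum v]
    simp [R, ContinuousLinearMap.smulRightL]
  have hA : ∀ n : ℕ, ∀ f ∈ S, ContDiff ℝ n f := by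
    intro n
    induction n with
    | zero => exact fun f hf => contDiff_zero.2 (hd f hf).1.continuous
    | succ n ih =>
      intro f hf
      refine (contDiff_succ_iff_fderiv (n := n)).2 ⟨(hd f hf).1, by simp, ?_⟩
      rw [hfd f hf]
      exact ContDiff.sum fun i _ => (R i).contDiff.comp (ih _ ((hd f hf).2 (b i)))
  -- Powers of ‖x‖ are traded one at a time for multiplications by coordinate forms, under which S
  -- is stable.
  have hB0 : ∀ k : ℕ, ∀ f ∈ S, ∃ C : ℝ, ∀ x, ‖x‖ ^ k * ‖f x‖ ≤ C := by
    intro k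
    induction k with
    | zero => simpa using hb
    | succ k ih =>
      intro f hf
      choose C hC using fun i => ih _ (hm f hf (c i))
      refine ⟨∑ i, ‖b i‖ * C i, fun x => ?_⟩
      have h1 : ‖x‖ ≤ ∑ i, ‖b i‖ * ‖c i x‖ := by
        conv_lhs => rw [← hsum x]
        refine (norm_sum_le _ _).trans (Finset.sum_le_sum fun i _ => ?_)
        rw [norm_smul, mul_comm]
      calc ‖x‖ ^ (k + 1) * ‖f x‖ = ‖x‖ * (‖x‖ ^ k * ‖f x‖) := by ring
        _ ≤ (∑ i, ‖b i‖ * ‖c i x‖) * (‖x‖ ^ k * ‖f x‖) := by gcongr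
        _ = ∑ i, ‖b i‖ * (‖x‖ ^ k * ‖(c i x : ℂ) * f x‖) := by
          rw [Finset.sum_mul]
          refine Finset.sum_congr rfl fun i _ => ?_
          rw [norm_mul, Complex.norm_real]
          ring
        _ ≤ _ := by
          gcongr with i
          exact hC i x
  have hB : ∀ n : ℕ, ∀ f ∈ S, ∀ k : ℕ, ∃ C : ℝ, ∀ x, ‖x‖ ^ k * ‖iteratedFDeriv ℝ n f x‖ ≤ C := by
    intro n
    induction n with
    | zero => simpa using fun f hf k => hB0 k f hf
    | succ n ih =>
      intro f hf k
      choose C hC using fun i => ih _ ((hd f hf).2 (b i)) k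
      refine ⟨∑ i, ‖R i‖ * C i, fun x => ?_⟩
      rw [← norm_iteratedFDeriv_fderiv, hfd f hf]
      have h2 : ∀ i, ContDiff ℝ n fun x => fderiv ℝ f x (b i) := fun i =>
        hA n _ ((hd f hf).2 (b i))
      rw [iteratedFDeriv_fun_sum_apply (f := fun i x => R i (fderiv ℝ f x (b i))) fun i _ => ((R i).contDiff.comp (h2 i)).contDiffAt]
      calc _ ≤ ‖x‖ ^ k * ∑ i, ‖R i‖ * ‖iteratedFDeriv ℝ n (fun x => fderiv ℝ f x (b i)) x‖ := by
            gcongr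
            refine (norm_sum_le _ _).trans (Finset.sum_le_sum fun i _ => ?_)
            exact (R i).norm_iteratedFDeriv_comp_left (h2 i).contDiffAt le_rfl
        _ = ∑ i, ‖R i‖ * (‖x‖ ^ k * ‖iteratedFDeriv ℝ n (fun x => fderiv ℝ f x (b i)) x‖) := by
            rw [Finset.mul_sum]
            exact Finset.sum_congr rfl fun i _ => by ring
        _ ≤ _ := by
          gcongr with i
          exact hC i x
  exact ⟨⟨f, contDiff_infty.2 fun n => hA n f hf, fun k n => hB n f hf k⟩, fun _ => rfl⟩

section PartialFourier

set_option linter.unusedSectionVars false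

variable {E E' G : Type*} [NormedAddCommGroup E] [NormedSpace ℝ E] [FiniteDimensional ℝ E]
  [MeasurableSpace E] [BorelSpace E] [NormedAddCommGroup E'] [NormedSpace ℝ E']
  [FiniteDimensional ℝ E'] [NormedAddCommGroup G] [NormedSpace ℝ G] [FiniteDimensional ℝ G]

/-- The decay in x is uniform in w, so it gives one integrable majorant in x for the whole family of
integrands with parameter w. -/
theorem schwartzMap_prod_decay (f : 𝓢(E × G, ℂ)) (n : ℕ) (r : ℕ) :
    ∃ C : ℝ, 0 ≤ C ∧ ∀ x w, ‖iteratedFDeriv ℝ n f (x, w)‖ ≤ C * (1 + ‖x‖) ^ (-(r : ℝ)) := by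
  let A : ℝ := 2 ^ r * ((Finset.Iic (r, n)).sup fun m => SchwartzMap.seminorm ℝ m.1 m.2) f
  have hA : 0 ≤ A := by positivity
  refine ⟨A, hA, fun x w => ?_⟩
  have h := SchwartzMap.one_add_le_sup_seminorm_apply (𝕜 := ℝ) (m := (r, n)) le_rfl le_rfl f (x, w)
  have h1 : (1 + ‖x‖) ^ r * ‖iteratedFDeriv ℝ n f (x, w)‖ ≤ A :=
    le_trans (by gcongr; exact norm_fst_le (x, w)) h
  rw [Real.rpow_neg (by positivity), Real.rpow_natCast, ← div_eq_mul_inv,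
    le_div_iff₀ (by positivity), mul_comm]
  exact h1

/-- The partial Fourier transform of a function on `E × G` in the first variable. -/
def partialFourier (L : E →L[ℝ] E' →L[ℝ] ℝ) (ν : Measure E) (f : E × G → ℂ) (p : E' × G) : ℂ :=
  ∫ x, f (x, p.2) * Complex.exp ((L x p.1 : ℝ) * Complex.I) ∂ν

variable (L : E →L[ℝ] E' →L[ℝ] ℝ) (ν : Measure E) [ν.IsAddHaarMeasure]

theorem integrable_one_add_norm_dim :
    Integrable (fun x : E => (1 + ‖x‖) ^ (-((Module.finrank ℝ E + 1 : ℕ) : ℝ))) ν :=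
  integrable_one_add_norm (by push_cast; linarith)

theorem partialFourier_integrable (f : 𝓢(E × G, ℂ)) (p : E' × G) :
    Integrable (fun x => f (x, p.2) * Complex.exp ((L x p.1 : ℝ) * Complex.I)) ν := by
  obtain ⟨C, hC, h⟩ := schwartzMap_prod_decay f 0 (Module.finrank ℝ E + 1)
  refine ((integrable_one_add_norm_dim ν).const_mul C).mono' ?_ (.of_forall fun x => ?_)
  · exact Continuous.aestronglyMeasurable (by have := f.continuous; fun_prop)
  · simpa [Complex.norm_exp_ofReal_mul_I] using h x p.2

theorem partialFourier_bounded (f : 𝓢(E × G, ℂ)) :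
    ∃ C : ℝ, ∀ p, ‖partialFourier L ν f p‖ ≤ C := by
  obtain ⟨C, hC, h⟩ := schwartzMap_prod_decay f 0 (Module.finrank ℝ E + 1)
  refine ⟨∫ x, C * (1 + ‖x‖) ^ (-((Module.finrank ℝ E + 1 : ℕ) : ℝ)) ∂ν, fun p => ?_⟩
  refine norm_integral_le_of_norm_le ((integrable_one_add_norm_dim ν).const_mul C)
    (.of_forall fun x => ?_)
  simpa [Complex.norm_exp_ofReal_mul_I] using h x p.2

theorem partialFourier_add (f g : 𝓢(E × G, ℂ)) (p : E' × G) :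
    partialFourier L ν (f + g : 𝓢(E × G, ℂ)) p =
      partialFourier L ν f p + partialFourier L ν g p := by
  simp only [partialFourier, add_apply, add_mul]
  exact integral_add (partialFourier_integrable L ν f p) (partialFourier_integrable L ν g p)

/-- The part of the form living on E' is L a for some a, since L is onto the dual; multiplying by it
is a derivative of f in the direction a, by parts. The part living on G commutes with the integral.
-/
theorem exists_mul_partialFourier (hL : ∀ l : E' →L[ℝ] ℝ, ∃ a, L a = l) (f : 𝓢(E × G, ℂ))
    (l : E' × G →L[ℝ] ℝ) : ∃ g : 𝓢(E × G, ℂ), ∀ p,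
      partialFourier L ν g p = (l p : ℂ) * partialFourier L ν f p := by
  obtain ⟨a, ha⟩ := hL (l.comp (.inl ℝ E' G))
  let l₂ : E × G →L[ℝ] ℝ := (l.comp (.inr ℝ E' G)).comp (.snd ℝ E G)
  refine ⟨Complex.I • ∂_{(a, (0 : G))} f + SchwartzMap.smulLeftCLM ℂ (fun p => (l₂ p : ℝ)) f,
    fun p => ?_⟩
  rw [partialFourier_add]
  have hp : l p = L a p.1 + l₂ (0, p.2) := by
    rw [ha]
    simp only [l₂, ContinuousLinearMap.comp_apply, ContinuousLinearMap.inl_apply,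
      ContinuousLinearMap.inr_apply, ContinuousLinearMap.coe_snd']
    rw [← map_add]
    simp
  have h2 : partialFourier L ν (SchwartzMap.smulLeftCLM ℂ (fun p => (l₂ p : ℝ)) f) p =
      (l₂ (0, p.2) : ℂ) * partialFourier L ν f p := by
    simp only [partialFourier]
    rw [← integral_const_mul]
    congr 1 with x
    rw [SchwartzMap.smulLeftCLM_apply_apply l₂.hasTemperateGrowth]
    simp [l₂, mul_assoc]
  let u : E → ℂ := fun x => f (x, p.2)
  let e : E → ℂ := fun x => Complex.exp ((L x p.1 : ℝ) * Complex.I)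
  have hu : ∀ x, HasFDerivAt u ((fderiv ℝ f (x, p.2)).comp (.inl ℝ E G)) x := fun x =>
    (f.hasFDerivAt (x, p.2)).comp x (hasFDerivAt_prodMk_left x p.2)
  let Lp : E →L[ℝ] ℝ := L.flip p.1
  have he : ∀ x, HasFDerivAt e (e x • (Complex.I • (Complex.ofRealCLM.comp Lp))) x := by
    intro x
    have h1 : HasFDerivAt (fun x => ((L x p.1 : ℝ) : ℂ) * Complex.I)
        (Complex.I • (Complex.ofRealCLM.comp Lp)) x :=
      ((Complex.ofRealCLM.comp Lp).hasFDerivAt (x := x)).mul_const Complex.I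
    exact h1.cexp
  have hu' : ∀ x, fderiv ℝ u x a = ∂_{(a, (0 : G))} f (x, p.2) := fun x => by
    rw [(hu x).fderiv, SchwartzMap.lineDerivOp_apply_eq_fderiv]; simp
  have he' : ∀ x, fderiv ℝ e x a = e x * (Complex.I * (L a p.1 : ℝ)) := fun x => by
    rw [(he x).fderiv]; simp [Lp]
  have h1 : partialFourier L ν (Complex.I • ∂_{(a, (0 : G))} f : 𝓢(E × G, ℂ)) p =
      (L a p.1 : ℂ) * partialFourier L ν f p := by
    have hi := partialFourier_integrable L ν f p
    -- Integration by parts along a, moving the derivative from f to the exponential.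
    have key := integral_mul_fderiv_eq_neg_fderiv_mul_of_integrable (𝕜 := ℂ) (μ := ν) (v := a)
      (f := u) (g := e) ?_ ?_ hi (fun x _ => (hu x).differentiableAt)
      (fun x _ => (he x).differentiableAt)
    · simp only [hu', he'] at key
      simp only [partialFourier, smul_apply, smul_eq_mul, mul_assoc]
      rw [integral_const_mul]
      have h3 : ∫ x, ∂_{(a, (0 : G))} f (x, p.2) * Complex.exp ((L x p.1 : ℝ) * Complex.I) ∂ν =
          -(Complex.I * (L a p.1 : ℝ) * ∫ x, u x * e x ∂ν) := by
        rw [← integral_const_mul, eq_neg_iff_add_eq_zero, add_comm, ← eq_neg_iff_add_eq_zero]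
        refine Eq.trans (integral_congr_ae (.of_forall fun x => ?_)) key
        ring
      rw [h3]
      simp only [u, e]
      linear_combination (- (L a p.1 : ℂ) * ∫ x, f (x, p.2) * Complex.exp ((L x p.1 : ℝ) * Complex.I) ∂ν) * Complex.I_mul_I
    · simp only [hu']
      exact partialFourier_integrable L ν (∂_{(a, (0 : G))} f) p
    · simp only [he']
      refine (hi.mul_const (Complex.I * (L a p.1 : ℝ))).congr (.of_forall fun x => ?_)
      simp only [u, e]; ring
  rw [h1, h2, hp]
  push_cast
  ring

/-- Differentiation under the integral sign: in the E' direction it brings down a linear form in x,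
in the G direction it falls on f. Both results are partial transforms of Schwartz functions. -/
theorem exists_fderiv_partialFourier (f : 𝓢(E × G, ℂ)) :
    Differentiable ℝ (partialFourier L ν f) ∧ ∀ v : E' × G, ∃ g : 𝓢(E × G, ℂ), ∀ p,
      partialFourier L ν g p = fderiv ℝ (partialFourier L ν f) p v := by
  let e : E' × G → E → ℂ := fun p x => Complex.exp ((L x p.1 : ℝ) * Complex.I)
  let F' : E' × G → E → (E' × G →L[ℝ] ℂ) := fun p x =>
    f (x, p.2) • (e p x • (Complex.I • (Complex.ofRealCLM.comp ((L x).comp (.fst ℝ E' G))))) +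
      e p x • (fderiv ℝ f (x, p.2)).comp ((ContinuousLinearMap.inr ℝ E G).comp (.snd ℝ E' G))
  have hF' : ∀ p x, HasFDerivAt (fun p : E' × G => f (x, p.2) * e p x) (F' p x) p := by
    intro p x
    have h1 : HasFDerivAt (fun p : E' × G => f (x, p.2))
        ((fderiv ℝ f (x, p.2)).comp ((ContinuousLinearMap.inr ℝ E G).comp (.snd ℝ E' G))) p :=
      (f.hasFDerivAt (x, p.2)).comp p ((hasFDerivAt_prodMk_right x p.2).comp p hasFDerivAt_snd)
    have h2 : HasFDerivAt (fun p : E' × G => ((L x p.1 : ℝ) : ℂ) * Complex.I)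
        (Complex.I • (Complex.ofRealCLM.comp ((L x).comp (.fst ℝ E' G)))) p :=
      ((Complex.ofRealCLM.comp ((L x).comp (.fst ℝ E' G))).hasFDerivAt (x := p)).mul_const _
    exact h1.mul h2.cexp
  -- One more power of decay than integrability needs: it absorbs the factor ‖x‖ that appears when
  -- the exponential is differentiated.
  obtain ⟨C₀, hC₀, h₀⟩ := schwartzMap_prod_decay f 0 (Module.finrank ℝ E + 2)
  obtain ⟨C₁, hC₁, h₁⟩ := schwartzMap_prod_decay f 1 (Module.finrank ℝ E + 1)
  have hcont : ∀ p, Continuous (F' p) := by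
    intro p
    have hf := f.continuous
    have hf' : Continuous (fderiv ℝ f) := (f.smooth 1).continuous_fderiv (by simp)
    have he : Continuous (e p) := by fun_prop
    refine Continuous.add ((hf.comp (by fun_prop)).smul (he.smul (Continuous.const_smul ?_ Complex.I)))
      (he.smul ?_)
    · exact continuous_const.clm_comp (L.continuous.clm_comp continuous_const)
    · exact (hf'.comp (by fun_prop)).clm_comp continuous_const
  have hen : ∀ p x, ‖e p x‖ = 1 := fun p x => by simp [e, Complex.norm_exp_ofReal_mul_I]
  have hbound : ∀ p x, ‖F' p x‖ ≤
      (C₀ * ‖L‖ + C₁) * (1 + ‖x‖) ^ (-((Module.finrank ℝ E + 1 : ℕ) : ℝ)) := by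
    intro p x
    have hx : (0 : ℝ) < 1 + ‖x‖ := by positivity
    have a1 : ‖(Complex.ofRealCLM.comp ((L x).comp (.fst ℝ E' G)))‖ ≤ ‖L‖ * (1 + ‖x‖) := by
      refine (ContinuousLinearMap.opNorm_comp_le _ _).trans ?_
      rw [Complex.ofRealCLM_norm, one_mul]
      refine (ContinuousLinearMap.opNorm_comp_le _ _).trans ?_
      have := ContinuousLinearMap.norm_fst_le (𝕜 := ℝ) E' G
      calc ‖L x‖ * ‖ContinuousLinearMap.fst ℝ E' G‖ ≤ (‖L‖ * ‖x‖) * 1 := by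
            gcongr; exact L.le_opNorm x
        _ ≤ _ := by rw [mul_one]; gcongr; linarith
    have a2 : ‖(fderiv ℝ f (x, p.2)).comp
        ((ContinuousLinearMap.inr ℝ E G).comp (.snd ℝ E' G))‖ ≤ ‖fderiv ℝ f (x, p.2)‖ := by
      refine ContinuousLinearMap.opNorm_le_bound _ (norm_nonneg _) fun q => ?_
      refine ((fderiv ℝ f (x, p.2)).le_opNorm _).trans ?_
      gcongr
      simpa using norm_snd_le q
    have a3 := h₀ x p.2
    have a4 := h₁ x p.2
    rw [norm_iteratedFDeriv_zero] at a3
    rw [norm_iteratedFDeriv_one] at a4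
    have a5 : (1 + ‖x‖) ^ (-((Module.finrank ℝ E + 2 : ℕ) : ℝ)) * (1 + ‖x‖) =
        (1 + ‖x‖) ^ (-((Module.finrank ℝ E + 1 : ℕ) : ℝ)) := by
      nth_rw 2 [← Real.rpow_one (1 + ‖x‖)]
      rw [← Real.rpow_add hx]
      congr 1
      push_cast
      ring
    calc ‖F' p x‖ ≤ ‖f (x, p.2)‖ * (‖L‖ * (1 + ‖x‖)) + ‖fderiv ℝ f (x, p.2)‖ := by
          refine (norm_add_le _ _).trans ?_
          rw [norm_smul, norm_smul, norm_smul, norm_smul, hen, Complex.norm_I, one_mul, one_mul,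
            one_mul]
          gcongr
      _ ≤ C₀ * (1 + ‖x‖) ^ (-((Module.finrank ℝ E + 2 : ℕ) : ℝ)) * (‖L‖ * (1 + ‖x‖)) +
          C₁ * (1 + ‖x‖) ^ (-((Module.finrank ℝ E + 1 : ℕ) : ℝ)) := by gcongr
      _ = _ := by rw [← a5]; ring
  have hint : ∀ p, Integrable (F' p) ν := fun p =>
    ((integrable_one_add_norm_dim ν).const_mul (C₀ * ‖L‖ + C₁)).mono'
      (hcont p).aestronglyMeasurable (.of_forall fun x => hbound p x)
  have hder : ∀ p, HasFDerivAt (partialFourier L ν f) (∫ x, F' p x ∂ν) p := by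
    intro p
    refine hasFDerivAt_integral_of_dominated_of_fderiv_le (s := Set.univ) Filter.univ_mem
      (.of_forall fun q => (partialFourier_integrable L ν f q).aestronglyMeasurable)
      (partialFourier_integrable L ν f p) (hcont p).aestronglyMeasurable
      (.of_forall fun x q _ => hbound q x)
      ((integrable_one_add_norm_dim ν).const_mul (C₀ * ‖L‖ + C₁))
      (.of_forall fun x q _ => hF' q x)
  refine ⟨fun p => (hder p).differentiableAt, fun v => ?_⟩
  let l : E × G →L[ℝ] ℝ := (L.flip v.1).comp (.fst ℝ E G)
  refine ⟨Complex.I • SchwartzMap.smulLeftCLM ℂ (fun p => (l p : ℝ)) f + ∂_{((0 : E), v.2)} f,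
    fun p => ?_⟩
  rw [(hder p).fderiv, ContinuousLinearMap.integral_apply (hint p)]
  simp only [partialFourier]
  congr 1 with x
  rw [add_apply, smul_apply,
    SchwartzMap.smulLeftCLM_apply_apply l.hasTemperateGrowth,
    SchwartzMap.lineDerivOp_apply_eq_fderiv]
  simp [F', e, l]
  ring

/-- The partial Fourier transform of a Schwartz function is a Schwartz function. -/
theorem exists_schwartzMap_partialFourier (hL : ∀ l : E' →L[ℝ] ℝ, ∃ a, L a = l)
    (f : 𝓢(E × G, ℂ)) : ∃ g : 𝓢(E' × G, ℂ), ∀ p, g p = partialFourier L ν f p := by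
  refine exists_schwartzMap_of_closed
    (Set.range fun f : 𝓢(E × G, ℂ) => partialFourier L ν f) ?_ ?_ ?_ ⟨f, rfl⟩
  · rintro _ ⟨f, rfl⟩
    exact partialFourier_bounded L ν f
  · rintro _ ⟨f, rfl⟩ l
    obtain ⟨g, hg⟩ := exists_mul_partialFourier L ν hL f l
    exact ⟨g, funext hg⟩
  · rintro _ ⟨f, rfl⟩
    obtain ⟨h1, h2⟩ := exists_fderiv_partialFourier L ν f
    refine ⟨h1, fun v => ?_⟩
    obtain ⟨g, hg⟩ := h2 v
    exact ⟨g, funext hg⟩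

end PartialFourier

end

end Kuznetsov

/-! ### Continuous unitary characters of real vector spaces -/

namespace Kuznetsov

noncomputable section

open scoped SchwartzMap

/-- A continuous unitary character of `ℝ` is an exponential. -/
theorem exists_exp_of_real_addChar (χ : AddChar ℝ Circle) (hχ : Continuous χ) :
    ∃ c : ℝ, ∀ x, (χ x : ℂ) = Complex.exp ((x * c : ℝ) * Complex.I) := by
  let h : ℝ → ℂ := fun x => χ x
  have hc : Continuous h := continuous_subtype_val.comp hχ
  have hadd : ∀ x y, h (x + y) = h x * h y := fun x y => by
    simp [h, AddChar.map_add_eq_mul]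
  have h0 : h 0 = 1 := by simp [h]
  let H : ℝ → ℂ := fun x => ∫ y in (0 : ℝ)..x, h y
  have hH : ∀ x, HasDerivAt H (h x) x := fun x =>
    intervalIntegral.integral_hasDerivAt_right (hc.intervalIntegrable _ _)
      (hc.stronglyMeasurableAtFilter _ _) hc.continuousAt
  -- The primitive H cannot vanish identically because h 0 = 1. At such a point, multiplicativity
  -- writes h as a difference of translates of H divided by H a, which makes h differentiable.
  obtain ⟨a, ha⟩ : ∃ a, H a ≠ 0 := by
    by_contra hne
    push Not at hne
    have h1 := hH 0
    rw [show H = fun _ => 0 from funext hne, h0] at h1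
    exact zero_ne_one ((hasDerivAt_const (0 : ℝ) (0 : ℂ)).unique h1)
  have hshift : ∀ x, h x = (H (x + a) - H x) / H a := by
    intro x
    rw [eq_div_iff ha]
    have h1 : h x * H a = ∫ y in (0 : ℝ)..a, h (x + y) := by
      simp only [hadd]
      rw [intervalIntegral.integral_const_mul]
    rw [h1, intervalIntegral.integral_comp_add_left (fun y => h y), add_zero]
    exact (intervalIntegral.integral_interval_sub_left (hc.intervalIntegrable _ _)
      (hc.intervalIntegrable _ _)).symm
  have hdiff : ∀ x, DifferentiableAt ℝ h x := by
    intro x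
    rw [show h = fun x => (H (x + a) - H x) / H a from funext hshift]
    exact ((((hH (x + a)).comp_add_const x a).sub (hH x)).div_const _).differentiableAt
  set l := deriv h 0 with hl
  have hder : ∀ x, HasDerivAt h (h x * l) x := by
    intro x
    have h1 : HasDerivAt (fun y => h x * h y) (h x * l) 0 := (hdiff 0).hasDerivAt.const_mul _
    simp only [← hadd] at h1
    have h2 := HasDerivAt.comp_add_const (f := fun y => h (x + y)) x (-x) (by simpa using h1)
    simpa using h2
  -- The function h satisfies h' = l h, so h(x) exp(-lx) has zero derivative. Unitarity then forces
  -- l to be imaginary.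
  have hexp : ∀ x : ℝ, h x = Complex.exp (x * l) := by
    have hz : ∀ x : ℝ, HasDerivAt (fun x : ℝ => h x * Complex.exp (-(x * l))) 0 x := by
      intro x
      have h1 : HasDerivAt (fun x : ℝ => -((x : ℂ) * l)) (-(1 * l)) x :=
        ((Complex.ofRealCLM.hasDerivAt (x := x)).mul_const l).neg
      have h2 := (hder x).mul h1.cexp
      refine h2.congr_deriv ?_
      ring
    intro x
    have h3 := is_const_of_deriv_eq_zero (fun x => (hz x).differentiableAt)
      (fun x => (hz x).deriv) x 0
    simp only [h0, Complex.ofReal_zero, zero_mul, neg_zero, Complex.exp_zero, mul_one] at h3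
    rw [Complex.exp_neg] at h3
    exact (mul_inv_eq_one₀ (Complex.exp_ne_zero _)).1 h3
  have hre : l.re = 0 := by
    have h1 : ‖h 1‖ = 1 := Circle.norm_coe _
    rw [hexp, Complex.norm_exp] at h1
    simpa using h1
  refine ⟨l.im, fun x => (hexp x).trans ?_⟩
  congr 1
  apply Complex.ext <;> simp [hre]

/-- A continuous unitary character of `ℝᵏ` is the exponential of a linear form. -/
theorem exists_exp_of_addChar {k : ℕ} (χ : AddChar (Fin k → ℝ) Circle) (hχ : Continuous χ) :
    ∃ φ : (Fin k → ℝ) →L[ℝ] ℝ, ∀ x, (χ x : ℂ) = Complex.exp ((φ x : ℝ) * Complex.I) := by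
  have h1 : ∀ i : Fin k, ∃ c : ℝ, ∀ x : ℝ, (χ (Pi.single i x) : ℂ) =
      Complex.exp ((x * c : ℝ) * Complex.I) := by
    intro i
    let χi : AddChar ℝ Circle :=
      { toFun := fun x => χ (Pi.single i x)
        map_zero_eq_one' := by simp
        map_add_eq_mul' := fun x y => by rw [Pi.single_add, AddChar.map_add_eq_mul] }
    exact exists_exp_of_real_addChar χi (hχ.comp (ContinuousLinearMap.single ℝ (fun _ => ℝ) i).continuous)
  choose c hc using h1
  refine ⟨∑ i, c i • ContinuousLinearMap.proj i, fun x => ?_⟩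
  have h2 : χ x = ∏ i, χ (Pi.single i (x i)) := by
    conv_lhs => rw [← Finset.univ_sum_single x]
    exact map_sum χ.toAddMonoidHom _ _
  rw [h2]
  have h3 : ((∏ i, χ (Pi.single i (x i)) : Circle) : ℂ) = ∏ i, (χ (Pi.single i (x i)) : ℂ) :=
    map_prod Circle.coeHom _ _
  rw [h3]
  simp only [hc]
  rw [← Complex.exp_sum]
  congr 1
  simp [Finset.sum_mul, mul_comm (c _ : ℂ)]

end

end Kuznetsov

/-! ### Schwartz–Bruhat functions: affine pull-back and polynomial phases -/

namespace Kuznetsov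

noncomputable section

open scoped SchwartzMap

set_option linter.unusedSectionVars false

/-- A continuous bi-additive map on finite-dimensional real spaces, as a real bilinear map. -/
def realBilin {E E' G : Type*} [NormedAddCommGroup E] [NormedSpace ℝ E] [FiniteDimensional ℝ E]
    [NormedAddCommGroup E'] [NormedSpace ℝ E'] [FiniteDimensional ℝ E']
    [NormedAddCommGroup G] [NormedSpace ℝ G]
    (b : E → E' → G) (hl : ∀ y, Continuous fun x => b x y) (hr : ∀ x, Continuous (b x))
    (hal : ∀ x x' y, b (x + x') y = b x y + b x' y)
    (har : ∀ x y y', b x (y + y') = b x y + b x y') : E →L[ℝ] E' →L[ℝ] G :=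
  LinearMap.toContinuousLinearMap
    { toFun := fun x => (AddMonoidHom.mk' (b x) (har x)).toRealLinearMap (hr x)
      map_add' := fun x x' => by ext y; exact hal x x' y
      map_smul' := fun c x => by
        ext y
        exact ((AddMonoidHom.mk' (fun x => b x y) (fun x x' => hal x x' y)).toRealLinearMap
          (hl y)).map_smul c x }

/-- The additive group of `F` is topologically isomorphic to some `ℝᵈ`. -/
def IsArch (F : Type*) [NontriviallyNormedField F] : Prop :=
  ∃ d : ℕ, Nonempty (F ≃ₜ+ (Fin d → ℝ))

/-- Schwartz–Bruhat functions on a finite-dimensional vector space over a local field. -/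
def IsSB (F : Type*) [NontriviallyNormedField F] {V : Type*} [NormedAddCommGroup V]
    (Φ : V → ℂ) : Prop :=
  (IsUltrametricDist F ∧ IsLocallyConstant Φ ∧ HasCompactSupport Φ) ∨
    (IsArch F ∧ ∃ (k : ℕ) (T : V ≃ₜ+ (Fin k → ℝ)) (g : 𝓢(Fin k → ℝ, ℂ)), ∀ v, Φ v = g (T v))

variable {F : Type*} [NontriviallyNormedField F] [ProperSpace F]

section charts

variable {V W : Type*} [NormedAddCommGroup V] [NormedSpace F V] [FiniteDimensional F V]
  [NormedAddCommGroup W] [NormedSpace F W] [FiniteDimensional F W]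

theorem exists_chart (hF : IsArch F) (V : Type*) [NormedAddCommGroup V] [NormedSpace F V]
    [FiniteDimensional F V] : ∃ k : ℕ, Nonempty (V ≃ₜ+ (Fin k → ℝ)) := by
  obtain ⟨d, ⟨T⟩⟩ := hF
  let b : V ≃L[F] (Fin (Module.finrank F V) → F) :=
    ContinuousLinearEquiv.ofFinrankEq (by simp)
  let e : (Fin (Module.finrank F V) → Fin d → ℝ) ≃L[ℝ]
      (Fin (Module.finrank ℝ (Fin (Module.finrank F V) → Fin d → ℝ)) → ℝ) :=
    ContinuousLinearEquiv.ofFinrankEq (by simp)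
  let t : (Fin (Module.finrank F V) → F) ≃ₜ+ (Fin (Module.finrank F V) → Fin d → ℝ) :=
    { toFun := fun v i => T (v i)
      invFun := fun v i => T.symm (v i)
      left_inv := fun v => by simp
      right_inv := fun v => by simp
      map_add' := fun v w => by ext; simp
      continuous_toFun := continuous_pi fun i => T.continuous.comp (continuous_apply i)
      continuous_invFun := continuous_pi fun i => T.symm.continuous.comp (continuous_apply i) }
  exact ⟨_, ⟨(b.toContinuousAddEquiv.trans t).trans e.toContinuousAddEquiv⟩⟩

/-- A continuous additive map is real linear, and an injective one out of a finite-dimensional space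
is antilipschitz, so composing with it preserves rapid decay. Only additivity is asked because the
charts are mere isomorphisms of topological groups. -/
theorem exists_schwartzMap_comp_injective {E E' : Type*} [NormedAddCommGroup E] [NormedSpace ℝ E]
    [FiniteDimensional ℝ E] [NormedAddCommGroup E'] [NormedSpace ℝ E'] (A : E →+ E')
    (hA : Continuous A) (hinj : Function.Injective A) (c : E') (g : 𝓢(E', ℂ)) :
    ∃ g' : 𝓢(E, ℂ), ∀ x, g' x = g (A x + c) := by
  let L := A.toRealLinearMap hA
  obtain ⟨K, -, hK⟩ := (L : E →ₗ[ℝ] E').exists_antilipschitzWith (LinearMap.ker_eq_bot.2 hinj)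
  have h1 : Function.HasTemperateGrowth fun x => L x + c :=
    L.hasTemperateGrowth.add (.const c)
  have h2 : AntilipschitzWith K fun x => L x + c := fun x y => by
    simpa using hK x y
  exact ⟨SchwartzMap.compCLMOfAntilipschitz ℂ h1 h2 g, fun x => rfl⟩

theorem exists_schwartzMap_of_chart {E : Type*} [NormedAddCommGroup E] [NormedSpace ℝ E]
    [FiniteDimensional ℝ E] {Φ : V → ℂ} (T : V ≃ₜ+ E) {k : ℕ} (T' : V ≃ₜ+ (Fin k → ℝ))
    (g : 𝓢(Fin k → ℝ, ℂ)) (hg : ∀ v, Φ v = g (T' v)) : ∃ g' : 𝓢(E, ℂ), ∀ v, Φ v = g' (T v) := by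
  obtain ⟨g', hg'⟩ := exists_schwartzMap_comp_injective
    (T'.toAddEquiv.toAddMonoidHom.comp T.symm.toAddEquiv.toAddMonoidHom)
    (T'.continuous.comp T.symm.continuous) (T'.injective.comp T.symm.injective) 0 g
  refine ⟨g', fun v => ?_⟩
  rw [hg', hg]
  change g (T' v) = g (T' (T.symm (T v)) + 0)
  simp

theorem IsSB.of_chart (hF : IsArch F) {E : Type*} [NormedAddCommGroup E] [NormedSpace ℝ E]
    [FiniteDimensional ℝ E] {Φ : V → ℂ} (T : V ≃ₜ+ E) (g : 𝓢(E, ℂ)) (hg : ∀ v, Φ v = g (T v)) :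
    IsSB F Φ := by
  let e : E ≃L[ℝ] (Fin (Module.finrank ℝ E) → ℝ) := ContinuousLinearEquiv.ofFinrankEq (by simp)
  refine .inr ⟨hF, _, T.trans e.toContinuousAddEquiv,
    SchwartzMap.compCLMOfContinuousLinearEquiv ℂ e.symm g, fun v => ?_⟩
  rw [hg]
  change g (T v) = g (e.symm (e (T v)))
  simp

/-- The pull-back of a Schwartz–Bruhat function under an injective affine map. -/
theorem IsSB.comp_affine {Φ : W → ℂ} (hΦ : IsSB F Φ) (L : V →ₗ[F] W)
    (hL : Function.Injective L) (c : W) : IsSB F fun v => Φ (L v + c) := by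
  have hLc : Continuous L := L.continuous_of_finiteDimensional
  rcases hΦ with ⟨hF, h1, h2⟩ | ⟨hF, k, T, g, hg⟩
  · refine .inl ⟨hF, h1.comp_continuous (hLc.add continuous_const), ?_⟩
    exact h2.comp_isClosedEmbedding ((Homeomorph.addRight c).isClosedEmbedding.comp
      (LinearMap.isClosedEmbedding_of_injective (LinearMap.ker_eq_bot.2 hL)))
  · obtain ⟨m, ⟨S⟩⟩ := exists_chart hF V
    obtain ⟨g', hg'⟩ := exists_schwartzMap_comp_injective
      ((T.toAddEquiv.toAddMonoidHom.comp L.toAddMonoidHom).comp S.symm.toAddEquiv.toAddMonoidHom)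
      (T.continuous.comp (hLc.comp S.symm.continuous))
      (T.injective.comp (hL.comp S.symm.injective)) (T c) g
    refine .inr ⟨hF, m, S, g', fun v => ?_⟩
    rw [hg']
    refine (hg _).trans ?_
    change g (T (L v + c)) = g (T (L (S.symm (S v))) + T c)
    simp

theorem IsSB.comp_linear {Φ : W → ℂ} (hΦ : IsSB F Φ) (L : V →ₗ[F] W)
    (hL : Function.Injective L) : IsSB F fun v => Φ (L v) := by
  simpa using hΦ.comp_affine L hL 0

theorem IsSB.continuous {Φ : V → ℂ} (hΦ : IsSB F Φ) : Continuous Φ := by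
  rcases hΦ with ⟨-, h1, -⟩ | ⟨-, k, T, g, hg⟩
  · exact h1.continuous
  · rw [show Φ = g ∘ T from funext hg]
    exact g.continuous.comp T.continuous

theorem IsSB.const_mul {Φ : V → ℂ} (hΦ : IsSB F Φ) (c : ℂ) : IsSB F fun v => c * Φ v := by
  rcases hΦ with ⟨hF, h1, h2⟩ | ⟨hF, k, T, g, hg⟩
  · exact .inl ⟨hF, h1.comp (c * ·), h2.mul_left (f := fun _ => c)⟩
  · exact .inr ⟨hF, k, T, c • g, fun v => by simp [hg]⟩

end charts

section characters

variable {V : Type*} [NormedAddCommGroup V] [NormedSpace F V] [FiniteDimensional F V]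

/-- The circle has no small subgroups: squaring u multiplies u - 1 by u + 1, which has absolute
value at least 3/2 near 1, so repeated squaring would push the distance from 1 past any bound. -/
theorem circle_eq_one_of_pow_near {z : Circle} (h : ∀ n : ℕ, ‖((z ^ n : Circle) : ℂ) - 1‖ ≤ 1 / 2) :
    z = 1 := by
  by_contra hz
  have h0 : 0 < ‖(z : ℂ) - 1‖ := by
    rw [norm_pos_iff, sub_ne_zero]
    exact fun h => hz (Circle.ext (by simpa using h))
  have key : ∀ n : ℕ, (3 / 2 : ℝ) ^ n * ‖(z : ℂ) - 1‖ ≤ ‖((z ^ 2 ^ n : Circle) : ℂ) - 1‖ := by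
    intro n
    induction n with
    | zero => simp
    | succ n ih =>
      have h1 := h (2 ^ n)
      set u : ℂ := ((z ^ 2 ^ n : Circle) : ℂ) with hu
      have h2 : ((z ^ 2 ^ (n + 1) : Circle) : ℂ) - 1 = (u - 1) * (u + 1) := by
        rw [hu, pow_succ, pow_mul]
        push_cast
        ring
      have h3 : (3 / 2 : ℝ) ≤ ‖u + 1‖ := by
        have : (2 : ℝ) ≤ ‖u + 1‖ + ‖u - 1‖ := by
          calc (2 : ℝ) = ‖(u + 1) - (u - 1)‖ := by norm_num
            _ ≤ _ := norm_sub_le _ _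
        linarith
      rw [h2, norm_mul]
      calc (3 / 2 : ℝ) ^ (n + 1) * ‖(z : ℂ) - 1‖ = ((3 / 2 : ℝ) ^ n * ‖(z : ℂ) - 1‖) * (3 / 2) := by
            ring
        _ ≤ _ := by gcongr
  obtain ⟨n, hn⟩ := pow_unbounded_of_one_lt (1 / ‖(z : ℂ) - 1‖) (by norm_num : (1 : ℝ) < 3 / 2)
  rw [div_lt_iff₀ h0] at hn
  linarith [key n, h (2 ^ n)]

/-- Balls around 0 are stable under natural multiples in the ultrametric case, so all powers of ψ(x)
stay near 1 once x is small. -/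
theorem exists_ball_addChar_eq_one [IsUltrametricDist F] {ψ : AddChar F Circle}
    (hψ : Continuous ψ) : ∃ r > 0, ∀ x, ‖x‖ < r → ψ x = 1 := by
  have h1 : ∀ᶠ x in nhds (0 : F), ‖(ψ x : ℂ) - 1‖ < 1 / 2 := by
    have : Continuous fun x => ‖(ψ x : ℂ) - 1‖ := by fun_prop
    exact this.continuousAt.eventually_lt continuousAt_const (by simp)
  obtain ⟨r, hr, h2⟩ := Metric.eventually_nhds_iff_ball.1 h1
  refine ⟨r, hr, fun x hx => circle_eq_one_of_pow_near fun n => ?_⟩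
  rw [← AddChar.map_nsmul_eq_pow]
  refine (h2 _ ?_).le
  rw [mem_ball_zero_iff, nsmul_eq_mul, norm_mul]
  calc _ ≤ 1 * ‖x‖ := by gcongr; exact IsUltrametricDist.norm_natCast_le_one F n
    _ < r := by rwa [one_mul]

theorem isLocallyConstant_addChar [IsUltrametricDist F] {ψ : AddChar F Circle}
    (hψ : Continuous ψ) : IsLocallyConstant ψ := by
  obtain ⟨r, hr, h⟩ := exists_ball_addChar_eq_one hψ
  refine (IsLocallyConstant.iff_eventually_eq _).2 fun x => ?_
  filter_upwards [Metric.ball_mem_nhds x hr] with y hy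
  rw [← sub_add_cancel y x, AddChar.map_add_eq_mul, h _ (by simpa [dist_eq_norm] using hy), one_mul]

/-- Polynomial functions on a vector space, without constant terms. -/
inductive IsPoly (F : Type*) [NontriviallyNormedField F] {V : Type*} [NormedAddCommGroup V]
    [NormedSpace F V] : (V → F) → Prop
  | lin (l : V →ₗ[F] F) : IsPoly F l
  | add {P Q : V → F} : IsPoly F P → IsPoly F Q → IsPoly F fun v => P v + Q v
  | mul {P Q : V → F} : IsPoly F P → IsPoly F Q → IsPoly F fun v => P v * Q v

theorem IsPoly.sum {ι : Type*} (s : Finset ι) {P : ι → V → F} (h : ∀ i, IsPoly F (P i)) :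
    IsPoly F fun v => ∑ i ∈ s, P i v := by
  classical
  induction s using Finset.induction_on with
  | empty =>
    simp only [Finset.sum_empty]
    exact IsPoly.lin (0 : V →ₗ[F] F)
  | insert a s ha ih => simpa [Finset.sum_insert ha] using (h a).add ih

theorem IsPoly.const_mul {P : V → F} (h : IsPoly F P) (c : F) : IsPoly F fun v => c * P v := by
  induction h with
  | lin l => exact IsPoly.lin (c • l)
  | add _ _ h1 h2 => simpa [mul_add] using h1.add h2
  | mul _ h h1 _ => simpa [mul_assoc] using h1.mul h

theorem IsPoly.continuous {P : V → F} (h : IsPoly F P) : Continuous P := by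
  induction h with
  | lin l => exact l.continuous_of_finiteDimensional
  | add _ _ h1 h2 => exact h1.add h2
  | mul _ _ h1 h2 => exact h1.mul h2

/-- In real charts, linear forms over F become real linear maps and the multiplication of F becomes
a real bilinear map; both operations keep temperate growth. -/
theorem IsPoly.hasTemperateGrowth {d k : ℕ} (T : F ≃ₜ+ (Fin d → ℝ)) (S : V ≃ₜ+ (Fin k → ℝ))
    {P : V → F} (h : IsPoly F P) : Function.HasTemperateGrowth fun x => T (P (S.symm x)) := by
  induction h with
  | lin l =>
    exact ((T.toAddEquiv.toAddMonoidHom.comp l.toAddMonoidHom).comp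
      S.symm.toAddEquiv.toAddMonoidHom).toRealLinearMap (T.continuous.comp
        (l.continuous_of_finiteDimensional.comp S.symm.continuous)) |>.hasTemperateGrowth
  | add _ _ h1 h2 =>
    simp only [map_add]
    exact h1.add h2
  | @mul P Q _ _ h1 h2 =>
    let m := realBilin (fun x y => T (T.symm x * T.symm y))
      (fun y => T.continuous.comp (T.symm.continuous.mul continuous_const))
      (fun x => T.continuous.comp (continuous_const.mul T.symm.continuous))
      (fun x x' y => by simp [add_mul]) (fun x y y' => by simp [mul_add])
    have h3 := m.bilinear_hasTemperateGrowth h1 h2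
    have h4 : (fun x => T (P (S.symm x) * Q (S.symm x))) =
        fun x => m (T (P (S.symm x))) (T (Q (S.symm x))) := by
      funext x
      change _ = T (T.symm (T (P (S.symm x))) * T.symm (T (Q (S.symm x))))
      simp
    rw [h4]
    exact h3

theorem hasTemperateGrowth_exp_mul_I :
    Function.HasTemperateGrowth fun x : ℝ => Complex.exp ((x : ℂ) * Complex.I) := by
  have hd : ∀ n : ℕ, iteratedDeriv n (fun x : ℝ => Complex.exp ((x : ℂ) * Complex.I)) =
      fun x : ℝ => Complex.I ^ n * Complex.exp ((x : ℂ) * Complex.I) := by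
    intro n
    induction n with
    | zero => simp
    | succ n ih =>
      rw [iteratedDeriv_succ, ih]
      funext x
      have h1 : HasDerivAt (fun x : ℝ => (x : ℂ) * Complex.I) (1 * Complex.I) x :=
        (Complex.ofRealCLM.hasDerivAt (x := x)).mul_const _
      rw [(h1.cexp.const_mul (Complex.I ^ n)).deriv]
      ring
  refine ⟨?_, fun n => ⟨0, 1, fun x => ?_⟩⟩
  · exact (Complex.ofRealCLM.contDiff.mul contDiff_const).cexp
  · rw [norm_iteratedFDeriv_eq_norm_iteratedDeriv, hd]
    simp [Complex.norm_exp_ofReal_mul_I]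

theorem exists_linearForm_of_addChar {ψ : AddChar F Circle} (hψ : Continuous ψ) {d : ℕ}
    (T : F ≃ₜ+ (Fin d → ℝ)) : ∃ φ : (Fin d → ℝ) →L[ℝ] ℝ,
      ∀ x, (ψ x : ℂ) = Complex.exp ((φ (T x) : ℝ) * Complex.I) := by
  let χ : AddChar (Fin d → ℝ) Circle :=
    { toFun := fun x => ψ (T.symm x)
      map_zero_eq_one' := by simp
      map_add_eq_mul' := fun x y => by simp [AddChar.map_add_eq_mul] }
  obtain ⟨φ, hφ⟩ := exists_exp_of_addChar χ (hψ.comp T.symm.continuous)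
  refine ⟨φ, fun x => ?_⟩
  rw [← hφ]
  change _ = ((ψ (T.symm (T x)) : Circle) : ℂ)
  simp

/-- The product of a Schwartz–Bruhat function with `ψ ∘ P`, for a polynomial `P`. -/
theorem IsSB.mul_addChar {ψ : AddChar F Circle} (hψ : Continuous ψ) {Φ : V → ℂ} (hΦ : IsSB F Φ)
    {P : V → F} (hP : IsPoly F P) : IsSB F fun v => Φ v * (ψ (P v) : ℂ) := by
  rcases hΦ with ⟨hF, h1, h2⟩ | ⟨hF, k, S, g, hg⟩
  · refine .inl ⟨hF, ?_, h2.mul_right⟩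
    exact h1.mul (((isLocallyConstant_addChar hψ).comp_continuous hP.continuous).comp
      ((↑) : Circle → ℂ))
  · obtain ⟨d, ⟨T⟩⟩ := hF
    obtain ⟨φ, hφ⟩ := exists_linearForm_of_addChar hψ T
    -- In the chart ψ ∘ P is the exponential of i times a real function of temperate growth, hence a
    -- multiplier of the Schwartz space.
    let q : (Fin k → ℝ) → ℂ := fun x =>
      Complex.exp (((φ (T (P (S.symm x))) : ℝ) : ℂ) * Complex.I)
    have h1 : Function.HasTemperateGrowth q :=
      hasTemperateGrowth_exp_mul_I.comp (φ.hasTemperateGrowth.comp (hP.hasTemperateGrowth T S))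
    refine .inr ⟨⟨d, ⟨T⟩⟩, k, S, SchwartzMap.smulLeftCLM ℂ q g, fun v => ?_⟩
    rw [SchwartzMap.smulLeftCLM_apply_apply h1]
    beta_reduce
    rw [hφ, hg]
    simp [q, mul_comm]

end characters

end

end Kuznetsov

/-! ### Integrable majorants, and stability under partial Fourier transforms -/

namespace Kuznetsov

noncomputable section

open scoped SchwartzMap ENNReal

set_option linter.unusedSectionVars false

variable {F : Type*} [NontriviallyNormedField F] [ProperSpace F]

section integrability

variable {V : Type*} [NormedAddCommGroup V] [NormedSpace F V] [FiniteDimensional F V]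
  [MeasurableSpace V] [BorelSpace V]

theorem IsSB.integrable {Φ : V → ℂ} (hΦ : IsSB F Φ) (μ : Measure V) [μ.IsAddHaarMeasure] :
    Integrable Φ μ := by
  rcases hΦ with ⟨hF, h1, h2⟩ | ⟨hF, k, T, g, hg⟩
  · exact h1.continuous.integrable_of_hasCompactSupport h2
  · have : (μ.map T).IsAddHaarMeasure :=
      T.toAddEquiv.isAddHaarMeasure_map μ T.continuous T.symm.continuous
    have h3 : Integrable g (μ.map T) := g.integrable
    rw [show Φ = g ∘ T from funext hg]
    exact h3.comp_measurable T.continuous.measurable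

variable [MeasureSpace F] [BorelSpace F] [(volume : Measure F).IsAddHaarMeasure]

/-- A Schwartz–Bruhat function is dominated by a product of integrable functions of the
coordinates. -/
theorem IsSB.exists_majorant {Φ : V → ℂ} (hΦ : IsSB F Φ) {ι : Type*} [Fintype ι]
    (l : ι → V →ₗ[F] F) : ∃ h : F → ℝ≥0∞, Measurable h ∧ (∀ x, h x ≤ 1) ∧ ∫⁻ x, h x ≠ ∞ ∧
      ∃ C : ℝ≥0∞, C ≠ ∞ ∧ ∀ v, ‖Φ v‖ₑ ≤ C * ∏ i, h (l i v) := by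
  classical
  rcases hΦ with ⟨hF, h1, h2⟩ | ⟨⟨d, ⟨T⟩⟩, k, S, g, hg⟩
  · obtain ⟨C, hC⟩ := h2.exists_bound_of_continuous h1.continuous
    have hb : ∀ i, ∃ R, ∀ v ∈ tsupport Φ, ‖l i v‖ ≤ R := fun i =>
      h2.isCompact.exists_bound_of_continuousOn
        ((l i).continuous_of_finiteDimensional.continuousOn)
    choose R hR using hb
    -- A single ball containing the values of all the forms on the compact support, so that the same
    -- h serves every coordinate.
    let B : Set F := Metric.closedBall 0 (∑ i, |R i|)
    have hB : MeasurableSet B := Metric.isClosed_closedBall.measurableSet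
    refine ⟨B.indicator 1, measurable_one.indicator hB,
      fun x => Set.indicator_le_self' (fun _ _ => zero_le_one) x, ?_, ENNReal.ofReal C,
      ENNReal.ofReal_ne_top, fun v => ?_⟩
    · rw [lintegral_indicator_one hB]
      exact (isCompact_closedBall _ _).measure_lt_top.ne
    · by_cases hv : v ∈ tsupport Φ
      · have h3 : ∀ i, B.indicator (1 : F → ℝ≥0∞) (l i v) = 1 := fun i => by
          refine Set.indicator_of_mem ?_ _
          rw [mem_closedBall_zero_iff]
          exact (hR i v hv).trans ((le_abs_self _).trans
            (Finset.single_le_sum (fun i _ => abs_nonneg (R i)) (Finset.mem_univ i)))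
        simp only [h3, Finset.prod_const_one, mul_one]
        rw [← ofReal_norm]
        exact ENNReal.ofReal_le_ofReal (hC v)
      · simp [image_eq_zero_of_notMem_tsupport hv]
  · have hT : ((volume : Measure F).map T).IsAddHaarMeasure :=
      T.toAddEquiv.isAddHaarMeasure_map _ T.continuous T.symm.continuous
    let q : (Fin d → ℝ) → ℝ := fun x => (1 + ‖x‖) ^ (-((d + 1 : ℕ) : ℝ))
    have hqi : Integrable q ((volume : Measure F).map T) :=
      integrable_one_add_norm (by simp)
    have hq0 : ∀ x, 0 < q x := fun x => by positivity
    have hq1 : ∀ x, q x ≤ 1 := fun x =>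
      Real.rpow_le_one_of_one_le_of_nonpos (by simp) (neg_nonpos.2 (Nat.cast_nonneg _))
    have hqi' : Integrable (fun x : F => q (T x)) := hqi.comp_measurable T.continuous.measurable
    have hA : ∀ i, ∃ A : ℝ, 0 ≤ A ∧ ∀ v, ‖T (l i v)‖ ≤ A * ‖S v‖ := by
      intro i
      let A : (Fin k → ℝ) →L[ℝ] (Fin d → ℝ) :=
        ((T.toAddEquiv.toAddMonoidHom.comp (l i).toAddMonoidHom).comp
        S.symm.toAddEquiv.toAddMonoidHom).toRealLinearMap (T.continuous.comp
          ((l i).continuous_of_finiteDimensional.comp S.symm.continuous))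
      refine ⟨‖A‖, norm_nonneg _, fun v => ?_⟩
      have := A.le_opNorm (S v)
      rwa [show A (S v) = T (l i (S.symm (S v))) from rfl, S.symm_apply_apply] at this
    choose A hA0 hA using hA
    set B : ℝ := 1 + ∑ i, A i with hB
    have hB1 : 0 < B := by
      have := Finset.sum_nonneg fun i (_ : i ∈ Finset.univ) => hA0 i
      linarith
    have hAB : ∀ i v, 1 + ‖T (l i v)‖ ≤ B * (1 + ‖S v‖) := by
      intro i v
      have h1 : A i ≤ ∑ i, A i := Finset.single_le_sum (fun i _ => hA0 i) (Finset.mem_univ i)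
      have h2 := Finset.sum_nonneg fun i (_ : i ∈ Finset.univ) => hA0 i
      have h3 : A i * ‖S v‖ ≤ (∑ i, A i) * ‖S v‖ := by gcongr
      nlinarith [hA i v, norm_nonneg (S v)]
    -- Each form needs d + 1 powers of decay, enough for integrability over F, which is ℝᵈ as a
    -- group.
    let N : ℕ := (d + 1) * Fintype.card ι
    let C : ℝ := 2 ^ N * ((Finset.Iic (N, 0)).sup fun m => SchwartzMap.seminorm ℝ m.1 m.2) g
    have hC : ∀ x, (1 + ‖x‖) ^ N * ‖g x‖ ≤ C := fun x => by
      simpa using SchwartzMap.one_add_le_sup_seminorm_apply (𝕜 := ℝ) (m := (N, 0)) le_rfl le_rfl g x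
    have hC0 : 0 ≤ C := by positivity
    refine ⟨fun x => ENNReal.ofReal (q (T x)), ?_, fun x => ?_, hqi'.lintegral_lt_top.ne,
      ENNReal.ofReal (C * B ^ N), ENNReal.ofReal_ne_top, fun v => ?_⟩
    · have := T.continuous.measurable
      fun_prop
    · simpa using hq1 (T x)
    · rw [← ENNReal.ofReal_prod_of_nonneg (fun i _ => (hq0 _).le),
        ← ENNReal.ofReal_mul (by positivity), ← ofReal_norm, hg]
      refine ENNReal.ofReal_le_ofReal ?_
      have h4 : ∏ i, q (T (l i v)) = (∏ i, (1 + ‖T (l i v)‖) ^ (d + 1))⁻¹ := by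
        rw [← Finset.prod_inv_distrib]
        refine Finset.prod_congr rfl fun i _ => ?_
        simp only [q]
        rw [Real.rpow_neg (by positivity), Real.rpow_natCast]
      have h5 : ∏ i, (1 + ‖T (l i v)‖) ^ (d + 1) ≤ B ^ N * (1 + ‖S v‖) ^ N := by
        calc ∏ i, (1 + ‖T (l i v)‖) ^ (d + 1) ≤ ∏ _i : ι, (B * (1 + ‖S v‖)) ^ (d + 1) := by
              gcongr with i
              exact hAB i v
          _ = _ := by
            rw [Finset.prod_const, Finset.card_univ, ← pow_mul, mul_pow]
      rw [h4, ← div_eq_mul_inv, le_div_iff₀ (by positivity)]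
      calc ‖g (S v)‖ * ∏ i, (1 + ‖T (l i v)‖) ^ (d + 1) ≤
            ‖g (S v)‖ * (B ^ N * (1 + ‖S v‖) ^ N) := by gcongr
        _ = ((1 + ‖S v‖) ^ N * ‖g (S v)‖) * B ^ N := by ring
        _ ≤ _ := by gcongr; exact hC _

end integrability

section partialFT

variable {V W : Type*} [NormedAddCommGroup V] [NormedSpace F V] [FiniteDimensional F V]
  [MeasurableSpace V] [BorelSpace V]
  [NormedAddCommGroup W] [NormedSpace F W] [FiniteDimensional F W]

/-- Compactness of the support makes local constancy uniform, through a Lebesgue number of the cover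
by fibres. -/
theorem exists_dist_lt_eq_of_isLocallyConstant {X : Type*} [PseudoMetricSpace X] {f : X → ℂ}
    (h1 : IsLocallyConstant f) (h2 : HasCompactSupport f) :
    ∃ r > 0, ∀ p q, dist p q < r → f p = f q := by
  obtain ⟨r, hr, h⟩ := lebesgue_number_lemma_of_metric (c := fun z : ℂ => f ⁻¹' {z}) h2.isCompact
    (fun z => h1.isOpen_fiber z) (fun x _ => Set.mem_iUnion.2 ⟨f x, rfl⟩)
  have key : ∀ p q, dist p q < r → p ∈ tsupport f → f p = f q := by
    intro p q hpq hp
    obtain ⟨z, hz⟩ := h p hp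
    rw [show f p = z from hz (Metric.mem_ball_self hr),
      show f q = z from hz (Metric.mem_ball'.2 hpq)]
  refine ⟨r, hr, fun p q hpq => ?_⟩
  by_cases hp : p ∈ tsupport f
  · exact key p q hpq hp
  by_cases hq : q ∈ tsupport f
  · exact (key q p (by rwa [dist_comm]) hq).symm
  · rw [image_eq_zero_of_notMem_tsupport hp, image_eq_zero_of_notMem_tsupport hq]

variable {ψ : AddChar F Circle} (hψ : Continuous ψ) (hψ1 : ∃ x, ψ x ≠ 1)
  (B : V →ₗ[F] V →ₗ[F] F) (hB : ∀ x, (∀ y, B x y = 0) → x = 0)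
  (μ : Measure V) [μ.IsAddHaarMeasure]
include hψ hψ1 hB

theorem IsSB.partialFT_of_isArch (hF : IsArch F) {Φ : V × W → ℂ} {k : ℕ}
    (T : V × W ≃ₜ+ (Fin k → ℝ)) (g : 𝓢(Fin k → ℝ, ℂ)) (hg : ∀ v, Φ v = g (T v)) :
    IsSB F fun p : V × W => ∫ x, Φ (x, p.2) * (ψ (B x p.1) : ℂ) ∂μ := by
  obtain ⟨m, ⟨TV⟩⟩ := exists_chart hF V
  obtain ⟨n, ⟨TW⟩⟩ := exists_chart hF W
  have hF' := hF
  obtain ⟨d, ⟨TF⟩⟩ := hF'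
  obtain ⟨φ, hφ⟩ := exists_linearForm_of_addChar hψ TF
  let TP : V × W ≃ₜ+ (Fin m → ℝ) × (Fin n → ℝ) :=
    { toFun := fun p => (TV p.1, TW p.2)
      invFun := fun p => (TV.symm p.1, TW.symm p.2)
      left_inv := fun v => by simp
      right_inv := fun v => by simp
      map_add' := fun v w => by ext <;> simp
      continuous_toFun := (TV.continuous.comp continuous_fst).prodMk
        (TW.continuous.comp continuous_snd)
      continuous_invFun := (TV.symm.continuous.comp continuous_fst).prodMk
        (TW.symm.continuous.comp continuous_snd) }
  obtain ⟨g', hg'⟩ := exists_schwartzMap_of_chart TP T g hg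
  have hBl : ∀ y, Continuous fun x => B x y := fun y =>
    (B.flip y).continuous_of_finiteDimensional
  have hBr : ∀ x, Continuous fun y => B x y := fun x => (B x).continuous_of_finiteDimensional
  let L := realBilin (fun x y => φ (TF (B (TV.symm x) (TV.symm y))))
    (fun y => φ.continuous.comp (TF.continuous.comp ((hBl _).comp TV.symm.continuous)))
    (fun x => φ.continuous.comp (TF.continuous.comp ((hBr _).comp TV.symm.continuous)))
    (fun x x' y => by simp) (fun x y y' => by simp)
  have hLB : ∀ x y, L (TV x) (TV y) = φ (TF (B x y)) := fun x y => by
    change φ (TF (B (TV.symm (TV x)) (TV.symm (TV y)))) = _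
    simp
  -- A real form may lose information compared with B, but y can be rescaled by F. If B(a, y) is
  -- nonzero then B(a, ·) takes every value z, and L(a, ·) = 0 would give ψ(z) = 1 for all z.
  have hLinj : ∀ a, (∀ y, L a y = 0) → a = 0 := by
    intro a ha
    rw [← TV.apply_symm_apply a]
    suffices h : TV.symm a = 0 by rw [h, map_zero]
    refine hB _ fun y => ?_
    by_contra hne
    obtain ⟨z, hz⟩ := hψ1
    refine hz (Circle.ext ?_)
    have h1 : B (TV.symm a) ((z / B (TV.symm a) y) • y) = z := by
      rw [map_smul, smul_eq_mul, div_mul_cancel₀ _ hne]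
    have h2 := hLB (TV.symm a) ((z / B (TV.symm a) y) • y)
    rw [h1, TV.apply_symm_apply, ha] at h2
    rw [hφ, ← h2]
    simp
  have hLsurj : ∀ l : (Fin m → ℝ) →L[ℝ] ℝ, ∃ a, L a = l := by
    let L' : (Fin m → ℝ) →ₗ[ℝ] Module.Dual ℝ (Fin m → ℝ) :=
      { toFun := fun a => (L a : (Fin m → ℝ) →ₗ[ℝ] ℝ)
        map_add' := fun a b => by ext; simp
        map_smul' := fun a b => by ext; simp }
    have hinj : Function.Injective L' := by
      rw [← LinearMap.ker_eq_bot, LinearMap.ker_eq_bot']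
      intro a ha
      exact hLinj a fun y => LinearMap.congr_fun ha y
    have hsurj := (LinearMap.injective_iff_surjective_of_finrank_eq_finrank
      (Subspace.dual_finrank_eq).symm).1 hinj
    intro l
    obtain ⟨a, ha⟩ := hsurj l
    exact ⟨a, ContinuousLinearMap.ext fun y => LinearMap.congr_fun ha y⟩
  have : (μ.map TV).IsAddHaarMeasure :=
    TV.toAddEquiv.isAddHaarMeasure_map μ TV.continuous TV.symm.continuous
  obtain ⟨G, hG⟩ := exists_schwartzMap_partialFourier L (μ.map TV) hLsurj g'
  refine IsSB.of_chart hF TP G fun p => ?_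
  rw [hG, partialFourier]
  have h3 : MeasurableEmbedding TV := TV.toHomeomorph.measurableEmbedding
  rw [h3.integral_map]
  congr 1 with x
  rw [hg', hφ]
  change _ = g' (TV x, TW p.2) * Complex.exp ((L (TV x) (TV p.1) : ℝ) * Complex.I)
  rw [hLB]
  rfl

theorem IsSB.partialFT_of_isUltrametricDist [IsUltrametricDist F] {Φ : V × W → ℂ}
    (h1 : IsLocallyConstant Φ) (h2 : HasCompactSupport Φ) :
    IsSB F fun p : V × W => ∫ x, Φ (x, p.2) * (ψ (B x p.1) : ℂ) ∂μ := by
  have : ProperSpace V := FiniteDimensional.proper F V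
  have : ProperSpace W := FiniteDimensional.proper F W
  obtain ⟨r, hr, hloc⟩ := exists_dist_lt_eq_of_isLocallyConstant h1 h2
  obtain ⟨R, hR⟩ := h2.isCompact.exists_bound_of_continuousOn (f := id) continuousOn_id
  obtain ⟨ρ, hρ, hψρ⟩ := exists_ball_addChar_eq_one hψ
  let Bc : V →L[F] V →L[F] F := LinearMap.toContinuousLinearMap
    ((LinearMap.toContinuousLinearMap : (V →ₗ[F] F) ≃ₗ[F] V →L[F] F).toLinearMap ∘ₗ B)
  have hBc : ∀ x y, Bc x y = B x y := fun x y => rfl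
  have hle : ∀ x y, ‖B x y‖ ≤ ‖Bc‖ * ‖x‖ * ‖y‖ := fun x y => Bc.le_opNorm₂ x y
  have hsupp : ∀ x w, Φ (x, w) ≠ 0 → ‖x‖ ≤ R ∧ ‖w‖ ≤ R := by
    intro x w h
    have h3 := hR (x, w) (subset_tsupport _ h)
    exact ⟨(norm_fst_le _).trans h3, (norm_snd_le _).trans h3⟩
  refine .inl ⟨inferInstance, ?_, ?_⟩
  · refine (IsLocallyConstant.iff_eventually_eq _).2 fun p => ?_
    have hc : ∀ᶠ q : V × W in nhds p, ‖Bc‖ * |R| * ‖q.1 - p.1‖ < ρ := by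
      have : Continuous fun q : V × W => ‖Bc‖ * |R| * ‖q.1 - p.1‖ := by fun_prop
      exact this.continuousAt.eventually_lt continuousAt_const (by simpa)
    filter_upwards [Metric.ball_mem_nhds p hr, hc] with q hq1 hq2
    congr 1 with x
    -- Local constancy: the second variable is controlled by the uniform radius r, the frequency by
    -- triviality of ψ near 0 together with boundedness of the support in x.
    have h3 : Φ (x, q.2) = Φ (x, p.2) := hloc _ _ (by
      rw [Prod.dist_eq]
      have : dist q.2 p.2 < r := lt_of_le_of_lt (le_max_right _ _) hq1
      simpa [hr] using this)
    rw [h3]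
    by_cases h4 : Φ (x, p.2) = 0
    · simp [h4]
    · congr 2
      rw [← sub_add_cancel q.1 p.1, map_add, AddChar.map_add_eq_mul, hψρ, one_mul]
      refine lt_of_le_of_lt (hle _ _) (lt_of_le_of_lt ?_ hq2)
      gcongr
      exact (hsupp _ _ h4).1.trans (le_abs_self R)
  -- Compact support. Where the transform is nonzero, invariance of Φ under small translations makes
  -- ψ trivial on the image of a ball under B(·, p.1). This image is stable under scalars of norm at
  -- most 1, hence cannot reach norm ‖z‖ when ψ(z) ≠ 1. That bounds the form, and p.1 by
  -- nondegeneracy.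
  · obtain ⟨z, hz⟩ := hψ1
    obtain ⟨c, hc⟩ := NormedField.exists_one_lt_norm F
    obtain ⟨K, -, hK⟩ := (Bc.flip : V →ₗ[F] V →L[F] F).exists_antilipschitzWith (by
      have hdim : Module.finrank F V = Module.finrank F (Module.Dual F V) :=
        (Subspace.dual_finrank_eq).symm
      have hinj : Function.Injective B := by
        rw [← LinearMap.ker_eq_bot, LinearMap.ker_eq_bot']
        exact fun x hx => hB x fun y => by rw [hx]; rfl
      have hsurj := (LinearMap.injective_iff_surjective_of_finrank_eq_finrank hdim).1 hinj
      rw [LinearMap.ker_eq_bot']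
      intro y hy
      have h3 : ∀ f : Module.Dual F V, f y = 0 := by
        intro f
        obtain ⟨x, rfl⟩ := hsurj f
        exact DFunLike.congr_fun hy x
      exact (Module.forall_dual_apply_eq_zero_iff F y).1 h3)
    refine HasCompactSupport.intro (isCompact_closedBall (0 : V × W)
      (max (K * (‖z‖ * ‖c‖ / r)) R)) fun p hp => ?_
    by_contra hne
    refine hp ?_
    rw [mem_closedBall_zero_iff]
    refine max_le_max ?_ ?_
    · have hinv : ∀ a : V, ‖a‖ < r → ψ (B a p.1) = 1 := by
        intro a ha
        have h3 : (ψ (B a p.1) : ℂ) * ∫ x, Φ (x, p.2) * (ψ (B x p.1) : ℂ) ∂μ =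
            ∫ x, Φ (x, p.2) * (ψ (B x p.1) : ℂ) ∂μ := by
          rw [← integral_const_mul]
          conv_rhs => rw [← integral_add_right_eq_self _ a]
          congr 1 with x
          have h4 : Φ (x + a, p.2) = Φ (x, p.2) := hloc _ _ (by
            rw [Prod.dist_eq]
            simpa [hr] using ha)
          rw [h4, map_add, LinearMap.add_apply, AddChar.map_add_eq_mul]
          push_cast
          ring
        exact Circle.ext (by simpa using mul_right_cancel₀ hne (h3.trans (one_mul _).symm))
      have hb : ∀ a : V, ‖a‖ < r → ‖Bc.flip p.1 a‖ ≤ ‖z‖ := by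
        intro a ha
        by_contra! hlt
        have hne' : B a p.1 ≠ 0 := by
          intro h0
          rw [ContinuousLinearMap.flip_apply, hBc, h0, norm_zero] at hlt
          exact absurd hlt (not_lt.2 (norm_nonneg z))
        refine hz ?_
        have h5 := hinv ((z / B a p.1) • a) (by
          rw [norm_smul, norm_div]
          refine lt_of_le_of_lt ?_ ha
          refine mul_le_of_le_one_left (norm_nonneg _) ?_
          rw [div_le_one (norm_pos_iff.2 hne')]
          exact hlt.le)
        rwa [map_smul, LinearMap.smul_apply, smul_eq_mul, div_mul_cancel₀ _ hne'] at h5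
      have h6 : ‖Bc.flip p.1‖ ≤ ‖z‖ * ‖c‖ / r := by
        refine ContinuousLinearMap.opNorm_le_of_shell hr (by positivity) hc fun a ha1 ha2 => ?_
        refine (hb a ha2).trans ?_
        have hc0 : 0 < ‖c‖ := by positivity
        calc ‖z‖ = ‖z‖ * ‖c‖ / r * (r / ‖c‖) := by field_simp
          _ ≤ _ := by gcongr
      have h7 := hK.le_mul_dist p.1 0
      simp only [map_zero, dist_zero_right] at h7
      refine h7.trans ?_
      gcongr
      exact h6
    · by_contra! hlt
      refine hne ?_
      have h8 : ∀ x, Φ (x, p.2) = 0 := fun x => by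
        by_contra h9
        exact absurd (hsupp _ _ h9).2 (not_le.2 hlt)
      simp [h8]

/-- The partial Fourier transform of a Schwartz–Bruhat function is a Schwartz–Bruhat function. -/
theorem IsSB.partialFT {Φ : V × W → ℂ} (hΦ : IsSB F Φ) :
    IsSB F fun p : V × W => ∫ x, Φ (x, p.2) * (ψ (B x p.1) : ℂ) ∂μ := by
  rcases hΦ with ⟨hF, h1, h2⟩ | ⟨hF, k, T, g, hg⟩
  · exact IsSB.partialFT_of_isUltrametricDist hψ hψ1 B hB μ h1 h2
  · exact IsSB.partialFT_of_isArch hψ hψ1 B hB μ hF T g hg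

end partialFT

end

end Kuznetsov

/-! ### The normalized absolute value and linear changes of variables -/

namespace Kuznetsov

noncomputable section

open scoped ENNReal Pointwise

set_option linter.unusedSectionVars false

variable {F : Type*} [NontriviallyNormedField F] [ProperSpace F]

section absF

open scoped Classical in
/-- The normalized absolute value of a local field. -/
def absF (x : F) : ℝ := if h : x = 0 then 0 else modulus (Units.mk0 x h)

theorem modulus_pos (x : Fˣ) : 0 < modulus x := NNReal.coe_pos.2 distribHaarChar_pos

theorem absF_zero : absF (0 : F) = 0 := by simp [absF]

theorem absF_coe (x : Fˣ) : absF (x : F) = modulus x := by simp [absF]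

theorem absF_pos {x : F} (hx : x ≠ 0) : 0 < absF x := by
  rw [absF, dif_neg hx]
  exact modulus_pos _

theorem absF_nonneg (x : F) : 0 ≤ absF x := by
  by_cases hx : x = 0
  · simp [hx, absF_zero]
  · exact (absF_pos hx).le

theorem modulus_mul (x y : Fˣ) : modulus (x * y) = modulus x * modulus y := by
  simp [modulus]

theorem absF_mul (x y : F) : absF (x * y) = absF x * absF y := by
  by_cases hx : x = 0
  · simp [hx, absF_zero]
  by_cases hy : y = 0
  · simp [hy, absF_zero]
  rw [← Units.val_mk0 hx, ← Units.val_mk0 hy, ← Units.val_mul]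
  simp only [absF_coe, modulus_mul]

theorem absF_one : absF (1 : F) = 1 := by
  rw [← Units.val_one, absF_coe]
  simp [modulus]

/-- The normalized absolute value as a homomorphism. -/
def absFHom (F : Type*) [NontriviallyNormedField F] [ProperSpace F] : F →*₀ ℝ where
  toFun := absF
  map_zero' := absF_zero
  map_one' := absF_one
  map_mul' := absF_mul

theorem absF_inv (x : F) : absF x⁻¹ = (absF x)⁻¹ := map_inv₀ (absFHom F) x

theorem absF_pow (x : F) (k : ℕ) : absF (x ^ k) = absF x ^ k := map_pow (absFHom F) x k

theorem absF_prod {ι : Type*} (s : Finset ι) (f : ι → F) :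
    absF (∏ i ∈ s, f i) = ∏ i ∈ s, absF (f i) := map_prod (absFHom F) f s

theorem absF_eq_one_of_mul_self {x : F} (hx : x * x = 1) : absF x = 1 := by
  have h1 : absF x * absF x = 1 := by rw [← absF_mul, hx, absF_one]
  nlinarith [absF_nonneg x]

theorem absF_neg (x : F) : absF (-x) = absF x := by
  rw [neg_eq_neg_one_mul, absF_mul, absF_eq_one_of_mul_self (by simp), one_mul]

end absF

section boxes

instance isAddHaarMeasure_volume_prod {V W : Type*} [NormedAddCommGroup V] [MeasureSpace V]
    [NormedAddCommGroup W] [MeasureSpace W] [BorelSpace V] [BorelSpace W]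
    [SecondCountableTopology V] [SecondCountableTopology W] [LocallyCompactSpace V]
    [LocallyCompactSpace W]
    [(volume : Measure V).IsAddHaarMeasure] [(volume : Measure W).IsAddHaarMeasure] :
    (volume : Measure (V × W)).IsAddHaarMeasure :=
  inferInstanceAs (((volume : Measure V).prod volume).IsAddHaarMeasure)

variable {V W : Type*} [NormedAddCommGroup V] [NormedSpace F V] [FiniteDimensional F V]
  [MeasureSpace V] [BorelSpace V] [(volume : Measure V).IsAddHaarMeasure]
  [NormedAddCommGroup W] [NormedSpace F W] [FiniteDimensional F W]
  [MeasureSpace W] [BorelSpace W] [(volume : Measure W).IsAddHaarMeasure]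

/-- A linear isomorphism preserves the Haar measures if it preserves the measure of one set. -/
theorem measurePreserving_of_preimage_eq (A : V ≃ₗ[F] W) (S : Set V) (S' : Set W)
    (hS : A ⁻¹' S' = S) (hm : MeasurableSet S') (hv : volume S = volume S')
    (h0 : volume S' ≠ 0) (hfin : volume S' ≠ ∞) : MeasurePreserving A := by
  have : ProperSpace W := FiniteDimensional.proper F W
  let Ac := A.toContinuousLinearEquiv
  have hA : Measurable A := Ac.continuous.measurable
  refine ⟨hA, ?_⟩
  have : ((volume : Measure V).map A).IsAddHaarMeasure :=
    A.toAddEquiv.isAddHaarMeasure_map volume Ac.continuous Ac.symm.continuous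
  rw [Measure.isAddLeftInvariant_eq_smul ((volume : Measure V).map A) volume]
  have h1 : ((volume : Measure V).map A) S' = volume S' := by
    rw [Measure.map_apply hA hm, hS, hv]
  rw [Measure.isAddLeftInvariant_eq_smul ((volume : Measure V).map A) volume, Measure.smul_apply,
    ENNReal.smul_def, smul_eq_mul] at h1
  have h2 := (ENNReal.mul_eq_right h0 hfin).1 h1
  rw [ENNReal.coe_eq_one.1 h2, one_smul]

theorem measurableEmbedding_linearEquiv (A : V ≃ₗ[F] W) : MeasurableEmbedding A :=
  A.toContinuousLinearEquiv.toHomeomorph.measurableEmbedding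

end boxes

variable [MeasureSpace F] [BorelSpace F] [(volume : Measure F).IsAddHaarMeasure]

section scaling

theorem volume_map_mul_left {x : F} (hx : x ≠ 0) :
    (volume : Measure F).map (x * ·) = ENNReal.ofReal (absF x)⁻¹ • (volume : Measure F) := by
  ext s hs
  have h1 := distribHaarChar_mul (volume : Measure F) (Units.mk0 x hx)⁻¹ s
  have h2 : (x * ·) ⁻¹' s = (Units.mk0 x hx)⁻¹ • s := by
    rw [← Set.preimage_smul]
    rfl
  rw [Measure.map_apply (measurable_const_mul x) hs, h2, ← h1, Measure.smul_apply, smul_eq_mul]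
  congr 1
  rw [← absF_inv, absF, dif_neg (inv_ne_zero hx), modulus, ENNReal.ofReal_coe_nnreal]
  congr 2
  ext
  simp

/-- This exhibits the normalized absolute value as a monotone function of the norm, from which
measurability is read off. -/
theorem absF_eq_volume_closedBall (x : F) : absF x =
    (volume (Metric.closedBall (0 : F) ‖x‖)).toReal /
      (volume (Metric.closedBall (0 : F) 1)).toReal := by
  have hpos : 0 < (volume (Metric.closedBall (0 : F) 1)).toReal :=
    ENNReal.toReal_pos (Metric.measure_closedBall_pos _ _ one_pos).ne'
      (isCompact_closedBall _ _).measure_lt_top.ne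
  by_cases hx : x = 0
  · simp [hx, absF_zero]
  rw [eq_div_iff hpos.ne']
  have h1 := distribHaarChar_mul (volume : Measure F) (Units.mk0 x hx) (Metric.closedBall (0 : F) 1)
  have h2 : (Units.mk0 x hx) • Metric.closedBall (0 : F) 1 = Metric.closedBall (0 : F) ‖x‖ := by
    ext y
    rw [Set.mem_smul_set_iff_inv_smul_mem, mem_closedBall_zero_iff, mem_closedBall_zero_iff,
      Units.smul_def]
    simp only [Units.val_inv_eq_inv_val, Units.val_mk0, smul_eq_mul, norm_mul, norm_inv]
    rw [inv_mul_le_iff₀ (norm_pos_iff.2 hx), mul_one]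
  rw [h2] at h1
  rw [← h1, ENNReal.toReal_mul, absF, dif_neg hx]
  rfl

theorem measurable_absF : Measurable (absF : F → ℝ) := by
  have h1 : Monotone fun r : ℝ => (volume (Metric.closedBall (0 : F) r)).toReal := fun r s h =>
    ENNReal.toReal_mono (isCompact_closedBall _ _).measure_lt_top.ne
      (measure_mono (Metric.closedBall_subset_closedBall h))
  rw [show (absF : F → ℝ) = fun x => (volume (Metric.closedBall (0 : F) ‖x‖)).toReal /
      (volume (Metric.closedBall (0 : F) 1)).toReal from funext absF_eq_volume_closedBall]
  exact (h1.measurable.comp measurable_norm).div_const _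

theorem measurableEmbedding_units_val : MeasurableEmbedding (Units.val : Fˣ → F) where
  injective := Units.val_injective
  measurable := comap_measurable _
  measurableSet_image' := by
    rintro _ ⟨t, ht, rfl⟩
    rw [Set.image_preimage_eq_inter_range]
    refine ht.inter ?_
    have : Set.range (Units.val : Fˣ → F) = {0}ᶜ := by
      ext x
      exact ⟨by rintro ⟨u, rfl⟩; exact u.ne_zero, fun h => ⟨Units.mk0 x h, rfl⟩⟩
    rw [this]
    exact (measurableSet_singleton 0).compl

theorem map_comap_units_val :
    ((volume : Measure F).comap Units.val).map (Units.val : Fˣ → F) = volume := by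
  rw [measurableEmbedding_units_val.map_comap]
  refine Measure.restrict_eq_self_of_ae_mem ?_
  filter_upwards [Measure.ae_ne volume (0 : F)] with x hx
  exact ⟨Units.mk0 x hx, rfl⟩

theorem measurable_modulus : Measurable fun x : Fˣ => ENNReal.ofReal (modulus x)⁻¹ := by
  simp only [← absF_coe]
  have := (measurable_absF (F := F)).comp (measurableEmbedding_units_val (F := F)).measurable
  exact this.inv.ennreal_ofReal

/-- The factor |x| cancels the density of d^×x, and the missing point 0 has measure zero, so
integrals over Fˣ become additive ones. -/
theorem integrable_mulHaar {f : Fˣ → ℂ} {g : F → ℂ} (hg : Integrable g)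
    (h : ∀ x : Fˣ, f x = modulus x * g x) : Integrable f (mulHaar volume) := by
  rw [mulHaar, integrable_withDensity_iff_integrable_smul' measurable_modulus (by simp)]
  have h1 : Integrable (g ∘ (Units.val : Fˣ → F)) ((volume : Measure F).comap Units.val) := by
    rw [← measurableEmbedding_units_val.integrable_map_iff, map_comap_units_val]
    exact hg
  refine h1.congr (.of_forall fun x => ?_)
  have h2 := modulus_pos x
  beta_reduce
  rw [ENNReal.toReal_ofReal (by positivity), h, Complex.real_smul, Function.comp_apply, ← mul_assoc]
  rw [← Complex.ofReal_mul, inv_mul_cancel₀ h2.ne', Complex.ofReal_one, one_mul]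

theorem integral_mulHaar {f : Fˣ → ℂ} {g : F → ℂ} (h : ∀ x : Fˣ, f x = modulus x * g x) :
    ∫ x, f x ∂(mulHaar volume) = ∫ x, g x := by
  rw [mulHaar, integral_withDensity_eq_integral_toReal_smul measurable_modulus (by simp)]
  conv_rhs => rw [← map_comap_units_val, measurableEmbedding_units_val.integral_map]
  congr 1 with x
  have h2 := modulus_pos x
  rw [ENNReal.toReal_ofReal (by positivity), h, Complex.real_smul, ← mul_assoc]
  rw [← Complex.ofReal_mul, inv_mul_cancel₀ h2.ne', Complex.ofReal_one, one_mul]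

end scaling

section Jacobian

variable {ι : Type*} [Fintype ι] [DecidableEq ι]

theorem continuous_mulVec (M : Matrix ι ι F) : Continuous fun v : ι → F => M.mulVec v :=
  (Matrix.toLin' M).continuous_of_finiteDimensional

theorem volume_map_diagonal {D : ι → F} (hD : (Matrix.diagonal D).det ≠ 0) :
    (volume : Measure (ι → F)).map (Matrix.diagonal D).mulVec =
      ENNReal.ofReal (absF (Matrix.diagonal D).det)⁻¹ • volume := by
  rw [Matrix.det_diagonal] at hD ⊢
  have hD' : ∀ i, D i ≠ 0 := fun i => Finset.prod_ne_zero_iff.1 hD i (Finset.mem_univ i)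
  have h1 : (Matrix.diagonal D).mulVec = fun v : ι → F => fun i => D i * v i := by
    funext v i
    simp [Matrix.mulVec_diagonal]
  have h2 : ∀ i, (volume : Measure F).map (D i * ·) = ENNReal.ofReal (absF (D i))⁻¹ • volume :=
    fun i => volume_map_mul_left (hD' i)
  have : ∀ i, SigmaFinite ((volume : Measure F).map (D i * ·)) := fun i => by
    rw [h2, ENNReal.ofReal]
    exact inferInstanceAs (SigmaFinite ((absF (D i))⁻¹.toNNReal • (volume : Measure F)))
  rw [h1, volume_pi, Measure.pi_map_pi fun i => (measurable_const_mul (D i)).aemeasurable]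
  refine Measure.pi_eq fun s hs => ?_
  rw [Measure.smul_apply, Measure.pi_pi, absF_prod, ← Finset.prod_inv_distrib,
    ENNReal.ofReal_prod_of_nonneg fun i _ => inv_nonneg.2 (absF_nonneg _), smul_eq_mul,
    ← Finset.prod_mul_distrib]
  simp [h2]

/-- A transvection translates one coordinate by an amount depending only on the others, so the
marginal integral in that coordinate is unchanged. -/
theorem volume_map_transvection (t : Matrix.TransvectionStruct ι F) :
    (volume : Measure (ι → F)).map t.toMatrix.mulVec = volume := by
  have ht : Measurable t.toMatrix.mulVec := (continuous_mulVec _).measurable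
  refine (Measure.pi_eq fun s hs => ?_).symm
  have h2s : MeasurableSet (Set.univ.pi s) := .pi Set.countable_univ fun i _ => hs i
  simp_rw [← Measure.pi_pi, ← lintegral_indicator_one h2s]
  rw [lintegral_map (measurable_one.indicator h2s) ht, volume_pi]
  refine lintegral_eq_of_lmarginal_eq {t.i} ((measurable_one.indicator h2s).comp ht)
    (measurable_one.indicator h2s) ?_
  simp_rw [lmarginal_singleton]
  ext x
  cases t with | mk t_i t_j t_hij t_c =>
  simp [Matrix.transvection, Matrix.single_mulVec, t_hij.symm, ← Function.update_add, Matrix.add_mulVec,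
    lintegral_add_right_eq_self fun xᵢ => Set.indicator (Set.univ.pi s) 1 (Function.update x t_i xᵢ)]

/-- An invertible matrix scales the Haar measure of `F^ι` by the absolute value of its
determinant. -/
theorem volume_map_mulVec {M : Matrix ι ι F} (hM : M.det ≠ 0) :
    (volume : Measure (ι → F)).map M.mulVec = ENNReal.ofReal (absF M.det)⁻¹ • volume := by
  refine Matrix.diagonal_transvection_induction_of_det_ne_zero
    (fun M => (volume : Measure (ι → F)).map M.mulVec = ENNReal.ofReal (absF M.det)⁻¹ • volume)
    M hM (fun D hD => volume_map_diagonal hD) (fun t => ?_) fun A B _ _ hA hB => ?_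
  · simp [volume_map_transvection, absF_one]
  · have h1 : (A * B).mulVec = A.mulVec ∘ B.mulVec := by
      funext v
      simp
    rw [h1, ← Measure.map_map (continuous_mulVec A).measurable (continuous_mulVec B).measurable,
      hB, Measure.map_smul, hA, smul_smul, Matrix.det_mul, absF_mul, mul_inv,
      ENNReal.ofReal_mul (inv_nonneg.2 (absF_nonneg _)), mul_comm]

theorem measurableEmbedding_mulVec {M : Matrix ι ι F} (hM : M.det ≠ 0) :
    MeasurableEmbedding fun v : ι → F => M.mulVec v := by
  have hu : IsUnit M.det := isUnit_iff_ne_zero.2 hM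
  exact ((Matrix.toLinearEquiv' M (M.invertibleOfIsUnitDet hu)).toContinuousLinearEquiv
    |>.toHomeomorph).measurableEmbedding

theorem integral_comp_mulVec {M : Matrix ι ι F} (hM : M.det ≠ 0) (f : (ι → F) → ℂ) :
    ∫ v, f (M.mulVec v) = ((absF M.det)⁻¹ : ℝ) * ∫ v, f v := by
  rw [← (measurableEmbedding_mulVec hM).integral_map, volume_map_mulVec hM, integral_smul_measure,
    ENNReal.toReal_ofReal (inv_nonneg.2 (absF_nonneg _)), Complex.real_smul]

theorem integral_comp_vecMul {M : Matrix ι ι F} (hM : M.det ≠ 0) (f : (ι → F) → ℂ) :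
    ∫ v, f (Matrix.vecMul v M) = ((absF M.det)⁻¹ : ℝ) * ∫ v, f v := by
  simp only [← Matrix.mulVec_transpose]
  rw [integral_comp_mulVec (by rwa [Matrix.det_transpose]), Matrix.det_transpose]

theorem lintegral_comp_mulVec {M : Matrix ι ι F} (hM : M.det ≠ 0) (f : (ι → F) → ℝ≥0∞) :
    ∫⁻ v, f (M.mulVec v) = ENNReal.ofReal (absF M.det)⁻¹ * ∫⁻ v, f v := by
  rw [← (measurableEmbedding_mulVec hM).lintegral_map, volume_map_mulVec hM, lintegral_smul_measure,
    smul_eq_mul]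

theorem lintegral_comp_vecMul {M : Matrix ι ι F} (hM : M.det ≠ 0) (f : (ι → F) → ℝ≥0∞) :
    ∫⁻ v, f (Matrix.vecMul v M) = ENNReal.ofReal (absF M.det)⁻¹ * ∫⁻ v, f v := by
  simp only [← Matrix.mulVec_transpose]
  rw [lintegral_comp_mulVec (by rwa [Matrix.det_transpose]), Matrix.det_transpose]

theorem integral_comp_smul {s : F} (hs : s ≠ 0) (f : (ι → F) → ℂ) :
    ∫ v, f (s • v) = ((absF s ^ Fintype.card ι)⁻¹ : ℝ) * ∫ v, f v := by
  have h := integral_comp_mulVec (M := s • (1 : Matrix ι ι F)) (by simp [hs]) f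
  simpa [Matrix.smul_mulVec, absF_pow] using h

theorem integral_comp_mul_left {s : F} (hs : s ≠ 0) (f : F → ℂ) :
    ∫ v, f (s * v) = ((absF s)⁻¹ : ℝ) * ∫ v, f v := by
  have he : MeasurableEmbedding (s * · : F → F) := (Homeomorph.mulLeft₀ s hs).measurableEmbedding
  rw [← he.integral_map, volume_map_mul_left hs, integral_smul_measure,
    ENNReal.toReal_ofReal (inv_nonneg.2 (absF_nonneg _)), Complex.real_smul]

end Jacobian

end

end Kuznetsov

/-! ### Fourier inversion for pairings, from one variable to products -/

namespace Kuznetsov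

noncomputable section

set_option linter.unusedSectionVars false

variable {F : Type*} [NontriviallyNormedField F] [ProperSpace F]

theorem integrable_mul_addChar {X : Type*} [TopologicalSpace X] [MeasurableSpace X]
    [OpensMeasurableSpace X] {μ : Measure X} {f : X → ℂ} (hf : Integrable f μ)
    {ψ : AddChar F Circle} (hψ : Continuous ψ) {P : X → F} (hP : Continuous P) :
    Integrable (fun x => f x * (ψ (P x) : ℂ)) μ := by
  have hc : Continuous fun x => (ψ (P x) : ℂ) := continuous_subtype_val.comp (hψ.comp hP)
  refine (hf.norm).mono (hf.aestronglyMeasurable.mul hc.aestronglyMeasurable) (.of_forall fun x => ?_)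
  rw [norm_mul, norm_norm, Circle.norm_coe, mul_one]

section slices

variable {V W : Type*} [NormedAddCommGroup V] [NormedSpace F V] [FiniteDimensional F V]
  [NormedAddCommGroup W] [NormedSpace F W] [FiniteDimensional F W]

theorem IsSB.slice_right {Φ : V × W → ℂ} (hΦ : IsSB F Φ) (w : W) : IsSB F fun v => Φ (v, w) := by
  simpa using hΦ.comp_affine (LinearMap.inl F V W) LinearMap.inl_injective (0, w)

theorem IsSB.slice_left {Φ : V × W → ℂ} (hΦ : IsSB F Φ) (v : V) : IsSB F fun w => Φ (v, w) := by
  simpa using hΦ.comp_affine (LinearMap.inr F V W) LinearMap.inr_injective (v, 0)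

theorem IsSB.swap {Φ : V × W → ℂ} (hΦ : IsSB F Φ) : IsSB F fun p : W × V => Φ (p.2, p.1) :=
  hΦ.comp_linear (LinearEquiv.prodComm F W V).toLinearMap (LinearEquiv.injective _)

variable [MeasureSpace V] [BorelSpace V] [(volume : Measure V).IsAddHaarMeasure]
  [MeasureSpace W] [BorelSpace W] [(volume : Measure W).IsAddHaarMeasure]
  {ψ : AddChar F Circle}

theorem IsSB.partialFT_right (hψ : Continuous ψ) (hψ1 : ∃ x, ψ x ≠ 1) (B : W →ₗ[F] W →ₗ[F] F)
    (hB : ∀ x, (∀ y, B x y = 0) → x = 0) {Φ : V × W → ℂ} (hΦ : IsSB F Φ) :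
    IsSB F fun p : V × W => ∫ z, Φ (p.1, z) * (ψ (B z p.2) : ℂ) :=
  (hΦ.swap.partialFT hψ hψ1 B hB volume).swap

theorem IsSB.fourier (hψ : Continuous ψ) (hψ1 : ∃ x, ψ x ≠ 1) (B : V →ₗ[F] V →ₗ[F] F)
    (hB : ∀ x, (∀ y, B x y = 0) → x = 0) {Φ : V → ℂ} (hΦ : IsSB F Φ) :
    IsSB F fun y => ∫ x, Φ x * (ψ (B x y) : ℂ) := by
  have h1 : IsSB F fun p : V × (Fin 0 → F) => Φ p.1 :=
    hΦ.comp_linear (LinearMap.fst F V (Fin 0 → F)) fun p q h => Prod.ext h (Subsingleton.elim _ _)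
  exact (h1.partialFT hψ hψ1 B hB volume).slice_right 0

/-- Fourier inversion for the pairing `B` and the given measure. -/
def HasInversion (ψ : AddChar F Circle) (B : V →ₗ[F] V →ₗ[F] F) : Prop :=
  ∀ Φ : V → ℂ, IsSB F Φ → ∀ x₀,
    ∫ y, (∫ x, Φ x * (ψ (B x y) : ℂ)) * (ψ (-B x₀ y) : ℂ) = Φ x₀

/-- The orthogonal sum of two pairings. -/
def prodPairing (B₁ : V →ₗ[F] V →ₗ[F] F) (B₂ : W →ₗ[F] W →ₗ[F] F) :
    V × W →ₗ[F] V × W →ₗ[F] F :=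
  LinearMap.mk₂ F (fun p q => B₁ p.1 q.1 + B₂ p.2 q.2)
    (fun p p' q => by simp; abel) (fun c p q => by simp [mul_add])
    (fun p q q' => by simp; abel) (fun c p q => by simp [mul_add])

theorem prodPairing_apply (B₁ : V →ₗ[F] V →ₗ[F] F) (B₂ : W →ₗ[F] W →ₗ[F] F) (p q : V × W) :
    prodPairing B₁ B₂ p q = B₁ p.1 q.1 + B₂ p.2 q.2 := rfl

theorem prodPairing_nondegenerate {B₁ : V →ₗ[F] V →ₗ[F] F} {B₂ : W →ₗ[F] W →ₗ[F] F}
    (h1 : ∀ x, (∀ y, B₁ x y = 0) → x = 0) (h2 : ∀ x, (∀ y, B₂ x y = 0) → x = 0)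
    (p : V × W) (hp : ∀ q, prodPairing B₁ B₂ p q = 0) : p = 0 :=
  Prod.ext (h1 _ fun y => by simpa [prodPairing_apply] using hp (y, 0))
    (h2 _ fun y => by simpa [prodPairing_apply] using hp (0, y))

theorem continuous_pairing_left (B : V →ₗ[F] V →ₗ[F] F) (y : V) : Continuous fun x => B x y :=
  (B.flip y).continuous_of_finiteDimensional

theorem continuous_pairing_right (B : V →ₗ[F] V →ₗ[F] F) (x : V) : Continuous fun y => B x y :=
  (B x).continuous_of_finiteDimensional

theorem integral_prodPairing (hψ : Continuous ψ) (B₁ : V →ₗ[F] V →ₗ[F] F) (B₂ : W →ₗ[F] W →ₗ[F] F)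
    {Φ : V × W → ℂ} (hΦ : IsSB F Φ) (q : V × W) :
    ∫ p, Φ p * (ψ (prodPairing B₁ B₂ p q) : ℂ) =
      ∫ w, (∫ v, Φ (v, w) * (ψ (B₁ v q.1) : ℂ)) * (ψ (B₂ w q.2) : ℂ) := by
  have : ProperSpace V := FiniteDimensional.proper F V
  have : ProperSpace W := FiniteDimensional.proper F W
  have hi := integrable_mul_addChar (hΦ.integrable volume) hψ
    (continuous_pairing_left (prodPairing B₁ B₂) q)
  rw [Measure.volume_eq_prod] at hi ⊢
  rw [integral_prod_symm _ hi]
  congr 1 with w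
  rw [← integral_mul_const]
  congr 1 with v
  rw [prodPairing_apply, AddChar.map_add_eq_mul]
  push_cast
  ring

/-- Inversion is carried out in the second variable, then in the first. Fubini applies because the
iterated partial transform is again Schwartz–Bruhat, hence integrable. -/
theorem HasInversion.prod (hψ : Continuous ψ) (hψ1 : ∃ x, ψ x ≠ 1) {B₁ : V →ₗ[F] V →ₗ[F] F}
    {B₂ : W →ₗ[F] W →ₗ[F] F} (h1 : HasInversion ψ B₁) (h2 : HasInversion ψ B₂)
    (n1 : ∀ x, (∀ y, B₁ x y = 0) → x = 0) (n2 : ∀ x, (∀ y, B₂ x y = 0) → x = 0) :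
    HasInversion ψ (prodPairing B₁ B₂) := by
  intro Φ hΦ p₀
  have : ProperSpace V := FiniteDimensional.proper F V
  have : ProperSpace W := FiniteDimensional.proper F W
  have s1 := hΦ.partialFT hψ hψ1 B₁ n1 volume
  have s2 := s1.partialFT_right hψ hψ1 B₂ n2
  have e1 : ∀ q : V × W, ∫ p, Φ p * (ψ (prodPairing B₁ B₂ p q) : ℂ) =
      ∫ w, (∫ v, Φ (v, w) * (ψ (B₁ v q.1) : ℂ)) * (ψ (B₂ w q.2) : ℂ) :=
    integral_prodPairing hψ B₁ B₂ hΦ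
  simp_rw [e1]
  have hi := integrable_mul_addChar (s2.integrable volume) hψ
    (P := fun q => -prodPairing B₁ B₂ p₀ q) (continuous_pairing_right (prodPairing B₁ B₂) p₀).neg
  rw [Measure.volume_eq_prod] at hi ⊢
  refine (integral_prod _ hi).trans ?_
  have e2 : ∀ y : V, ∫ z, (∫ w, (∫ v, Φ (v, w) * (ψ (B₁ v y) : ℂ)) * (ψ (B₂ w z) : ℂ)) *
      (ψ (-prodPairing B₁ B₂ p₀ (y, z)) : ℂ) =
      (∫ v, Φ (v, p₀.2) * (ψ (B₁ v y) : ℂ)) * (ψ (-B₁ p₀.1 y) : ℂ) := by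
    intro y
    rw [← h2 _ (s1.slice_left y) p₀.2, ← integral_mul_const]
    congr 1 with z
    rw [prodPairing_apply, neg_add, AddChar.map_add_eq_mul]
    push_cast
    ring
  simp only [e2]
  exact h1 _ (hΦ.slice_right p₀.2) p₀.1

/-- Two separate maps A and A' are allowed because the trace pairing becomes a sum of products of
entries only after transposing one of its two arguments. -/
theorem HasInversion.transfer {B : V →ₗ[F] V →ₗ[F] F} {B' : W →ₗ[F] W →ₗ[F] F}
    (h : HasInversion ψ B) (A A' : V ≃ₗ[F] W) (hA : MeasurePreserving A)
    (hA' : MeasurePreserving A') (hB : ∀ x y, B' (A x) (A' y) = B x y) : HasInversion ψ B' := by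
  intro Φ hΦ w₀
  rw [← hA'.integral_comp (measurableEmbedding_linearEquiv A')]
  have h1 := h _ (hΦ.comp_linear A.toLinearMap A.injective) (A.symm w₀)
  have e : ∀ y, ∫ w, Φ w * (ψ (B' w (A' y)) : ℂ) = ∫ x, Φ (A x) * (ψ (B x y) : ℂ) := fun y => by
    rw [← hA.integral_comp (measurableEmbedding_linearEquiv A)]
    simp only [hB]
  simp only [e]
  have e2 : ∀ y, B' w₀ (A' y) = B (A.symm w₀) y := fun y => by
    rw [← hB, A.apply_symm_apply]
  simp only [e2]
  simpa using h1

/-- The pairing `∑ᵢ B(xᵢ, yᵢ)` on `Vⁿ`. -/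
def piPairing (B : V →ₗ[F] V →ₗ[F] F) (n : ℕ) : (Fin n → V) →ₗ[F] (Fin n → V) →ₗ[F] F :=
  LinearMap.mk₂ F (fun p q => ∑ i, B (p i) (q i))
    (fun p p' q => by simp [Finset.sum_add_distrib])
    (fun c p q => by simp [Finset.mul_sum])
    (fun p q q' => by simp [Finset.sum_add_distrib])
    (fun c p q => by simp [Finset.mul_sum])

theorem piPairing_apply (B : V →ₗ[F] V →ₗ[F] F) (n : ℕ) (p q : Fin n → V) :
    piPairing B n p q = ∑ i, B (p i) (q i) := rfl

theorem piPairing_nondegenerate {B : V →ₗ[F] V →ₗ[F] F} (h : ∀ x, (∀ y, B x y = 0) → x = 0)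
    (n : ℕ) (p : Fin n → V) (hp : ∀ q, piPairing B n p q = 0) : p = 0 := by
  funext i
  refine h _ fun y => ?_
  have h1 := hp (Pi.single i y)
  rw [piPairing_apply, Finset.sum_eq_single i] at h1
  · simpa using h1
  · intro j _ hj
    simp [Pi.single_eq_of_ne hj]
  · simp

theorem measurePreserving_consLinearEquiv (n : ℕ) [SigmaFinite (volume : Measure V)] :
    MeasurePreserving (Fin.consLinearEquiv F fun _ : Fin (n + 1) => V) := by
  have h := (volume_preserving_piFinSuccAbove (fun _ : Fin (n + 1) => V) 0).symm
  convert h using 1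
  funext p
  simp only [Fin.consLinearEquiv, MeasurableEquiv.piFinSuccAbove]
  exact (Fin.insertNth_zero' p.1 p.2).symm

theorem HasInversion.pi (hψ : Continuous ψ) (hψ1 : ∃ x, ψ x ≠ 1) {B : V →ₗ[F] V →ₗ[F] F}
    (h : HasInversion ψ B) (n1 : ∀ x, (∀ y, B x y = 0) → x = 0) (n : ℕ) :
    HasInversion ψ (piPairing B n) := by
  have : ProperSpace V := FiniteDimensional.proper F V
  induction n with
  | zero =>
    intro Φ _ x₀
    simp only [integral_unique, piPairing_apply]
    simp [measureReal_def, volume_pi, Subsingleton.elim default x₀]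
  | succ n ih =>
    refine (h.prod hψ hψ1 ih n1 (piPairing_nondegenerate n1 n)).transfer
      (Fin.consLinearEquiv F fun _ : Fin (n + 1) => V)
      (Fin.consLinearEquiv F fun _ : Fin (n + 1) => V) (measurePreserving_consLinearEquiv n)
      (measurePreserving_consLinearEquiv n) fun x y => ?_
    rw [piPairing_apply, Fin.sum_univ_succ, prodPairing_apply, piPairing_apply]
    simp [Fin.consLinearEquiv]

end slices

section base

variable [MeasureSpace F] [BorelSpace F] [(volume : Measure F).IsAddHaarMeasure]
  {ψ : AddChar F Circle}

theorem mul_nondegenerate (x : F) (h : ∀ y, LinearMap.mul F F x y = 0) : x = 0 := by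
  simpa using h 1

theorem hasInversion_mul (hψ : Continuous ψ) (hψ1 : ∃ x, ψ x ≠ 1)
    (hs : IsSelfDual ψ (volume : Measure F)) : HasInversion ψ (LinearMap.mul F F) := by
  intro Φ hΦ x₀
  have h1 := hΦ.fourier hψ hψ1 _ mul_nondegenerate
  -- Self-duality uses ψ in both transforms and returns the reflected function; evaluation at -x₀
  -- turns this into inversion with ψ⁻¹ in the second transform.
  have h2 := hs Φ hΦ.continuous (hΦ.integrable volume) (h1.integrable volume) (-x₀)
  rw [neg_neg] at h2
  rw [← h2]
  congr 1 with y
  congr 3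
  simp [mul_comm]

/-- Passing to ψ⁻¹ reflects the frequency, which a change of variable undoes. The inverse Hankel
transform requires the whole theory for ψ⁻¹. -/
theorem IsSelfDual.inv (hs : IsSelfDual ψ (volume : Measure F)) :
    IsSelfDual ψ⁻¹ (volume : Measure F) := by
  intro Φ h1 h2 h3 x
  have e : ∀ z, ∫ y, Φ y * (ψ⁻¹ (y * z) : ℂ) = ∫ y, Φ y * (ψ (y * -z) : ℂ) := fun z => by
    simp [AddChar.inv_apply]
  simp only [e] at h3 ⊢
  have h4 := hs Φ h1 h2 (by simpa using h3.comp_neg) x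
  rw [← h4, ← integral_neg_eq_self]
  simp [AddChar.inv_apply]

theorem continuous_inv_addChar (hψ : Continuous ψ) : Continuous (ψ⁻¹ : AddChar F Circle) := by
  have h : ((ψ⁻¹ : AddChar F Circle) : F → Circle) = fun x => ψ (-x) :=
    funext fun x => AddChar.inv_apply ψ x
  rw [h]
  exact hψ.comp continuous_neg

theorem inv_addChar_ne_one (hψ1 : ∃ x, ψ x ≠ 1) : ∃ x, (ψ⁻¹ : AddChar F Circle) x ≠ 1 := by
  obtain ⟨x, hx⟩ := hψ1
  exact ⟨-x, by rwa [AddChar.inv_apply, neg_neg]⟩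

end base

end

end Kuznetsov

/-! ### Block decompositions of the open Bruhat cell -/

namespace Kuznetsov

noncomputable section

open scoped ENNReal

set_option linter.unusedSectionVars false

section algebra

variable {F : Type*} [Field F] {n m : ℕ}

/-- The matrix `w t`. -/
def wt (t : Torus F n) : Matrix (Fin n) (Fin n) F :=
  Matrix.of fun i j => if j = i.rev then (t j : F) else 0

/-- The matrix `n₁ w t n₂`. -/
def bruhat (t : Torus F n) (u : UCoord F n × UCoord F n) : Matrix (Fin n) (Fin n) F :=
  unipMatrix u.1 * wt t * unipMatrix u.2

theorem antidiag_mul_diag_val (t : Torus F n) : (antidiag F n * diag t).val = wt t := by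
  ext i j
  simp [antidiag, diag, wt, Matrix.mul_apply, Matrix.diagonal_apply]

theorem val_unip_mul (t : Torus F n) (u : UCoord F n × UCoord F n) :
    (unip u.1 * (antidiag F n * diag t) * unip u.2).val = bruhat t u := by
  rw [Units.val_mul, Units.val_mul, antidiag_mul_diag_val]
  rfl

theorem det_wt (t : Torus F n) : (wt t).det = (antidiag F n).val.det * ∏ i, (t i : F) := by
  rw [← antidiag_mul_diag_val, Units.val_mul, Matrix.det_mul]
  simp [diag]

theorem det_antidiag_mul_self : (antidiag F n).val.det * (antidiag F n).val.det = 1 := by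
  rw [← Matrix.det_mul]
  change ((Matrix.of fun i j : Fin n => if j = i.rev then (1 : F) else 0) *
      (Matrix.of fun i j : Fin n => if j = i.rev then (1 : F) else 0)).det = 1
  rw [antidiag_mul_self, Matrix.det_one]

theorem det_bruhat (t : Torus F n) (u : UCoord F n × UCoord F n) :
    (bruhat t u).det = (antidiag F n).val.det * ∏ i, (t i : F) := by
  simp [bruhat, det_unipMatrix, det_wt]

/-- Positions above the diagonal of a matrix of size `m + 1`: those in the first row, and those
above the diagonal of the lower right block. -/
def rowEquiv (m : ℕ) : Fin m ⊕ {p : Fin m × Fin m // p.1 < p.2} ≃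
    {p : Fin (m + 1) × Fin (m + 1) // p.1 < p.2} :=
  Equiv.ofBijective
    (Sum.elim (fun j => ⟨(0, j.succ), Fin.succ_pos j⟩)
      fun p => ⟨(p.1.1.succ, p.1.2.succ), Fin.succ_lt_succ_iff.2 p.2⟩) (by
    constructor
    · rintro (i | ⟨⟨i, j⟩, h⟩) (k | ⟨⟨k, l⟩, h'⟩) <;> simp [Fin.succ_ne_zero, Ne.symm]
    · rintro ⟨⟨i, j⟩, h⟩
      have hj : j ≠ 0 := Fin.ne_zero_of_lt h
      obtain ⟨j, rfl⟩ := Fin.exists_succ_eq.2 hj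
      induction i using Fin.cases with
      | zero => exact ⟨.inl j, rfl⟩
      | succ i => exact ⟨.inr ⟨(i, j), Fin.succ_lt_succ_iff.1 h⟩, rfl⟩)

/-- Positions above the diagonal of a matrix of size `m + 1`: those in the last column, and those
above the diagonal of the upper left block. -/
def colEquiv (m : ℕ) : {p : Fin m × Fin m // p.1 < p.2} ⊕ Fin m ≃
    {p : Fin (m + 1) × Fin (m + 1) // p.1 < p.2} :=
  Equiv.ofBijective
    (Sum.elim (fun p => ⟨(p.1.1.castSucc, p.1.2.castSucc), Fin.castSucc_lt_castSucc_iff.2 p.2⟩)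
      fun i => ⟨(i.castSucc, Fin.last m), Fin.castSucc_lt_last i⟩) (by
    constructor
    · rintro (⟨⟨i, j⟩, h⟩ | i) (⟨⟨k, l⟩, h'⟩ | k) <;>
        simp [(Fin.castSucc_lt_last _).ne, (Fin.castSucc_lt_last _).ne']
    · rintro ⟨⟨i, j⟩, h⟩
      have hi : i ≠ Fin.last m := Fin.ne_last_of_lt h
      obtain ⟨i, rfl⟩ := Fin.exists_castSucc_eq.2 hi
      induction j using Fin.lastCases with
      | last => exact ⟨.inr i, rfl⟩
      | cast j => exact ⟨.inl ⟨(i, j), Fin.castSucc_lt_castSucc_iff.1 h⟩, rfl⟩)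

/-- The unipotent matrix with first row `(1, r)` and lower right block `u`. -/
def rowU (r : Fin m → F) (u : UCoord F m) : UCoord F (m + 1) :=
  fun p => Sum.elim r u ((rowEquiv m).symm p)

/-- The unipotent matrix with last column `(b, 1)` and upper left block `u`. -/
def colU (u : UCoord F m) (b : Fin m → F) : UCoord F (m + 1) :=
  fun p => Sum.elim u b ((colEquiv m).symm p)

theorem rowU_inl (r : Fin m → F) (u : UCoord F m) (j : Fin m) :
    rowU r u ⟨(0, j.succ), Fin.succ_pos j⟩ = r j := by
  change Sum.elim r u ((rowEquiv m).symm (rowEquiv m (.inl j))) = r j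
  simp

theorem rowU_inr (r : Fin m → F) (u : UCoord F m) (p : {p : Fin m × Fin m // p.1 < p.2}) :
    rowU r u ⟨(p.1.1.succ, p.1.2.succ), Fin.succ_lt_succ_iff.2 p.2⟩ = u p := by
  change Sum.elim r u ((rowEquiv m).symm (rowEquiv m (.inr p))) = u p
  simp

theorem colU_inl (u : UCoord F m) (b : Fin m → F) (p : {p : Fin m × Fin m // p.1 < p.2}) :
    colU u b ⟨(p.1.1.castSucc, p.1.2.castSucc), Fin.castSucc_lt_castSucc_iff.2 p.2⟩ = u p := by
  change Sum.elim u b ((colEquiv m).symm (colEquiv m (.inl p))) = u p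
  simp

theorem colU_inr (u : UCoord F m) (b : Fin m → F) (i : Fin m) :
    colU u b ⟨(i.castSucc, Fin.last m), Fin.castSucc_lt_last i⟩ = b i := by
  change Sum.elim u b ((colEquiv m).symm (colEquiv m (.inr i))) = b i
  simp

section entries

variable (r b : Fin m → F) (u : UCoord F m) (i j : Fin m)

theorem unipMatrix_self {n : ℕ} (u : UCoord F n) (i : Fin n) : unipMatrix u i i = 1 := by
  simp [unipMatrix]

theorem unipMatrix_of_lt {n : ℕ} (u : UCoord F n) {i j : Fin n} (h : j < i) :
    unipMatrix u i j = 0 := by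
  simp [unipMatrix, not_lt.2 h.le, h.ne']

@[simp] theorem unipMatrix_rowU_zero_zero : unipMatrix (rowU r u) 0 0 = 1 := unipMatrix_self _ _

@[simp] theorem unipMatrix_rowU_zero_succ : unipMatrix (rowU r u) 0 j.succ = r j := by
  rw [← rowU_inl r u j]
  simp [unipMatrix, Fin.succ_pos]

@[simp] theorem unipMatrix_rowU_succ_zero : unipMatrix (rowU r u) i.succ 0 = 0 :=
  unipMatrix_of_lt _ (Fin.succ_pos i)

@[simp] theorem unipMatrix_rowU_succ_succ :
    unipMatrix (rowU r u) i.succ j.succ = unipMatrix u i j := by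
  by_cases h : i < j
  · have := rowU_inr r u ⟨(i, j), h⟩
    simp [unipMatrix, h, Fin.succ_lt_succ_iff.2 h, ← this]
  · simp [unipMatrix, h]

@[simp] theorem unipMatrix_colU_last_last :
    unipMatrix (colU u b) (Fin.last m) (Fin.last m) = 1 := unipMatrix_self _ _

@[simp] theorem unipMatrix_colU_castSucc_last :
    unipMatrix (colU u b) i.castSucc (Fin.last m) = b i := by
  rw [← colU_inr u b i]
  simp [unipMatrix, Fin.castSucc_lt_last]

@[simp] theorem unipMatrix_colU_last_castSucc :
    unipMatrix (colU u b) (Fin.last m) j.castSucc = 0 :=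
  unipMatrix_of_lt _ (Fin.castSucc_lt_last j)

@[simp] theorem unipMatrix_colU_castSucc_castSucc :
    unipMatrix (colU u b) i.castSucc j.castSucc = unipMatrix u i j := by
  by_cases h : i < j
  · have := colU_inl u b ⟨(i, j), h⟩
    simp [unipMatrix, h, ← this]
  · simp [unipMatrix, h]

variable (t : Torus F m) (s : Fˣ)

/-- The torus element `(t, s)`. -/
def tsnoc (t : Torus F m) (s : Fˣ) : Torus F (m + 1) := Fin.snoc (α := fun _ => Fˣ) t s

/-- The torus element `(s, t)`. -/
def tcons (s : Fˣ) (t : Torus F m) : Torus F (m + 1) := Fin.cons (α := fun _ => Fˣ) s t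

@[simp] theorem tsnoc_last : tsnoc t s (Fin.last m) = s := by simp [tsnoc]

@[simp] theorem tsnoc_castSucc : tsnoc t s i.castSucc = t i := by simp [tsnoc]

@[simp] theorem tcons_zero : tcons s t 0 = s := by simp [tcons]

@[simp] theorem tcons_succ : tcons s t i.succ = t i := by simp [tcons]

@[simp] theorem wt_tsnoc_zero_last : wt (tsnoc t s) 0 (Fin.last m) = s := by simp [wt]

@[simp] theorem wt_tsnoc_zero_castSucc : wt (tsnoc t s) 0 j.castSucc = 0 := by
  simp [wt, (Fin.castSucc_lt_last j).ne]

@[simp] theorem wt_tsnoc_succ_last : wt (tsnoc t s) i.succ (Fin.last m) = 0 := by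
  simp [wt, Fin.rev_succ, (Fin.castSucc_lt_last _).ne']

@[simp] theorem wt_tsnoc_succ_castSucc : wt (tsnoc t s) i.succ j.castSucc = wt t i j := by
  simp [wt, Fin.rev_succ]

@[simp] theorem wt_tcons_last_zero : wt (tcons s t) (Fin.last m) 0 = s := by simp [wt]

@[simp] theorem wt_tcons_castSucc_zero : wt (tcons s t) i.castSucc 0 = 0 := by
  simp [wt, Fin.rev_castSucc, (Fin.succ_ne_zero _).symm]

@[simp] theorem wt_tcons_last_succ : wt (tcons s t) (Fin.last m) j.succ = 0 := by
  simp [wt, Fin.succ_ne_zero]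

@[simp] theorem wt_tcons_castSucc_succ : wt (tcons s t) i.castSucc j.succ = wt t i j := by
  simp [wt, Fin.rev_castSucc]

end entries

/-- The block matrix with first row `(c, d)` and remaining rows `(X, b)`. -/
def blk (X : Fin m → Fin m → F) (c b : Fin m → F) (d : F) : Fin (m + 1) → Fin (m + 1) → F :=
  Fin.cons (α := fun _ => Fin (m + 1) → F) (Fin.snoc (α := fun _ => F) c d)
    fun i => Fin.snoc (α := fun _ => F) (X i) (b i)

/-- The block matrix with last row `(d, g)` and remaining rows `(b, Y)`. -/
def blkDual (Y : Fin m → Fin m → F) (b g : Fin m → F) (d : F) : Fin (m + 1) → Fin (m + 1) → F :=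
  Fin.snoc (α := fun _ => Fin (m + 1) → F) (fun i => Fin.cons (α := fun _ => F) (b i) (Y i))
    (Fin.cons (α := fun _ => F) d g)

section blocks

variable (X : Fin m → Fin m → F) (c b : Fin m → F) (d : F) (i j : Fin m)

@[simp] theorem blk_zero_last : blk X c b d 0 (Fin.last m) = d := by simp [blk]
@[simp] theorem blk_zero_castSucc : blk X c b d 0 j.castSucc = c j := by simp [blk]
@[simp] theorem blk_succ_last : blk X c b d i.succ (Fin.last m) = b i := by simp [blk]
@[simp] theorem blk_succ_castSucc : blk X c b d i.succ j.castSucc = X i j := by simp [blk]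
@[simp] theorem blkDual_last_zero : blkDual X c b d (Fin.last m) 0 = d := by simp [blkDual]
@[simp] theorem blkDual_castSucc_zero : blkDual X c b d i.castSucc 0 = c i := by simp [blkDual]
@[simp] theorem blkDual_last_succ : blkDual X c b d (Fin.last m) j.succ = b j := by simp [blkDual]
@[simp] theorem blkDual_castSucc_succ : blkDual X c b d i.castSucc j.succ = X i j := by
  simp [blkDual]

theorem trace_blk_mul_blkDual (Y : Fin m → Fin m → F) (β γ : Fin m → F) (δ : F) :
    Matrix.trace (Matrix.of (blk X c b d) * Matrix.of (blkDual Y β γ δ)) =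
      (c ⬝ᵥ β + d * δ) + b ⬝ᵥ γ + Matrix.trace (Matrix.of X * Matrix.of Y) := by
  simp only [Matrix.trace, Matrix.diag_apply, Matrix.mul_apply, Matrix.of_apply, dotProduct]
  rw [Fin.sum_univ_succ]
  simp only [Fin.sum_univ_castSucc, blk_zero_castSucc, blk_zero_last, blk_succ_castSucc,
    blk_succ_last, blkDual_castSucc_zero, blkDual_last_zero, blkDual_castSucc_succ,
    blkDual_last_succ, Finset.sum_add_distrib]
  ring

end blocks

/-- With s last, w(t, s) has s in the upper right corner and w t in the lower left block. The point
is that s occurs in one entry only, where it is added to a term independent of it. -/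
theorem bruhat_tsnoc (t : Torus F m) (s : Fˣ) (u : UCoord F m × UCoord F m) (r b : Fin m → F) :
    bruhat (tsnoc t s) (rowU r u.1, colU u.2 b) =
      Matrix.of (blk (fun i j => bruhat t u i j) (Matrix.vecMul r (wt t * unipMatrix u.2))
        ((unipMatrix u.1 * wt t).mulVec b) (r ⬝ᵥ (wt t).mulVec b + s)) := by
  have h1 : ∀ k, (unipMatrix (rowU r u.1) * wt (tsnoc t s)) 0 k =
      Fin.lastCases (motive := fun _ => F) (s : F) (fun k => Matrix.vecMul r (wt t) k) k := by
    intro k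
    induction k using Fin.lastCases with
    | last => simp [Matrix.mul_apply, Fin.sum_univ_succ]
    | cast k => simp [Matrix.mul_apply, Fin.sum_univ_succ, Matrix.vecMul, dotProduct]
  have h2 : ∀ i k, (unipMatrix (rowU r u.1) * wt (tsnoc t s)) (Fin.succ i) k =
      Fin.lastCases (motive := fun _ => F) 0 (fun k => (unipMatrix u.1 * wt t) i k) k := by
    intro i k
    induction k using Fin.lastCases with
    | last => simp [Matrix.mul_apply, Fin.sum_univ_succ]
    | cast k => simp [Matrix.mul_apply, Fin.sum_univ_succ]
  ext i j
  rw [bruhat, Matrix.mul_apply, Fin.sum_univ_castSucc, Matrix.of_apply]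
  induction i using Fin.cases with
  | zero =>
    induction j using Fin.lastCases with
    | last =>
      rw [blk_zero_last, Matrix.dotProduct_mulVec]
      simp [h1, dotProduct]
    | cast j =>
      rw [blk_zero_castSucc, ← Matrix.vecMul_vecMul]
      simp [h1, Matrix.vecMul, dotProduct]
  | succ i =>
    induction j using Fin.lastCases with
    | last =>
      rw [blk_succ_last]
      simp [h2, Matrix.mulVec, dotProduct]
    | cast j =>
      rw [blk_succ_castSucc, bruhat, Matrix.mul_apply (M := unipMatrix u.1 * wt t)]
      simp [h2]

/-- With s first, it sits in the lower left corner instead, and the complementary block receives a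
rank one correction. This is the form met on the Fourier dual side. -/
theorem bruhat_tcons (t : Torus F m) (s : Fˣ) (u : UCoord F m × UCoord F m) (β γ : Fin m → F) :
    bruhat (tcons s t) (colU u.1 β, rowU γ u.2) =
      Matrix.of (blkDual (fun i j => bruhat t u i j + s * (β i * γ j)) ((s : F) • β)
        ((s : F) • γ) s) := by
  have h1 : ∀ k, (unipMatrix (colU u.1 β) * wt (tcons s t)) (Fin.last m) k =
      Fin.cases (motive := fun _ => F) (s : F) (fun _ => 0) k := by
    intro k
    induction k using Fin.cases with
    | zero => simp [Matrix.mul_apply, Fin.sum_univ_castSucc]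
    | succ k => simp [Matrix.mul_apply, Fin.sum_univ_castSucc]
  have h2 : ∀ i k, (unipMatrix (colU u.1 β) * wt (tcons s t)) (Fin.castSucc i) k =
      Fin.cases (motive := fun _ => F) (β i * s) (fun k => (unipMatrix u.1 * wt t) i k) k := by
    intro i k
    induction k using Fin.cases with
    | zero => simp [Matrix.mul_apply, Fin.sum_univ_castSucc]
    | succ k => simp [Matrix.mul_apply, Fin.sum_univ_castSucc]
  ext i j
  rw [bruhat, Matrix.mul_apply, Fin.sum_univ_succ, Matrix.of_apply]
  induction i using Fin.lastCases with
  | last =>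
    induction j using Fin.cases with
    | zero => rw [blkDual_last_zero]; simp [h1]
    | succ j => rw [blkDual_last_succ]; simp [h1]
  | cast i =>
    induction j using Fin.cases with
    | zero => rw [blkDual_castSucc_zero]; simp [h2, mul_comm]
    | succ j =>
      rw [blkDual_castSucc_succ, bruhat, Matrix.mul_apply (M := unipMatrix u.1 * wt t)]
      simp only [h2, Fin.cases_zero, Fin.cases_succ, unipMatrix_rowU_zero_succ,
        unipMatrix_rowU_succ_succ]
      ring

/-- The indicator of the first index. -/
def firstVec (F : Type*) [Field F] (m : ℕ) : Fin m → F := fun i => if i.val = 0 then 1 else 0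

/-- The indicator of the last index. -/
def lastVec (F : Type*) [Field F] (m : ℕ) : Fin m → F := fun i => if i.val + 1 = m then 1 else 0

/-- The inverse of the last coordinate, or `0` in size `0`. -/
def lastInv (t : Torus F m) : F := ∑ i : Fin m, if i.val + 1 = m then ((t i : F))⁻¹ else 0

theorem superSum_rowU (r : Fin m → F) (u : UCoord F m) :
    superSum (rowU r u) = r ⬝ᵥ firstVec F m + superSum u := by
  rw [superSum, ← (rowEquiv m).sum_comp, Fintype.sum_sum_type]
  congr 1
  · refine Finset.sum_congr rfl fun j _ => ?_
    have h : rowEquiv m (.inl j) = ⟨(0, j.succ), Fin.succ_pos j⟩ := rfl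
    rw [h, rowU_inl]
    by_cases hj : j.val = 0 <;> simp [firstVec, hj]
  · refine Finset.sum_congr rfl fun p _ => ?_
    have h : rowEquiv m (.inr p) =
      ⟨(p.1.1.succ, p.1.2.succ), Fin.succ_lt_succ_iff.2 p.2⟩ := rfl
    rw [h, rowU_inr]
    simp

theorem superSum_colU (u : UCoord F m) (b : Fin m → F) :
    superSum (colU u b) = superSum u + b ⬝ᵥ lastVec F m := by
  rw [superSum, ← (colEquiv m).sum_comp, Fintype.sum_sum_type]
  congr 1
  · refine Finset.sum_congr rfl fun p _ => ?_
    have h : colEquiv m (.inl p) =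
      ⟨(p.1.1.castSucc, p.1.2.castSucc), Fin.castSucc_lt_castSucc_iff.2 p.2⟩ := rfl
    rw [h, colU_inl]
    simp
  · refine Finset.sum_congr rfl fun j _ => ?_
    have h : colEquiv m (.inr j) = ⟨(j.castSucc, Fin.last m), Fin.castSucc_lt_last j⟩ := rfl
    rw [h, colU_inr]
    simp [lastVec]

theorem unipMatrix_mulVec_firstVec (u : UCoord F m) :
    (unipMatrix u).mulVec (firstVec F m) = firstVec F m := by
  cases m with
  | zero => exact Subsingleton.elim _ _
  | succ m =>
    have h : firstVec F (m + 1) = Pi.single 0 1 := by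
      ext i
      induction i using Fin.cases <;> simp [firstVec]
    rw [h, Matrix.mulVec_single_one]
    ext i
    induction i using Fin.cases with
    | zero => simp [unipMatrix_self]
    | succ i => simp [unipMatrix_of_lt u (Fin.succ_pos i)]

theorem lastVec_succ (F : Type*) [Field F] (m : ℕ) :
    lastVec F (m + 1) = Pi.single (Fin.last m) 1 := by
  ext i
  induction i using Fin.lastCases with
  | last => simp [lastVec]
  | cast i => simp [lastVec, (Fin.castSucc_lt_last i).ne, i.isLt.ne]

theorem lastVec_vecMul_unipMatrix (u : UCoord F m) :
    Matrix.vecMul (lastVec F m) (unipMatrix u) = lastVec F m := by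
  cases m with
  | zero => exact Subsingleton.elim _ _
  | succ m =>
    rw [lastVec_succ, Matrix.single_one_vecMul]
    ext i
    induction i using Fin.lastCases with
    | last => simp [unipMatrix_self]
    | cast i => simp [unipMatrix_of_lt u (Fin.castSucc_lt_last i), (Fin.castSucc_lt_last i).ne]

theorem lastInv_succ (t : Torus F (m + 1)) : lastInv t = (t (Fin.last m) : F)⁻¹ := by
  rw [lastInv, Finset.sum_eq_single (Fin.last m)]
  · simp
  · intro i _ hi
    rw [if_neg]
    intro h
    exact hi (Fin.ext (by simpa using h))
  · simp

/-- The vector e_m / t_m is the preimage of e₁ under w t; it supplies the translation that cancels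
the character on the first row. -/
theorem wt_mulVec_lastVec (t : Torus F m) :
    (wt t).mulVec (lastInv t • lastVec F m) = firstVec F m := by
  cases m with
  | zero => exact Subsingleton.elim _ _
  | succ m =>
    rw [Matrix.mulVec_smul, lastVec_succ, Matrix.mulVec_single_one, lastInv_succ]
    ext i
    induction i using Fin.cases with
    | zero => simp [wt, firstVec]
    | succ i => simp [wt, firstVec, Fin.rev_succ, (Fin.castSucc_lt_last _).ne']

/-- The last basis vector has square 1 except in size 0, where `lastInv` vanishes; this keeps the
later formulas uniform in the size. -/
theorem lastInv_mul_lastVec_dotProduct (t : Torus F m) :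
    lastInv t * (lastVec F m ⬝ᵥ lastVec F m) = lastInv t := by
  cases m with
  | zero => simp [lastInv]
  | succ m => simp [lastVec_succ]

end algebra

end

end Kuznetsov

/-! ### Splitting the measure of N × N, and convergence of orbital integrals -/

namespace Kuznetsov

noncomputable section

open scoped ENNReal

set_option linter.unusedSectionVars false

variable {F : Type*} [NontriviallyNormedField F] [ProperSpace F]
  [MeasureSpace F] [BorelSpace F] [(volume : Measure F).IsAddHaarMeasure] {n m : ℕ}

section splitting

theorem measurePreserving_prodProdProdComm {V₁ V₂ V₃ V₄ : Type*}
    [MeasureSpace V₁] [MeasureSpace V₂] [MeasureSpace V₃] [MeasureSpace V₄]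
    [SigmaFinite (volume : Measure V₁)] [SigmaFinite (volume : Measure V₂)]
    [SigmaFinite (volume : Measure V₃)] [SigmaFinite (volume : Measure V₄)] :
    MeasurePreserving fun p : (V₁ × V₂) × (V₃ × V₄) => ((p.1.1, p.2.1), (p.1.2, p.2.2)) := by
  have a : MeasurePreserving (MeasurableEquiv.prodAssoc : (V₁ × V₂) × (V₃ × V₄) ≃ᵐ _) :=
    volume_preserving_prodAssoc
  have b : MeasurePreserving ((MeasurableEquiv.prodAssoc : (V₂ × V₃) × V₄ ≃ᵐ _).symm) :=
    volume_preserving_prodAssoc.symm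
  have c : MeasurePreserving ((MeasurableEquiv.prodAssoc : (V₃ × V₂) × V₄ ≃ᵐ _)) :=
    volume_preserving_prodAssoc
  have d : MeasurePreserving ((MeasurableEquiv.prodAssoc : (V₁ × V₃) × (V₂ × V₄) ≃ᵐ _).symm) :=
    volume_preserving_prodAssoc.symm
  have e : MeasurePreserving (Prod.map Prod.swap id : (V₂ × V₃) × V₄ → (V₃ × V₂) × V₄) :=
    Measure.measurePreserving_swap.prod (.id volume)
  have i : MeasurePreserving (id : V₁ → V₁) := .id volume
  exact d.comp ((i.prod (c.comp (e.comp b))).comp a)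

/-- The coordinates `(r, u) ↦ rowU r u`. -/
def rowUEquiv (F : Type*) [MeasurableSpace F] (m : ℕ) :
    (Fin m → F) × UCoord F m ≃ᵐ UCoord F (m + 1) :=
  (MeasurableEquiv.sumPiEquivProdPi fun _ => F).symm.trans
    (MeasurableEquiv.piCongrLeft (fun _ => F) (rowEquiv m))

/-- The coordinates `(u, b) ↦ colU u b`. -/
def colUEquiv (F : Type*) [MeasurableSpace F] (m : ℕ) :
    UCoord F m × (Fin m → F) ≃ᵐ UCoord F (m + 1) :=
  (MeasurableEquiv.sumPiEquivProdPi fun _ => F).symm.trans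
    (MeasurableEquiv.piCongrLeft (fun _ => F) (colEquiv m))

theorem rowUEquiv_apply (p : (Fin m → F) × UCoord F m) : rowUEquiv F m p = rowU p.1 p.2 := by
  funext q
  obtain ⟨q, rfl⟩ := (rowEquiv m).surjective q
  refine (MeasurableEquiv.piCongrLeft_apply_apply (rowEquiv m) (β := fun _ => F) _ q).trans ?_
  rw [rowU, Equiv.symm_apply_apply]
  cases q <;> rfl

theorem colUEquiv_apply (p : UCoord F m × (Fin m → F)) : colUEquiv F m p = colU p.1 p.2 := by
  funext q
  obtain ⟨q, rfl⟩ := (colEquiv m).surjective q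
  refine (MeasurableEquiv.piCongrLeft_apply_apply (colEquiv m) (β := fun _ => F) _ q).trans ?_
  rw [colU, Equiv.symm_apply_apply]
  cases q <;> rfl

theorem measurePreserving_rowUEquiv : MeasurePreserving (rowUEquiv F m) :=
  (volume_measurePreserving_piCongrLeft (fun _ => F) (rowEquiv m)).comp
    (volume_measurePreserving_sumPiEquivProdPi_symm fun _ => F)

theorem measurePreserving_colUEquiv : MeasurePreserving (colUEquiv F m) :=
  (volume_measurePreserving_piCongrLeft (fun _ => F) (colEquiv m)).comp
    (volume_measurePreserving_sumPiEquivProdPi_symm fun _ => F)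

/-- The coordinates on `N × N` adapted to `bruhat_tsnoc`. -/
def snocEquiv (F : Type*) [MeasurableSpace F] (m : ℕ) :
    (UCoord F m × UCoord F m) × ((Fin m → F) × (Fin m → F)) ≃ᵐ
      UCoord F (m + 1) × UCoord F (m + 1) where
  toFun p := (rowUEquiv F m (p.2.1, p.1.1), colUEquiv F m (p.1.2, p.2.2))
  invFun q := ((((rowUEquiv F m).symm q.1).2, ((colUEquiv F m).symm q.2).1),
    (((rowUEquiv F m).symm q.1).1, ((colUEquiv F m).symm q.2).2))
  left_inv p := by simp
  right_inv q := by simp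
  measurable_toFun := by simp only [Equiv.coe_fn_mk]; fun_prop
  measurable_invFun := by simp only [Equiv.coe_fn_symm_mk]; fun_prop

/-- The coordinates on `N × N` adapted to `bruhat_tcons`. -/
def consEquiv (F : Type*) [MeasurableSpace F] (m : ℕ) :
    (UCoord F m × UCoord F m) × ((Fin m → F) × (Fin m → F)) ≃ᵐ
      UCoord F (m + 1) × UCoord F (m + 1) where
  toFun p := (colUEquiv F m (p.1.1, p.2.1), rowUEquiv F m (p.2.2, p.1.2))
  invFun q := ((((colUEquiv F m).symm q.1).1, ((rowUEquiv F m).symm q.2).2),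
    (((colUEquiv F m).symm q.1).2, ((rowUEquiv F m).symm q.2).1))
  left_inv p := by simp
  right_inv q := by simp
  measurable_toFun := by simp only [Equiv.coe_fn_mk]; fun_prop
  measurable_invFun := by simp only [Equiv.coe_fn_symm_mk]; fun_prop

theorem snocEquiv_apply (p : (UCoord F m × UCoord F m) × ((Fin m → F) × (Fin m → F))) :
    snocEquiv F m p = (rowU p.2.1 p.1.1, colU p.1.2 p.2.2) :=
  Prod.ext (rowUEquiv_apply _) (colUEquiv_apply _)

theorem consEquiv_apply (p : (UCoord F m × UCoord F m) × ((Fin m → F) × (Fin m → F))) :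
    consEquiv F m p = (colU p.1.1 p.2.1, rowU p.2.2 p.1.2) :=
  Prod.ext (colUEquiv_apply _) (rowUEquiv_apply _)

theorem measurePreserving_snocEquiv : MeasurePreserving (snocEquiv F m) :=
  (((measurePreserving_rowUEquiv (F := F) (m := m)).comp Measure.measurePreserving_swap).prod
    (measurePreserving_colUEquiv (F := F) (m := m))).comp measurePreserving_prodProdProdComm

theorem measurePreserving_consEquiv : MeasurePreserving (consEquiv F m) :=
  ((measurePreserving_colUEquiv (F := F) (m := m)).prod
    ((measurePreserving_rowUEquiv (F := F) (m := m)).comp Measure.measurePreserving_swap)).comp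
      measurePreserving_prodProdProdComm

end splitting

section orbital

/-- The orbital integral in coordinates. -/
def orbInt (ψ : AddChar F Circle) (Φ : Matrix (Fin n) (Fin n) F → ℂ) (t : Torus F n) : ℂ :=
  ∫ u : UCoord F n × UCoord F n, Φ (bruhat t u) * (ψ (-(superSum u.1 + superSum u.2)) : ℂ)

/-- The scalar relating push-forwards from `Mat_n` to orbital integrals. -/
def matFactor (t : Torus F n) : ℝ := deltaHalf t * (∏ i, modulus (t i)) ^ ((n : ℝ) / 2)

theorem modulus_det_bruhat (t : Torus F n) (u : UCoord F n × UCoord F n) :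
    modulus (Matrix.GeneralLinearGroup.det (unip u.1 * (antidiag F n * diag t) * unip u.2)) =
      ∏ i, modulus (t i) := by
  rw [← absF_coe, Matrix.GeneralLinearGroup.val_det_apply, val_unip_mul, det_bruhat, absF_mul,
    absF_eq_one_of_mul_self det_antidiag_mul_self, one_mul, absF_prod]
  simp only [absF_coe]

theorem orbitalIntegrand_restrictMat (ψ : AddChar F Circle) (Φ : Matrix (Fin n) (Fin n) F → ℂ)
    (t : Torus F n) (u : UCoord F n × UCoord F n) :
    orbitalIntegrand ψ (restrictMat Φ) t u = (((∏ i, modulus (t i)) ^ ((n : ℝ) / 2) : ℝ) : ℂ) *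
      (Φ (bruhat t u) * (ψ (-(superSum u.1 + superSum u.2)) : ℂ)) := by
  rw [orbitalIntegrand, restrictMat, modulus_det_bruhat, val_unip_mul, mul_assoc]

theorem orbitalIntegrand_restrictMatDual (ψ : AddChar F Circle)
    (Φ : Matrix (Fin n) (Fin n) F → ℂ) (t : Torus F n) (u : UCoord F n × UCoord F n) :
    orbitalIntegrand ψ (restrictMatDual Φ) t u =
      (((∏ i, modulus (t i)) ^ (-((n : ℝ) / 2)) : ℝ) : ℂ) *
      (Φ (bruhat t u)⁻¹ * (ψ (-(superSum u.1 + superSum u.2)) : ℂ)) := by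
  rw [orbitalIntegrand, restrictMatDual, modulus_det_bruhat, Matrix.coe_units_inv, val_unip_mul,
    mul_assoc]

theorem pushMat_eq (ψ : AddChar F Circle) (Φ : Matrix (Fin n) (Fin n) F → ℂ) (t : Torus F n) :
    pushMat ψ volume Φ t = (matFactor t : ℂ) * orbInt ψ Φ t := by
  rw [pushMat, push, orbital, matFactor, Complex.ofReal_mul, mul_assoc]
  congr 1
  simp only [orbitalIntegrand_restrictMat]
  exact integral_const_mul _ _

end orbital

section convergence

theorem continuous_unipMatrix : Continuous (unipMatrix : UCoord F n → Matrix (Fin n) (Fin n) F) := by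
  refine continuous_matrix fun i j => ?_
  by_cases h : i < j
  · simpa [unipMatrix, h] using continuous_apply _
  · simpa [unipMatrix, h] using continuous_const

theorem continuous_bruhat (t : Torus F n) : Continuous (bruhat t) :=
  ((continuous_unipMatrix.comp continuous_fst).matrix_mul continuous_const).matrix_mul
    (continuous_unipMatrix.comp continuous_snd)

theorem continuous_superSum : Continuous (superSum : UCoord F n → F) := by
  refine continuous_finsetSum _ fun p _ => ?_
  split_ifs
  · exact continuous_apply p
  · exact continuous_const

/-- The matrix `w t n₂`. -/
abbrev rightFactor (t : Torus F n) (u : UCoord F n × UCoord F n) : Matrix (Fin n) (Fin n) F :=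
  wt t * unipMatrix u.2

/-- The matrix `n₁ w t`. -/
abbrev leftFactor (t : Torus F n) (u : UCoord F n × UCoord F n) : Matrix (Fin n) (Fin n) F :=
  unipMatrix u.1 * wt t

theorem absF_det_wt (t : Torus F n) : absF (wt t).det = ∏ i, modulus (t i) := by
  rw [det_wt, absF_mul, absF_eq_one_of_mul_self det_antidiag_mul_self, one_mul, absF_prod]
  simp only [absF_coe]

theorem absF_det_rightFactor (t : Torus F n) (u : UCoord F n × UCoord F n) :
    absF (rightFactor t u).det = ∏ i, modulus (t i) := by
  rw [Matrix.det_mul, det_unipMatrix, mul_one, absF_det_wt]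

theorem absF_det_leftFactor (t : Torus F n) (u : UCoord F n × UCoord F n) :
    absF (leftFactor t u).det = ∏ i, modulus (t i) := by
  rw [Matrix.det_mul, det_unipMatrix, one_mul, absF_det_wt]

theorem det_wt_ne_zero (t : Torus F n) : (wt t).det ≠ 0 := by
  intro h
  have h1 := absF_det_wt t
  rw [h, absF_zero] at h1
  exact (Finset.prod_pos fun i _ => modulus_pos (t i)).ne h1

theorem det_rightFactor_ne_zero (t : Torus F n) (u : UCoord F n × UCoord F n) :
    (rightFactor t u).det ≠ 0 := by
  simpa [Matrix.det_mul, det_unipMatrix] using det_wt_ne_zero t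

theorem det_leftFactor_ne_zero (t : Torus F n) (u : UCoord F n × UCoord F n) :
    (leftFactor t u).det ≠ 0 := by
  simpa [Matrix.det_mul, det_unipMatrix] using det_wt_ne_zero t

theorem continuous_rightFactor (t : Torus F n) : Continuous (rightFactor t) :=
  continuous_const.matrix_mul (continuous_unipMatrix.comp continuous_snd)

theorem continuous_leftFactor (t : Torus F n) : Continuous (leftFactor t) :=
  (continuous_unipMatrix.comp continuous_fst).matrix_mul continuous_const

variable {h : F → ℝ≥0∞} (hm : Measurable h)

include hm

theorem lintegral_pi_prod (k : ℕ) : ∫⁻ v : Fin k → F, ∏ i, h (v i) = (∫⁻ x, h x) ^ k := by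
  induction k with
  | zero => simp [volume_pi]
  | succ k ih =>
    rw [← ((volume_preserving_piFinSuccAbove (fun _ : Fin (k + 1) => F) 0).symm).lintegral_comp_emb
      (MeasurableEquiv.measurableEmbedding _), pow_succ', ← ih]
    refine (lintegral_congr fun p => ?_).trans (lintegral_prod_mul
      (g := fun v : Fin k → F => ∏ i, h (v i)) hm.aemeasurable (Finset.measurable_prod _ fun j _ =>
        hm.comp (measurable_pi_apply j)).aemeasurable)
    simp [Fin.prod_univ_succ, MeasurableEquiv.piFinSuccAbove]

/-- The majorant of the orbital integrand after splitting off the first row and the last column. -/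
theorem lintegral_split_ne_top (hfin : ∫⁻ x, h x ≠ ∞) (t : Torus F m)
    (ht : ∫⁻ u, ∏ i, ∏ j, h (bruhat t u i j) ≠ ∞) :
    ∫⁻ p : (UCoord F m × UCoord F m) × ((Fin m → F) × (Fin m → F)),
      (∏ i, ∏ j, h (bruhat t p.1 i j)) * ((∏ j, h (Matrix.vecMul p.2.1 (rightFactor t p.1) j)) *
        ∏ i, h ((leftFactor t p.1).mulVec p.2.2 i)) ≠ ∞ := by
  have m1 : Measurable fun u : UCoord F m × UCoord F m => ∏ i, ∏ j, h (bruhat t u i j) := by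
    refine Finset.measurable_prod _ fun i _ => Finset.measurable_prod _ fun j _ => hm.comp ?_
    exact ((continuous_bruhat t).matrix_elem i j).measurable
  have m2 : Measurable fun p : (UCoord F m × UCoord F m) × ((Fin m → F) × (Fin m → F)) =>
      (∏ j, h (Matrix.vecMul p.2.1 (rightFactor t p.1) j)) := by
    refine Finset.measurable_prod _ fun j _ => hm.comp ?_
    exact ((continuous_apply j).comp ((continuous_fst.comp continuous_snd).matrix_vecMul
      ((continuous_rightFactor t).comp continuous_fst))).measurable
  have m3 : Measurable fun p : (UCoord F m × UCoord F m) × ((Fin m → F) × (Fin m → F)) =>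
      ∏ i, h ((leftFactor t p.1).mulVec p.2.2 i) := by
    refine Finset.measurable_prod _ fun j _ => hm.comp ?_
    exact ((continuous_apply j).comp (((continuous_leftFactor t).comp continuous_fst).matrix_mulVec
      (continuous_snd.comp continuous_snd))).measurable
  -- For fixed u the row and the column are images of r and b under matrices whose determinants have
  -- absolute value ∏|t_i|, independent of u. The inner integral is therefore a constant.
  have e : ∀ u : UCoord F m × UCoord F m, ∫⁻ q : (Fin m → F) × (Fin m → F),
      (∏ i, ∏ j, h (bruhat t u i j)) * ((∏ j, h (Matrix.vecMul q.1 (rightFactor t u) j)) *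
        ∏ i, h ((leftFactor t u).mulVec q.2 i)) = (∏ i, ∏ j, h (bruhat t u i j)) *
      ((ENNReal.ofReal (∏ i, modulus (t i))⁻¹ * (∫⁻ x, h x) ^ m) *
        (ENNReal.ofReal (∏ i, modulus (t i))⁻¹ * (∫⁻ x, h x) ^ m)) := by
    intro u
    have m4 : Measurable fun v : Fin m → F => ∏ i, h (v i) :=
      Finset.measurable_prod _ fun j _ => hm.comp (measurable_pi_apply j)
    have h1 := lintegral_comp_vecMul (det_rightFactor_ne_zero t u) fun v => ∏ i, h (v i)
    have h2 := lintegral_comp_mulVec (det_leftFactor_ne_zero t u) fun v => ∏ i, h (v i)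
    rw [absF_det_rightFactor, lintegral_pi_prod hm] at h1
    rw [absF_det_leftFactor, lintegral_pi_prod hm] at h2
    have m5 := m2.comp (measurable_prodMk_left (x := u))
    have m6 := m3.comp (measurable_prodMk_left (x := u))
    refine (lintegral_const_mul _ (m5.mul m6)).trans ?_
    refine congrArg _ ((lintegral_prod_mul
      (f := fun v => ∏ j, h (Matrix.vecMul v (rightFactor t u) j))
      (g := fun v => ∏ i, h ((leftFactor t u).mulVec v i)) ?_ ?_).trans (congrArg₂ _ h1 h2))
    · exact (m4.comp (by
        simpa only [← Matrix.mulVec_transpose] using (continuous_mulVec _).measurable)).aemeasurable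
    · exact (m4.comp (continuous_mulVec _).measurable).aemeasurable
  refine ne_of_eq_of_ne ((lintegral_prod _
    ((m1.comp measurable_fst).mul (m2.mul m3)).aemeasurable).trans (lintegral_congr e)) ?_
  rw [lintegral_mul_const _ m1]
  exact ENNReal.mul_ne_top ht (by finiteness)

/-- By induction through `bruhat_tsnoc`. The corner entry has no integration variable of its own,
which is why its factor must be bounded by 1. -/
theorem lintegral_bruhat_ne_top (h1 : ∀ x, h x ≤ 1) (hfin : ∫⁻ x, h x ≠ ∞) (t : Torus F n) :
    ∫⁻ u, ∏ i, ∏ j, h (bruhat t u i j) ≠ ∞ := by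
  induction n with
  | zero =>
    simp only [Finset.univ_eq_empty, Finset.prod_empty, lintegral_one]
    rw [Measure.volume_eq_prod, ← Set.univ_prod_univ, Measure.prod_prod]
    have : IsEmpty {p : Fin 0 × Fin 0 // p.1 < p.2} := ⟨fun p => p.1.1.elim0⟩
    simp [volume_pi]
  | succ m ih =>
    obtain ⟨t, s, rfl⟩ : ∃ t' s, t = tsnoc t' s := ⟨Fin.init t, t (Fin.last m), by simp [tsnoc]⟩
    rw [← (measurePreserving_snocEquiv (F := F) (m := m)).lintegral_comp_emb
      (snocEquiv F m).measurableEmbedding]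
    refine ne_top_of_le_ne_top (lintegral_split_ne_top hm hfin t (ih t)) (lintegral_mono fun p => ?_)
    rw [snocEquiv_apply, bruhat_tsnoc]
    simp only [Matrix.of_apply]
    rw [Fin.prod_univ_succ]
    simp only [Fin.prod_univ_castSucc, blk_zero_castSucc, blk_zero_last, blk_succ_castSucc,
      blk_succ_last, Finset.prod_mul_distrib]
    calc _ ≤ ((∏ j, h (Matrix.vecMul p.2.1 (rightFactor t p.1) j)) * 1) *
          ((∏ i, ∏ j, h (bruhat t p.1 i j)) * ∏ i, h ((leftFactor t p.1).mulVec p.2.2 i)) := by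
          gcongr
          exact h1 _
      _ = _ := by ring

end convergence

section integrability

variable {ψ : AddChar F Circle}

theorem orbInt_integrable (hψ : Continuous ψ) {Φ : Matrix (Fin n) (Fin n) F → ℂ}
    (hΦ : IsSB F fun X : Fin n → Fin n → F => Φ (Matrix.of X)) (t : Torus F n) :
    Integrable fun u : UCoord F n × UCoord F n =>
      Φ (bruhat t u) * (ψ (-(superSum u.1 + superSum u.2)) : ℂ) := by
  refine integrable_mul_addChar (P := fun u : UCoord F n × UCoord F n =>
    -(superSum u.1 + superSum u.2)) ?_ hψ
    ((continuous_superSum.comp continuous_fst).add (continuous_superSum.comp continuous_snd)).neg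
  obtain ⟨h, hm, h1, hfin, C, hC, hb⟩ := hΦ.exists_majorant
    fun p : Fin n × Fin n => LinearMap.proj p.2 ∘ₗ LinearMap.proj p.1
  have hc : Continuous fun u => Φ (bruhat t u) := hΦ.continuous.comp (continuous_bruhat t)
  refine ⟨hc.aestronglyMeasurable, ?_⟩
  refine lt_of_le_of_lt (lintegral_mono fun u => hb (bruhat t u)) ?_
  simp only [Fintype.prod_prod_type]
  rw [lintegral_const_mul' _ _ hC]
  exact ENNReal.mul_lt_top hC.lt_top (lintegral_bruhat_ne_top hm h1 hfin t).lt_top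

/-- The integrand in all variables, including the torus variable `y`, is integrable. -/
theorem split_integrable {Φ : Matrix (Fin (m + 1)) (Fin (m + 1)) F → ℂ}
    (hΦ : IsSB F fun X : Fin (m + 1) → Fin (m + 1) → F => Φ (Matrix.of X)) (t : Torus F m) :
    Integrable fun p : ((UCoord F m × UCoord F m) × ((Fin m → F) × (Fin m → F))) × F =>
      Φ (Matrix.of (blk (fun i j => bruhat t p.1.1 i j)
        (Matrix.vecMul p.1.2.1 (rightFactor t p.1.1)) ((leftFactor t p.1.1).mulVec p.1.2.2)
        (p.1.2.1 ⬝ᵥ (wt t).mulVec p.1.2.2 + p.2))) := by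
  obtain ⟨h, hm, h1, hfin, C, hC, hb⟩ := hΦ.exists_majorant
    fun p : Fin (m + 1) × Fin (m + 1) => LinearMap.proj p.2 ∘ₗ LinearMap.proj p.1
  have c1 : Continuous fun p : ((UCoord F m × UCoord F m) × ((Fin m → F) × (Fin m → F))) × F =>
      Matrix.vecMul p.1.2.1 (rightFactor t p.1.1) :=
    (continuous_fst.comp (continuous_snd.comp continuous_fst)).matrix_vecMul
      ((continuous_rightFactor t).comp (continuous_fst.comp continuous_fst))
  have c2 : Continuous fun p : ((UCoord F m × UCoord F m) × ((Fin m → F) × (Fin m → F))) × F =>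
      (leftFactor t p.1.1).mulVec p.1.2.2 :=
    ((continuous_leftFactor t).comp (continuous_fst.comp continuous_fst)).matrix_mulVec
      (continuous_snd.comp (continuous_snd.comp continuous_fst))
  have c3 : Continuous fun p : ((UCoord F m × UCoord F m) × ((Fin m → F) × (Fin m → F))) =>
      p.2.1 ⬝ᵥ (wt t).mulVec p.2.2 :=
    (continuous_fst.comp continuous_snd).dotProduct
      ((continuous_mulVec _).comp (continuous_snd.comp continuous_snd))
  have c4 : Continuous fun p : ((UCoord F m × UCoord F m) × ((Fin m → F) × (Fin m → F))) × F =>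
      bruhat t p.1.1 := (continuous_bruhat t).comp (continuous_fst.comp continuous_fst)
  have hc : Continuous fun p : ((UCoord F m × UCoord F m) × ((Fin m → F) × (Fin m → F))) × F =>
      blk (fun i j => bruhat t p.1.1 i j)
        (Matrix.vecMul p.1.2.1 (rightFactor t p.1.1)) ((leftFactor t p.1.1).mulVec p.1.2.2)
        (p.1.2.1 ⬝ᵥ (wt t).mulVec p.1.2.2 + p.2) := by
    refine continuous_pi fun i => continuous_pi fun j => ?_
    induction i using Fin.cases with
    | zero =>
      induction j using Fin.lastCases with
      | last => simp only [blk_zero_last]; exact (c3.comp continuous_fst).add continuous_snd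
      | cast j => simp only [blk_zero_castSucc]; exact (continuous_apply j).comp c1
    | succ i =>
      induction j using Fin.lastCases with
      | last => simp only [blk_succ_last]; exact (continuous_apply i).comp c2
      | cast j => simpa only [blk_succ_castSucc] using c4.matrix_elem i j
  refine ⟨(hΦ.continuous.comp hc).aestronglyMeasurable, ?_⟩
  let H : (UCoord F m × UCoord F m) × ((Fin m → F) × (Fin m → F)) → ℝ≥0∞ := fun p =>
    (∏ i, ∏ j, h (bruhat t p.1 i j)) * ((∏ j, h (Matrix.vecMul p.2.1 (rightFactor t p.1) j)) *
        ∏ i, h ((leftFactor t p.1).mulVec p.2.2 i))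
  have hH := lintegral_split_ne_top hm hfin t (lintegral_bruhat_ne_top hm h1 hfin t)
  have hHm : Measurable fun p : ((UCoord F m × UCoord F m) × ((Fin m → F) × (Fin m → F))) × F =>
      H p.1 * h (p.1.2.1 ⬝ᵥ (wt t).mulVec p.1.2.2 + p.2) := by
    refine Measurable.mul (.mul ?_ (.mul ?_ ?_)) (hm.comp
      ((c3.comp continuous_fst).add continuous_snd).measurable)
    · exact Finset.measurable_prod _ fun i _ => Finset.measurable_prod _ fun j _ =>
        hm.comp (c4.matrix_elem i j).measurable
    · exact Finset.measurable_prod _ fun j _ => hm.comp ((continuous_apply j).comp c1).measurable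
    · exact Finset.measurable_prod _ fun j _ => hm.comp ((continuous_apply j).comp c2).measurable
  refine lt_of_le_of_lt (b := ∫⁻ p : ((UCoord F m × UCoord F m) × ((Fin m → F) × (Fin m → F))) × F,
    C * (H p.1 * h (p.1.2.1 ⬝ᵥ (wt t).mulVec p.1.2.2 + p.2))) (lintegral_mono fun p => ?_) ?_
  · refine (hb _).trans (mul_le_mul_right ?_ C)
    simp only [Fintype.prod_prod_type, LinearMap.comp_apply, LinearMap.proj_apply]
    rw [Fin.prod_univ_succ]
    simp only [Fin.prod_univ_castSucc, blk_zero_castSucc, blk_zero_last, blk_succ_castSucc,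
      blk_succ_last, Finset.prod_mul_distrib, H]
    exact le_of_eq (by ring)
  · rw [lintegral_const_mul' _ _ hC]
    refine ENNReal.mul_lt_top hC.lt_top ?_
    refine lt_of_eq_of_lt (lintegral_prod _ hHm.aemeasurable) ?_
    -- Here the corner has its own variable y, shifted by a quantity independent of y, so
    -- translation invariance integrates it out.
    have e : ∀ p : (UCoord F m × UCoord F m) × ((Fin m → F) × (Fin m → F)),
        ∫⁻ y, H p * h (p.2.1 ⬝ᵥ (wt t).mulVec p.2.2 + y) = H p * ∫⁻ y, h y := fun p => by
      refine (lintegral_const_mul _ (hm.comp (measurable_const_add _))).trans ?_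
      rw [← lintegral_add_left_eq_self h (p.2.1 ⬝ᵥ (wt t).mulVec p.2.2)]
      rfl
    refine lt_of_eq_of_lt (lintegral_congr e) ?_
    rw [lintegral_mul_const' _ _ hfin]
    exact ENNReal.mul_lt_top hH.lt_top hfin.lt_top

end integrability

end

end Kuznetsov

/-! ### Inversion on the group and the dual push-forward -/

namespace Kuznetsov

noncomputable section

set_option linter.unusedSectionVars false

section algebra

variable {F : Type*} [Field F] {n : ℕ}

/-- Coordinates of the inverse of an upper triangular unipotent matrix. -/
def invU : (n : ℕ) → UCoord F n → UCoord F n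
  | 0, u => u
  | m + 1, u =>
    let v := invU m fun p => u (colEquiv m (.inl p))
    colU v (-(unipMatrix v).mulVec fun i => u (colEquiv m (.inr i)))

theorem exists_eq_colU {m : ℕ} (u : UCoord F (m + 1)) : ∃ v b, u = colU v b := by
  refine ⟨fun p => u (colEquiv m (.inl p)), fun i => u (colEquiv m (.inr i)), ?_⟩
  funext q
  obtain ⟨q, rfl⟩ := (colEquiv m).surjective q
  rw [colU, Equiv.symm_apply_apply]
  cases q <;> rfl

theorem invU_colU {m : ℕ} (v : UCoord F m) (b : Fin m → F) :
    invU (m + 1) (colU v b) = colU (invU m v) (-(unipMatrix (invU m v)).mulVec b) := by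
  have h1 : (fun p => colU v b (colEquiv m (.inl p))) = v := funext fun p => by simp [colU]
  have h2 : (fun p => colU v b (colEquiv m (.inr p))) = b := funext fun p => by simp [colU]
  rw [invU, h1, h2]

theorem unipMatrix_invU_mul (u : UCoord F n) : unipMatrix (invU n u) * unipMatrix u = 1 := by
  induction n with
  | zero => exact Subsingleton.elim _ _
  | succ m ih =>
    obtain ⟨v, b, rfl⟩ := exists_eq_colU u
    rw [invU_colU]
    ext i j
    rw [Matrix.mul_apply, Fin.sum_univ_castSucc]
    induction i using Fin.lastCases with
    | last =>
      induction j using Fin.lastCases with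
      | last => simp
      | cast j => simp [(Fin.castSucc_lt_last j).ne']
    | cast i =>
      induction j using Fin.lastCases with
      | last => simp [(Fin.castSucc_lt_last i).ne, Matrix.mulVec, dotProduct]
      | cast j =>
        have := congrFun (congrFun (ih v) i) j
        rw [Matrix.mul_apply] at this
        simp [this, Matrix.one_apply]

theorem superSum_invU (u : UCoord F n) : superSum (invU n u) = -superSum u := by
  induction n with
  | zero =>
    have : IsEmpty {p : Fin 0 × Fin 0 // p.1 < p.2} := ⟨fun p => p.1.1.elim0⟩
    simp [superSum]
  | succ m ih =>
    obtain ⟨v, b, rfl⟩ := exists_eq_colU u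
    rw [invU_colU, superSum_colU, superSum_colU, ih, neg_dotProduct, dotProduct_comm,
      Matrix.dotProduct_mulVec, lastVec_vecMul_unipMatrix, dotProduct_comm b]
    ring

/-- The torus element `(t_n⁻¹, …, t_1⁻¹)`. -/
def revInv (t : Torus F n) : Torus F n := fun i => (t i.rev)⁻¹

theorem wt_revInv_mul_wt (t : Torus F n) : wt (revInv t) * wt t = 1 := by
  ext i j
  rw [Matrix.mul_apply, Finset.sum_eq_single i.rev]
  · by_cases h : i = j
    · subst h
      simp [wt, revInv]
    · simp [wt, h, Ne.symm h]
  · intro k _ hk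
    simp [wt, hk]
  · simp

/-- The inverse is n₂⁻¹ (w t)⁻¹ n₁⁻¹, and moving w back to the left of the torus part reverses the
order of its inverted entries. -/
theorem inv_bruhat (t : Torus F n) (u : UCoord F n × UCoord F n) :
    (bruhat t u)⁻¹ = bruhat (revInv t) (invU n u.2, invU n u.1) := by
  refine Matrix.inv_eq_left_inv ?_
  rw [bruhat, bruhat]
  calc _ = unipMatrix (invU n u.2) * (wt (revInv t) * ((unipMatrix (invU n u.1) * unipMatrix u.1) *
        wt t)) * unipMatrix u.2 := by simp only [Matrix.mul_assoc]
    _ = 1 := by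
      rw [unipMatrix_invU_mul, Matrix.one_mul, wt_revInv_mul_wt, Matrix.mul_one,
        unipMatrix_invU_mul]

end algebra

variable {F : Type*} [NontriviallyNormedField F] [ProperSpace F]
  [MeasureSpace F] [BorelSpace F] [(volume : Measure F).IsAddHaarMeasure] {n m : ℕ}

/-- In the block recursion, inversion is a skew product: on the last column it acts by minus a
unipotent matrix depending on the other coordinates, whose determinant has absolute value 1. -/
theorem measurePreserving_invU : MeasurePreserving (invU n : UCoord F n → UCoord F n) := by
  induction n with
  | zero => exact .id _
  | succ m ih =>
    have hc : Measurable fun p : UCoord F m × (Fin m → F) =>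
        -(unipMatrix (invU m p.1)).mulVec p.2 := by
      refine measurable_pi_lambda _ fun i => Measurable.neg ?_
      change Measurable fun p : UCoord F m × (Fin m → F) =>
        ∑ j, unipMatrix (invU m p.1) i j * p.2 j
      refine Finset.measurable_sum _ fun j _ => Measurable.mul ?_ (by fun_prop)
      exact ((continuous_unipMatrix (F := F) (n := m)).matrix_elem i j).measurable.comp
        (ih.measurable.comp measurable_fst)
    have h1 : MeasurePreserving fun p : UCoord F m × (Fin m → F) =>
        (invU m p.1, -(unipMatrix (invU m p.1)).mulVec p.2) := by
      refine ih.skew_product (g := fun v b => -(unipMatrix (invU m v)).mulVec b)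
        hc (.of_forall fun v => ?_)
      have h2 : (fun b : Fin m → F => -(unipMatrix (invU m v)).mulVec b) =
          (-(unipMatrix (invU m v))).mulVec := funext fun b => (Matrix.neg_mulVec _ _).symm
      have h3 : absF (-(unipMatrix (invU m v))).det = 1 := by
        rw [Matrix.det_neg, det_unipMatrix, mul_one, absF_pow, absF_neg, absF_one, one_pow]
      rw [h2, volume_map_mulVec, h3]
      · simp
      · intro h4
        simp [h4, absF_zero] at h3
    have h5 := (measurePreserving_colUEquiv (F := F) (m := m)).comp
      (h1.comp (measurePreserving_colUEquiv (F := F) (m := m)).symm)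
    convert h5 using 1
    funext u
    obtain ⟨p, rfl⟩ := (colUEquiv F m).surjective u
    rw [Function.comp_apply, Function.comp_apply, MeasurableEquiv.symm_apply_apply,
      colUEquiv_apply, colUEquiv_apply, invU_colU]

theorem measurePreserving_inv_swap : MeasurePreserving fun u : UCoord F n × UCoord F n =>
    (invU n u.2, invU n u.1) :=
  ((measurePreserving_invU (F := F) (n := n)).prod
    (measurePreserving_invU (F := F) (n := n))).comp Measure.measurePreserving_swap

variable {ψ : AddChar F Circle}

theorem orbitalIntegrand_restrictMatDual_eq (Φ : Matrix (Fin n) (Fin n) F → ℂ)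
    (t : Torus F n) (u : UCoord F n × UCoord F n) :
    orbitalIntegrand ψ (restrictMatDual Φ) t u =
      (((∏ i, modulus (t i)) ^ (-((n : ℝ) / 2)) : ℝ) : ℂ) *
      (fun v : UCoord F n × UCoord F n =>
        Φ (bruhat (revInv t) v) * (ψ⁻¹ (-(superSum v.1 + superSum v.2)) : ℂ))
          (invU n u.2, invU n u.1) := by
  rw [orbitalIntegrand_restrictMatDual, inv_bruhat]
  simp only [superSum_invU, AddChar.inv_apply]
  congr 5
  ring

theorem orbitalIntegrand_integrable (hψ : Continuous ψ) {Φ : Matrix (Fin n) (Fin n) F → ℂ}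
    (hΦ : IsSB F fun X : Fin n → Fin n → F => Φ (Matrix.of X)) (t : Torus F n) :
    Integrable (orbitalIntegrand ψ (restrictMat Φ) t) ∧
      Integrable (orbitalIntegrand ψ (restrictMatDual Φ) t) := by
  constructor
  · rw [funext (orbitalIntegrand_restrictMat ψ Φ t)]
    exact (orbInt_integrable hψ hΦ t).const_mul _
  · rw [funext (orbitalIntegrand_restrictMatDual_eq Φ t)]
    have h := orbInt_integrable (continuous_inv_addChar hψ) hΦ (revInv t)
    exact ((measurePreserving_inv_swap.integrable_comp h.aestronglyMeasurable).2 h).const_mul _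

theorem matFactor_revInv (t : Torus F n) :
    matFactor (revInv t) = deltaHalf t * (∏ i, modulus (t i)) ^ (-((n : ℝ) / 2)) := by
  have e : ∀ x : Fˣ, modulus x⁻¹ = (modulus x)⁻¹ := fun x => by
    rw [← absF_coe, Units.val_inv_eq_inv_val, absF_inv, absF_coe]
  rw [matFactor, deltaHalf, deltaHalf]
  congr 1
  · rw [← Equiv.prod_comp Fin.revPerm]
    refine Finset.prod_congr rfl fun i _ => ?_
    rw [Fin.revPerm_apply, revInv, Fin.rev_rev, e, Real.inv_rpow (modulus_pos _).le,
      ← Real.rpow_neg (modulus_pos _).le, Fin.val_rev]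
    congr 1
    rw [Nat.cast_sub i.isLt]
    push_cast
    ring
  · simp only [revInv, e]
    rw [← Equiv.prod_comp Fin.revPerm, Finset.prod_inv_distrib,
      Real.inv_rpow (Finset.prod_nonneg fun i _ => (modulus_pos _).le),
      ← Real.rpow_neg (Finset.prod_nonneg fun i _ => (modulus_pos _).le)]
    simp

/-- Inverting and exchanging n₁ and n₂ preserves the measure and negates both superdiagonal sums,
which accounts for ψ⁻¹. The power of |det| and δ^{1/2} match by `matFactor_revInv`. -/
theorem pushMatDual_eq (hψ : Continuous ψ) {Φ : Matrix (Fin n) (Fin n) F → ℂ}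
    (hΦ : IsSB F fun X : Fin n → Fin n → F => Φ (Matrix.of X)) (t : Torus F n) :
    pushMatDual ψ volume Φ t = pushMat ψ⁻¹ volume Φ (revInv t) := by
  have h1 := (orbInt_integrable (continuous_inv_addChar hψ) hΦ (revInv t)).aestronglyMeasurable
  have h2 := measurePreserving_inv_swap (F := F) (n := n)
  rw [pushMat_eq, pushMatDual, push, orbital, matFactor_revInv, Complex.ofReal_mul, mul_assoc]
  congr 1
  simp only [orbitalIntegrand_restrictMatDual_eq]
  refine (integral_const_mul (L := ℂ) _ _).trans ?_
  congr 1
  have h3 := integral_map (μ := volume) h2.measurable.aemeasurable (by rwa [h2.map_eq])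
  rw [h2.map_eq] at h3
  exact h3.symm

theorem revInv_revInv (t : Torus F n) : revInv (revInv t) = t := by
  funext i
  simp [revInv]

theorem revInv_tsnoc (t : Torus F m) (s : Fˣ) : revInv (tsnoc t s) = tcons s⁻¹ (revInv t) := by
  funext i
  induction i using Fin.cases with
  | zero => simp [revInv]
  | succ i => simp [revInv, Fin.rev_succ]

end

end Kuznetsov

/-! ### The trace pairing in blocks, and descent to smaller matrices -/

namespace Kuznetsov

noncomputable section

open scoped ENNReal

set_option linter.unusedSectionVars false
set_option synthInstance.maxSize 1000
set_option synthInstance.maxHeartbeats 100000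

variable {F : Type*} [NontriviallyNormedField F] {n m : ℕ}

theorem blk_ext {Z Z' : Fin (m + 1) → Fin (m + 1) → F} (h1 : ∀ j : Fin m, Z 0 j.castSucc = Z' 0 j.castSucc)
    (h2 : Z 0 (Fin.last m) = Z' 0 (Fin.last m))
    (h3 : ∀ i : Fin m, Z i.succ (Fin.last m) = Z' i.succ (Fin.last m))
    (h4 : ∀ i j : Fin m, Z i.succ j.castSucc = Z' i.succ j.castSucc) : Z = Z' := by
  funext i j
  induction i using Fin.cases with
  | zero =>
    induction j using Fin.lastCases with
    | last => exact h2
    | cast j => exact h1 j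
  | succ i =>
    induction j using Fin.lastCases with
    | last => exact h3 i
    | cast j => exact h4 i j

/-- Block matrices as a linear equivalence. -/
def blkEquiv (F : Type*) [NontriviallyNormedField F] (m : ℕ) :
    (((Fin m → F) × F) × ((Fin m → F) × (Fin m → Fin m → F))) ≃ₗ[F]
      (Fin (m + 1) → Fin (m + 1) → F) where
  toFun p := blk p.2.2 p.1.1 p.2.1 p.1.2
  invFun Z := ((fun j => Z 0 j.castSucc, Z 0 (Fin.last m)),
    (fun i => Z i.succ (Fin.last m), fun i j => Z i.succ j.castSucc))
  left_inv p := by simp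
  right_inv Z := by refine blk_ext ?_ ?_ ?_ ?_ <;> simp
  map_add' p q := by refine blk_ext ?_ ?_ ?_ ?_ <;> simp
  map_smul' c p := by refine blk_ext ?_ ?_ ?_ ?_ <;> simp

theorem blkEquiv_apply (p : ((Fin m → F) × F) × ((Fin m → F) × (Fin m → Fin m → F))) :
    blkEquiv F m p = blk p.2.2 p.1.1 p.2.1 p.1.2 := rfl

/-- The trace pairing on matrices. -/
def tracePairing (F : Type*) [NontriviallyNormedField F] (n : ℕ) :
    (Fin n → Fin n → F) →ₗ[F] (Fin n → Fin n → F) →ₗ[F] F :=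
  LinearMap.mk₂ F (fun X Y => Matrix.trace (Matrix.of X * Matrix.of Y))
    (fun X X' Y => by rw [← Matrix.of_add_of, Matrix.add_mul, Matrix.trace_add])
    (fun c X Y => by rw [← Matrix.smul_of, Matrix.smul_mul, Matrix.trace_smul])
    (fun X Y Y' => by rw [← Matrix.of_add_of, Matrix.mul_add, Matrix.trace_add])
    (fun c X Y => by rw [← Matrix.smul_of, Matrix.mul_smul, Matrix.trace_smul])

theorem tracePairing_apply (X Y : Fin n → Fin n → F) :
    tracePairing F n X Y = Matrix.trace (Matrix.of X * Matrix.of Y) := rfl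

variable [ProperSpace F] [MeasureSpace F] [BorelSpace F] [(volume : Measure F).IsAddHaarMeasure]

/-- The standard pairing on `Fᵐ`. -/
abbrev dotPairing (F : Type*) [NontriviallyNormedField F] (m : ℕ) :
    (Fin m → F) →ₗ[F] (Fin m → F) →ₗ[F] F := piPairing (LinearMap.mul F F) m

theorem dotPairing_nondegenerate (v : Fin m → F) (h : ∀ w, dotPairing F m v w = 0) : v = 0 :=
  piPairing_nondegenerate mul_nondegenerate m v h

theorem tracePairing_swap (X Y : Fin n → Fin n → F) :
    tracePairing F n X (fun i j => Y j i) = piPairing (dotPairing F n) n X Y := by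
  rw [tracePairing_apply, piPairing_apply]
  rfl

theorem tracePairing_nondegenerate (X : Fin n → Fin n → F)
    (h : ∀ Y, tracePairing F n X Y = 0) : X = 0 :=
  piPairing_nondegenerate dotPairing_nondegenerate n X fun Y => by rw [← tracePairing_swap, h]

/-- The pairing on the first row. -/
abbrev rowPairing (F : Type*) [NontriviallyNormedField F] (m : ℕ) :
    (Fin m → F) × F →ₗ[F] (Fin m → F) × F →ₗ[F] F :=
  prodPairing (dotPairing F m) (LinearMap.mul F F)

theorem rowPairing_nondegenerate (v : (Fin m → F) × F) (h : ∀ w, rowPairing F m v w = 0) :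
    v = 0 :=
  prodPairing_nondegenerate dotPairing_nondegenerate mul_nondegenerate v h

theorem tracePairing_blk (p : ((Fin m → F) × F) × ((Fin m → F) × (Fin m → Fin m → F)))
    (Y : Fin m → Fin m → F) (β γ : Fin m → F) (δ : F) :
    tracePairing F (m + 1) (blkEquiv F m p) (blkDual Y β γ δ) =
      prodPairing (rowPairing F m) (prodPairing (dotPairing F m) (tracePairing F m)) p
        ((β, δ), (γ, Y)) := by
  rw [tracePairing_apply, blkEquiv_apply, trace_blk_mul_blkDual]
  exact add_assoc _ _ _

/-- Both measures are Haar measures, so it suffices to compare them on the product of unit balls,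
whose measure is the same power on either side. -/
theorem measurePreserving_blkEquiv : MeasurePreserving (blkEquiv F m) := by
  let K : Set F := Metric.closedBall 0 1
  have hK : MeasurableSet K := Metric.isClosed_closedBall.measurableSet
  have hc : volume (Set.univ.pi fun _ : Fin (m + 1) => Set.univ.pi fun _ : Fin (m + 1) => K) =
      (volume K ^ (m + 1)) ^ (m + 1) := by
    rw [volume_pi_pi]
    simp only [volume_pi_pi]
    simp
  have hK0 : volume K ≠ 0 := (Metric.measure_closedBall_pos _ _ one_pos).ne'
  have hKf : volume K ≠ ∞ := (isCompact_closedBall _ _).measure_lt_top.ne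
  refine measurePreserving_of_preimage_eq (blkEquiv F m)
    (((Set.univ.pi fun _ => K) ×ˢ K) ×ˢ ((Set.univ.pi fun _ => K) ×ˢ
      (Set.univ.pi fun _ => Set.univ.pi fun _ => K)))
    (Set.univ.pi fun _ => Set.univ.pi fun _ => K) ?_ ?_ ?_ ?_ ?_
  · ext p
    simp only [Set.mem_preimage, Set.mem_pi, Set.mem_univ, forall_const, Set.mem_prod,
      blkEquiv_apply]
    rw [Fin.forall_fin_succ]
    simp only [Fin.forall_fin_succ', blk_zero_castSucc, blk_zero_last, blk_succ_castSucc,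
      blk_succ_last, forall_and]
    tauto
  · exact .univ_pi fun _ => .univ_pi fun _ => hK
  · rw [hc]
    simp only [Measure.volume_eq_prod, Measure.prod_prod, volume_pi_pi]
    simp
    ring
  · rw [hc]
    exact pow_ne_zero _ (pow_ne_zero _ hK0)
  · rw [hc]
    exact ENNReal.pow_ne_top (ENNReal.pow_ne_top hKf)

variable {ψ : AddChar F Circle}

theorem hasInversion_dotPairing (hψ : Continuous ψ) (hψ1 : ∃ x, ψ x ≠ 1)
    (hs : IsSelfDual ψ (volume : Measure F)) (m : ℕ) :
    HasInversion ψ (dotPairing F m) :=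
  (hasInversion_mul hψ hψ1 hs).pi hψ hψ1 mul_nondegenerate m

/-- Transposition. -/
def transposeEquiv (F : Type*) [NontriviallyNormedField F] (n : ℕ) :
    (Fin n → Fin n → F) ≃ₗ[F] (Fin n → Fin n → F) where
  toFun X := fun i j => X j i
  invFun X := fun i j => X j i
  left_inv _ := rfl
  right_inv _ := rfl
  map_add' _ _ := rfl
  map_smul' _ _ := rfl

theorem measurePreserving_transposeEquiv : MeasurePreserving (transposeEquiv F n) := by
  let K : Set F := Metric.closedBall 0 1
  have hK : MeasurableSet K := Metric.isClosed_closedBall.measurableSet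
  refine measurePreserving_of_preimage_eq (transposeEquiv F n)
    (Set.univ.pi fun _ => Set.univ.pi fun _ => K)
    (Set.univ.pi fun _ => Set.univ.pi fun _ => K) ?_ ?_ rfl ?_ ?_
  · ext X
    simp only [Set.mem_preimage, Set.mem_pi, Set.mem_univ, forall_const]
    exact forall_comm
  · exact .univ_pi fun _ => .univ_pi fun _ => hK
  · simp only [volume_pi_pi, Finset.prod_const]
    exact pow_ne_zero _ (pow_ne_zero _ (Metric.measure_closedBall_pos _ _ one_pos).ne')
  · simp only [volume_pi_pi, Finset.prod_const]
    exact ENNReal.pow_ne_top (ENNReal.pow_ne_top (isCompact_closedBall _ _).measure_lt_top.ne)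

theorem hasInversion_tracePairing (hψ : Continuous ψ) (hψ1 : ∃ x, ψ x ≠ 1)
    (hs : IsSelfDual ψ (volume : Measure F)) (n : ℕ) :
    HasInversion ψ (tracePairing F n) :=
  ((hasInversion_dotPairing hψ hψ1 hs n).pi hψ hψ1 dotPairing_nondegenerate n).transfer
    (LinearEquiv.refl F _) (transposeEquiv F n) (.id _) measurePreserving_transposeEquiv
    tracePairing_swap

theorem fourierMat_apply (Φ : Matrix (Fin n) (Fin n) F → ℂ) (Y : Fin n → Fin n → F) :
    fourierMat ψ volume Φ (Matrix.of Y) =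
      ∫ X : Fin n → Fin n → F, Φ (Matrix.of X) * (ψ (tracePairing F n X Y) : ℂ) := rfl

theorem isSB_fourierMat (hψ : Continuous ψ) (hψ1 : ∃ x, ψ x ≠ 1)
    {Φ : Matrix (Fin n) (Fin n) F → ℂ}
    (hΦ : IsSB F fun X : Fin n → Fin n → F => Φ (Matrix.of X)) :
    IsSB F fun Y : Fin n → Fin n → F => fourierMat ψ volume Φ (Matrix.of Y) :=
  hΦ.fourier hψ hψ1 (tracePairing F n) tracePairing_nondegenerate

section descent

variable (ψ)

/-- The partial Fourier transform in the first row. -/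
def rowFT (Φ : Matrix (Fin (m + 1)) (Fin (m + 1)) F → ℂ)
    (p : ((Fin m → F) × F) × ((Fin m → F) × (Fin m → Fin m → F))) : ℂ :=
  ∫ x : (Fin m → F) × F, Φ (Matrix.of (blk p.2.2 x.1 p.2.1 x.2)) * (ψ (rowPairing F m x p.1) : ℂ)

/-- The partial Fourier transform in the first row and the last column. -/
def hookFT (Φ : Matrix (Fin (m + 1)) (Fin (m + 1)) F → ℂ)
    (p : (Fin m → F) × (((Fin m → F) × F) × (Fin m → Fin m → F))) : ℂ :=
  ∫ b : Fin m → F, rowFT ψ Φ (p.2.1, (b, p.2.2)) * (ψ (dotPairing F m b p.1) : ℂ)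

/-- The twisted partial Fourier transform whose integral over `(β, γ)` is the function on matrices
of smaller size. -/
def twistedFT (s : F) (Φ : Matrix (Fin (m + 1)) (Fin (m + 1)) F → ℂ)
    (p : ((Fin m → F) × (Fin m → F)) × (Fin m → Fin m → F)) : ℂ :=
  hookFT ψ Φ (p.1.2, ((p.1.1, s⁻¹), p.2)) *
    (ψ (s * (p.1.2 ⬝ᵥ (Matrix.of p.2).mulVec p.1.1 + p.1.2 ⬝ᵥ firstVec F m +
      p.1.1 ⬝ᵥ lastVec F m)) : ℂ)

/-- The function on matrices of smaller size obtained from `Φ` by the last transform. -/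
def descend (s : F) (Φ : Matrix (Fin (m + 1)) (Fin (m + 1)) F → ℂ) :
    Matrix (Fin m) (Fin m) F → ℂ := fun X =>
  ((absF s ^ m * (absF s ^ (1 / 2 : ℝ))⁻¹ : ℝ) : ℂ) *
    ∫ q : (Fin m → F) × (Fin m → F), twistedFT ψ s Φ (q, fun i j => X i j)

variable {ψ}

theorem isSB_rowFT (hψ : Continuous ψ) (hψ1 : ∃ x, ψ x ≠ 1)
    {Φ : Matrix (Fin (m + 1)) (Fin (m + 1)) F → ℂ}
    (hΦ : IsSB F fun X : Fin (m + 1) → Fin (m + 1) → F => Φ (Matrix.of X)) :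
    IsSB F (rowFT ψ Φ) :=
  (hΦ.comp_linear (blkEquiv F m).toLinearMap (blkEquiv F m).injective).partialFT hψ hψ1
    (rowPairing F m) rowPairing_nondegenerate volume

theorem isSB_hookFT (hψ : Continuous ψ) (hψ1 : ∃ x, ψ x ≠ 1)
    {Φ : Matrix (Fin (m + 1)) (Fin (m + 1)) F → ℂ}
    (hΦ : IsSB F fun X : Fin (m + 1) → Fin (m + 1) → F => Φ (Matrix.of X)) :
    IsSB F (hookFT ψ Φ) := by
  have h1 : IsSB F fun p : (Fin m → F) × (((Fin m → F) × F) × (Fin m → Fin m → F)) =>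
      rowFT ψ Φ (p.2.1, (p.1, p.2.2)) := by
    refine (isSB_rowFT hψ hψ1 hΦ).comp_linear
      (((LinearMap.fst F _ _).comp (LinearMap.snd F _ _)).prod
        ((LinearMap.fst F _ _).prod ((LinearMap.snd F _ _).comp (LinearMap.snd F _ _)))) ?_
    rintro ⟨a, b, c⟩ ⟨a', b', c'⟩ h
    simpa [Prod.ext_iff, and_assoc, and_comm, and_left_comm] using h
  exact h1.partialFT hψ hψ1 (dotPairing F m) dotPairing_nondegenerate volume

theorem isPoly_dotProduct {V : Type*} [NormedAddCommGroup V] [NormedSpace F V]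
    [FiniteDimensional F V] {f g : V → Fin m → F} (hf : ∀ i, IsPoly F fun v => f v i) (hg : ∀ i, IsPoly F fun v => g v i) :
    IsPoly F fun v => f v ⬝ᵥ g v :=
  IsPoly.sum _ fun i => (hf i).mul (hg i)

theorem isPoly_dotProduct_const {V : Type*} [NormedAddCommGroup V] [NormedSpace F V]
    [FiniteDimensional F V] {f : V → Fin m → F} (hf : ∀ i, IsPoly F fun v => f v i) (g : Fin m → F) :
    IsPoly F fun v => f v ⬝ᵥ g := by
  refine IsPoly.sum _ fun i => ?_
  simpa only [mul_comm] using (hf i).const_mul (g i)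

/-- Fixing the corner frequency at s⁻¹ is an affine pull-back. The phase contains the cubic term
γXβ, which is why multiplication by ψ is established for polynomials and not just for linear forms.
-/
theorem isSB_twistedFT (hψ : Continuous ψ) (hψ1 : ∃ x, ψ x ≠ 1)
    (s : F) {Φ : Matrix (Fin (m + 1)) (Fin (m + 1)) F → ℂ}
    (hΦ : IsSB F fun X : Fin (m + 1) → Fin (m + 1) → F => Φ (Matrix.of X)) :
    IsSB F (twistedFT ψ s Φ) := by
  let L : ((Fin m → F) × (Fin m → F)) × (Fin m → Fin m → F) →ₗ[F]
      (Fin m → F) × (((Fin m → F) × F) × (Fin m → Fin m → F)) :=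
    ((LinearMap.snd F _ _).comp (LinearMap.fst F _ _)).prod
      ((((LinearMap.fst F _ _).comp (LinearMap.fst F _ _)).prod 0).prod (LinearMap.snd F _ _))
  have hL : Function.Injective L := by
    rintro ⟨⟨a, b⟩, c⟩ ⟨⟨a', b'⟩, c'⟩ h
    simpa [L, Prod.ext_iff, and_assoc, and_comm, and_left_comm] using h
  have h1 := (isSB_hookFT hψ hψ1 hΦ).comp_affine L hL (0, ((0, s⁻¹), 0))
  have pβ : ∀ i, IsPoly F fun p : ((Fin m → F) × (Fin m → F)) × (Fin m → Fin m → F) =>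
      p.1.1 i := fun i => (IsPoly.lin (LinearMap.proj i ∘ₗ
    LinearMap.fst F (Fin m → F) (Fin m → F) ∘ₗ LinearMap.fst F ((Fin m → F) × (Fin m → F)) (Fin m → Fin m → F)) :)
  have pγ : ∀ i, IsPoly F fun p : ((Fin m → F) × (Fin m → F)) × (Fin m → Fin m → F) =>
      p.1.2 i := fun i => (IsPoly.lin (LinearMap.proj i ∘ₗ
    LinearMap.snd F (Fin m → F) (Fin m → F) ∘ₗ LinearMap.fst F ((Fin m → F) × (Fin m → F)) (Fin m → Fin m → F)) :)
  have pX : ∀ i j, IsPoly F fun p : ((Fin m → F) × (Fin m → F)) × (Fin m → Fin m → F) =>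
      p.2 i j := fun i j => (IsPoly.lin (LinearMap.proj j ∘ₗ
    (LinearMap.proj i : (Fin m → Fin m → F) →ₗ[F] (Fin m → F)) ∘ₗ LinearMap.snd F ((Fin m → F) × (Fin m → F)) (Fin m → Fin m → F)) :)
  have hP : IsPoly F fun p : ((Fin m → F) × (Fin m → F)) × (Fin m → Fin m → F) =>
      s * (p.1.2 ⬝ᵥ (Matrix.of p.2).mulVec p.1.1 + p.1.2 ⬝ᵥ firstVec F m +
        p.1.1 ⬝ᵥ lastVec F m) :=
    .const_mul (((isPoly_dotProduct pγ fun i => isPoly_dotProduct (pX i) pβ).add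
      (isPoly_dotProduct_const pγ _)).add (isPoly_dotProduct_const pβ _)) s
  have h2 := h1.mul_addChar hψ hP
  refine Eq.mp (congrArg (IsSB F) (funext fun p => ?_)) h2
  simp [L, twistedFT]

/-- Integrating a variable out is evaluating its partial Fourier transform at frequency 0. -/
theorem IsSB.integral_left (hψ : Continuous ψ) (hψ1 : ∃ x, ψ x ≠ 1)
    {k l : ℕ} {W : Type*} [NormedAddCommGroup W] [NormedSpace F W]
    [FiniteDimensional F W] {Φ : ((Fin k → F) × (Fin l → F)) × W → ℂ} (hΦ : IsSB F Φ) :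
    IsSB F fun w => ∫ v, Φ (v, w) := by
  have h := (hΦ.partialFT hψ hψ1 (prodPairing (dotPairing F k) (dotPairing F l))
    (prodPairing_nondegenerate dotPairing_nondegenerate dotPairing_nondegenerate)
    volume).slice_left 0
  simpa using h

theorem isSB_descend (hψ : Continuous ψ) (hψ1 : ∃ x, ψ x ≠ 1)
    (s : F) {Φ : Matrix (Fin (m + 1)) (Fin (m + 1)) F → ℂ}
    (hΦ : IsSB F fun X : Fin (m + 1) → Fin (m + 1) → F => Φ (Matrix.of X)) :
    IsSB F fun X : Fin m → Fin m → F => descend ψ s Φ (Matrix.of X) :=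
  (IsSB.integral_left hψ hψ1 (isSB_twistedFT hψ hψ1 s hΦ)).const_mul _

/-- The Fourier transform on matrices, computed through the block decomposition. -/
theorem fourierMat_blkDual (hψ : Continuous ψ) (hψ1 : ∃ x, ψ x ≠ 1)
    {Φ : Matrix (Fin (m + 1)) (Fin (m + 1)) F → ℂ}
    (hΦ : IsSB F fun X : Fin (m + 1) → Fin (m + 1) → F => Φ (Matrix.of X))
    (Y : Fin m → Fin m → F) (β γ : Fin m → F) (δ : F) :
    fourierMat ψ volume Φ (Matrix.of (blkDual Y β γ δ)) =
      ∫ X : Fin m → Fin m → F, hookFT ψ Φ (γ, ((β, δ), X)) * (ψ (tracePairing F m X Y) : ℂ) := by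
  have h1 := hΦ.comp_linear (blkEquiv F m).toLinearMap (blkEquiv F m).injective
  rw [fourierMat_apply, ← measurePreserving_blkEquiv.integral_comp
    (measurableEmbedding_linearEquiv (blkEquiv F m))]
  simp only [tracePairing_blk]
  refine (integral_prodPairing hψ (rowPairing F m) (prodPairing (dotPairing F m) (tracePairing F m))
    h1 ((β, δ), (γ, Y))).trans ?_
  exact integral_prodPairing hψ (dotPairing F m) (tracePairing F m)
    ((isSB_rowFT hψ hψ1 hΦ).slice_left (β, δ)) (γ, Y)

end descent

end

end Kuznetsov

/-! ### The row and column integrals for fixed smaller unipotents -/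

namespace Kuznetsov

noncomputable section

set_option linter.unusedSectionVars false
set_option synthInstance.maxSize 1000
set_option synthInstance.maxHeartbeats 100000

section algebra

variable {F : Type*} [NontriviallyNormedField F] {m : ℕ} (t : Torus F m) (s : F)
  (u : UCoord F m × UCoord F m) (β r : Fin m → F)

/-- The change of variable in the last column. -/
def lastShift : Fin m → F :=
  (-s • unipMatrix u.2).mulVec β - s • lastInv t • lastVec F m

theorem wt_mulVec_lastShift :
    (wt t).mulVec (lastShift t s u β) = -s • ((wt t * unipMatrix u.2).mulVec β + firstVec F m) := by
  rw [lastShift, Matrix.mulVec_sub, Matrix.mulVec_smul, wt_mulVec_lastVec, Matrix.mulVec_mulVec,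
    Matrix.mul_smul, Matrix.smul_mulVec, smul_add, sub_eq_add_neg, neg_smul s (firstVec F m)]

theorem leftFactor_mulVec_lastShift :
    (unipMatrix u.1 * wt t).mulVec (lastShift t s u β) =
      -s • ((bruhat t u).mulVec β + firstVec F m) := by
  rw [← Matrix.mulVec_mulVec, wt_mulVec_lastShift, Matrix.mulVec_smul, Matrix.mulVec_add,
    unipMatrix_mulVec_firstVec, Matrix.mulVec_mulVec, bruhat, Matrix.mul_assoc]

theorem lastShift_dotProduct :
    lastShift t s u β ⬝ᵥ lastVec F m = -s * (β ⬝ᵥ lastVec F m) - s * lastInv t := by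
  rw [lastShift, sub_dotProduct, dotProduct_comm, Matrix.smul_mulVec, dotProduct_smul,
    Matrix.dotProduct_mulVec, lastVec_vecMul_unipMatrix, smul_dotProduct, smul_dotProduct,
    smul_eq_mul, smul_eq_mul, smul_eq_mul, lastInv_mul_lastVec_dotProduct, dotProduct_comm β]

/-- The shift is chosen so that w t sends it to -s(w t n₂ β + e₁): after division by s, the term e₁
cancels the character of the first row, and what remains pairs r w t n₂ with β. The constant s ·
`lastInv t` is the scalar later cancelled by ψ(-e^{-α}). -/
theorem phase_lastShift (hs : s ≠ 0) :
    -(s⁻¹ * (r ⬝ᵥ (wt t).mulVec (lastShift t s u β)) + r ⬝ᵥ firstVec F m +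
      lastShift t s u β ⬝ᵥ lastVec F m) =
    Matrix.vecMul r (wt t * unipMatrix u.2) ⬝ᵥ β + s * (β ⬝ᵥ lastVec F m + lastInv t) := by
  rw [wt_mulVec_lastShift, lastShift_dotProduct, dotProduct_smul, dotProduct_add,
    Matrix.dotProduct_mulVec, smul_eq_mul]
  field_simp
  ring

end algebra

variable {F : Type*} [NontriviallyNormedField F] [ProperSpace F]
  [MeasureSpace F] [BorelSpace F] [(volume : Measure F).IsAddHaarMeasure] {m : ℕ}
  {ψ : AddChar F Circle} {Φ : Matrix (Fin (m + 1)) (Fin (m + 1)) F → ℂ}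

variable (ψ) in
/-- The partial Fourier transform in the upper right corner. -/
def cornerFT (δ : F) (Φ : Matrix (Fin (m + 1)) (Fin (m + 1)) F → ℂ) (X : Fin m → Fin m → F)
    (p : (Fin m → F) × (Fin m → F)) : ℂ :=
  ∫ y : F, Φ (Matrix.of (blk X p.1 p.2 y)) * (ψ (y * δ) : ℂ)

theorem isSB_cornerFT (hψ : Continuous ψ) (hψ1 : ∃ x, ψ x ≠ 1)
    (hΦ : IsSB F fun X : Fin (m + 1) → Fin (m + 1) → F => Φ (Matrix.of X)) (δ : F)
    (X : Fin m → Fin m → F) : IsSB F (cornerFT ψ δ Φ X) := by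
  let L : F × ((Fin m → F) × (Fin m → F)) →ₗ[F]
      (((Fin m → F) × F) × ((Fin m → F) × (Fin m → Fin m → F))) :=
    (((LinearMap.fst F _ _).comp (LinearMap.snd F _ _)).prod (LinearMap.fst F _ _)).prod
      (((LinearMap.snd F _ _).comp (LinearMap.snd F _ _)).prod 0)
  have hL : Function.Injective L := by
    rintro ⟨y, c, b⟩ ⟨y', c', b'⟩ h
    simpa [L, Prod.ext_iff, and_assoc, and_comm, and_left_comm] using h
  have h1 := (hΦ.comp_linear (blkEquiv F m).toLinearMap (blkEquiv F m).injective).comp_affine L hL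
    ((0, 0), (0, X))
  have h2 := (h1.partialFT hψ hψ1 (LinearMap.mul F F) mul_nondegenerate volume).slice_left δ
  refine Eq.mp (congrArg (IsSB F) (funext fun p => ?_)) h2
  simp [L, cornerFT, blkEquiv_apply]

theorem integral_cornerFT (hψ : Continuous ψ)
    (hΦ : IsSB F fun X : Fin (m + 1) → Fin (m + 1) → F => Φ (Matrix.of X)) (δ : F)
    (X : Fin m → Fin m → F) (b β : Fin m → F) :
    ∫ c : Fin m → F, cornerFT ψ δ Φ X (c, b) * (ψ (c ⬝ᵥ β) : ℂ) =
      rowFT ψ Φ ((β, δ), (b, X)) := by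
  have h1 := (hΦ.comp_linear (blkEquiv F m).toLinearMap (blkEquiv F m).injective).slice_right (b, X)
  have h2 := integrable_mul_addChar (h1.integrable volume) hψ
    (continuous_pairing_left (rowPairing F m) (β, δ))
  refine Eq.trans ?_ (integral_prod _ h2).symm
  congr 1 with c
  rw [cornerFT, ← integral_mul_const]
  congr 1 with y
  rw [prodPairing_apply, AddChar.map_add_eq_mul, mul_assoc]
  congr 1
  rw [Circle.coe_mul, mul_comm]
  rfl

theorem integral_hookFT (hψ : Continuous ψ) (hψ1 : ∃ x, ψ x ≠ 1)
    (hs : IsSelfDual ψ (volume : Measure F))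
    (hΦ : IsSB F fun X : Fin (m + 1) → Fin (m + 1) → F => Φ (Matrix.of X)) (δ : F)
    (X : Fin m → Fin m → F) (b β : Fin m → F) :
    ∫ γ : Fin m → F, hookFT ψ Φ (γ, ((β, δ), X)) * (ψ (-(b ⬝ᵥ γ)) : ℂ) =
      rowFT ψ Φ ((β, δ), (b, X)) :=
  hasInversion_dotPairing hψ hψ1 hs m _
    (((isSB_rowFT hψ hψ1 hΦ).slice_left (β, δ)).slice_right X) b

/-- The γ-integral is Fourier inversion in the last column at the point -s(Xβ + e₁). Keeping γ as a
variable avoids substituting a nonlinear function of (X, β) into a Schwartz function. -/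
theorem integral_twistedFT (hψ : Continuous ψ) (hψ1 : ∃ x, ψ x ≠ 1)
    (hs : IsSelfDual ψ (volume : Measure F))
    (hΦ : IsSB F fun X : Fin (m + 1) → Fin (m + 1) → F => Φ (Matrix.of X)) (s : F)
    (X : Fin m → Fin m → F) :
    ∫ q, twistedFT ψ s Φ (q, X) = ∫ β : Fin m → F,
      rowFT ψ Φ ((β, s⁻¹), (-s • ((Matrix.of X).mulVec β + firstVec F m), X)) *
        (ψ (s * (β ⬝ᵥ lastVec F m)) : ℂ) := by
  refine (integral_prod _ (((isSB_twistedFT hψ hψ1 s hΦ).slice_right X).integrable volume)).trans ?_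
  congr 1 with β
  rw [← integral_hookFT hψ hψ1 hs hΦ, ← integral_mul_const]
  congr 1 with γ
  rw [twistedFT, mul_assoc, ← Circle.coe_mul, ← AddChar.map_add_eq_mul]
  congr 3
  rw [smul_dotProduct, smul_eq_mul, dotProduct_comm (_ + _) γ, dotProduct_add]
  ring

/-- The inner integral of the last transform, for a fixed smaller pair of unipotent matrices. -/
theorem integral_corner_phase (hψ : Continuous ψ) (hψ1 : ∃ x, ψ x ≠ 1)
    (hs : IsSelfDual ψ (volume : Measure F))
    (hΦ : IsSB F fun X : Fin (m + 1) → Fin (m + 1) → F => Φ (Matrix.of X)) (s : F) (hs0 : s ≠ 0)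
    (t : Torus F m) (u : UCoord F m × UCoord F m) :
    ∫ q : (Fin m → F) × (Fin m → F),
      cornerFT ψ s⁻¹ Φ (fun i j => bruhat t u i j) (Matrix.vecMul q.1 (rightFactor t u),
        (leftFactor t u).mulVec q.2) *
      (ψ (-(s⁻¹ * (q.1 ⬝ᵥ (wt t).mulVec q.2) + q.1 ⬝ᵥ firstVec F m + q.2 ⬝ᵥ lastVec F m)) : ℂ) =
    ((absF s ^ m * (∏ i, modulus (t i))⁻¹ : ℝ) : ℂ) * (ψ (s * lastInv t) : ℂ) *
      ∫ q, twistedFT ψ s Φ (q, fun i j => bruhat t u i j) := by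
  set X : Fin m → Fin m → F := fun i j => bruhat t u i j with hX
  have hA := det_rightFactor_ne_zero t u
  have hB := det_leftFactor_ne_zero t u
  have hP := isSB_cornerFT hψ hψ1 hΦ s⁻¹ X
  let L : (Fin m → F) × (Fin m → F) →ₗ[F] (Fin m → F) × (Fin m → F) :=
    (Matrix.vecMulLinear (rightFactor t u)).prodMap (Matrix.mulVecLin (leftFactor t u))
  have hL : Function.Injective L := by
    change Function.Injective (Prod.map (fun v => Matrix.vecMul v (rightFactor t u))
      fun v => (leftFactor t u).mulVec v)
    refine Function.Injective.prodMap ?_ ?_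
    · exact Matrix.vecMul_injective_iff_isUnit.2
        ((Matrix.isUnit_iff_isUnit_det _).2 (isUnit_iff_ne_zero.2 hA))
    · exact Matrix.mulVec_injective_iff_isUnit.2
        ((Matrix.isUnit_iff_isUnit_det _).2 (isUnit_iff_ne_zero.2 hB))
  have hc : Continuous fun q : (Fin m → F) × (Fin m → F) =>
      -(s⁻¹ * (q.1 ⬝ᵥ (wt t).mulVec q.2) + q.1 ⬝ᵥ firstVec F m + q.2 ⬝ᵥ lastVec F m) :=
    (((continuous_const.mul (continuous_fst.dotProduct ((continuous_mulVec _).comp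
      continuous_snd))).add (continuous_fst.dotProduct continuous_const)).add
        (continuous_snd.dotProduct continuous_const)).neg
  have hi := integrable_mul_addChar ((hP.comp_linear L hL).integrable volume) hψ hc
  refine (integral_prod_symm _ hi).trans ?_
  set H : (Fin m → F) → ℂ := fun b => ∫ r : Fin m → F,
    cornerFT ψ s⁻¹ Φ X (Matrix.vecMul r (rightFactor t u), (leftFactor t u).mulVec b) *
      (ψ (-(s⁻¹ * (r ⬝ᵥ (wt t).mulVec b) + r ⬝ᵥ firstVec F m + b ⬝ᵥ lastVec F m)) : ℂ) with hH
  have hK : (-s • unipMatrix u.2).det = (-s) ^ m := by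
    rw [Matrix.det_smul, det_unipMatrix, mul_one, Fintype.card_fin]
  -- The substitution of b by the affine function of β has linear part -s times a unipotent matrix,
  -- hence Jacobian |s|^m.
  have h1 : ∫ b, H b = ((absF s ^ m : ℝ) : ℂ) * ∫ β, H (lastShift t s u β) := by
    have h2 := integral_comp_mulVec (M := -s • unipMatrix u.2)
      (by rw [hK]; exact pow_ne_zero _ (neg_ne_zero.2 hs0))
      fun v => H (v - s • lastInv t • lastVec F m)
    rw [integral_sub_right_eq_self H, hK, absF_pow, absF_neg] at h2
    refine Eq.trans ?_ (congrArg _ h2.symm)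
    rw [← mul_assoc, ← Complex.ofReal_mul, mul_inv_cancel₀ (pow_ne_zero _ (absF_pos hs0).ne'),
      Complex.ofReal_one, one_mul]
  -- After the substitution the phase depends on r only through c = r w t n₂; the change from r to c
  -- contributes the inverse of ∏|t_i|, and the c-integral completes the first row transform.
  have h3 : ∀ β, H (lastShift t s u β) = (((∏ i, modulus (t i))⁻¹ : ℝ) : ℂ) *
      ((ψ (s * lastInv t) : ℂ) * (rowFT ψ Φ ((β, s⁻¹),
        (-s • ((Matrix.of X).mulVec β + firstVec F m), X)) * (ψ (s * (β ⬝ᵥ lastVec F m)) : ℂ))) := by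
    intro β
    rw [hH]
    simp only [phase_lastShift t s u β _ hs0, leftFactor_mulVec_lastShift]
    have h4 := integral_comp_vecMul hA fun c => cornerFT ψ s⁻¹ Φ X
      (c, -s • ((bruhat t u).mulVec β + firstVec F m)) *
        (ψ (c ⬝ᵥ β + s * (β ⬝ᵥ lastVec F m + lastInv t)) : ℂ)
    rw [absF_det_rightFactor] at h4
    refine h4.trans (congrArg _ ?_)
    rw [← integral_cornerFT hψ hΦ, ← integral_mul_const, ← integral_const_mul]
    congr 1 with c
    rw [AddChar.map_add_eq_mul, mul_add, AddChar.map_add_eq_mul, Circle.coe_mul, Circle.coe_mul]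
    have h5 : (Matrix.of X).mulVec β = (bruhat t u).mulVec β := rfl
    rw [h5]
    ring
  change ∫ b, H b = _
  rw [h1, integral_congr_ae (.of_forall h3), integral_const_mul, integral_const_mul,
    ← integral_twistedFT hψ hψ1 hs hΦ s X]
  push_cast
  ring

section torus

theorem prod_modulus_tsnoc (t : Torus F m) (s : Fˣ) :
    ∏ i, modulus (tsnoc t s i) = (∏ i, modulus (t i)) * modulus s := by
  rw [Fin.prod_univ_castSucc]
  simp

theorem prod_modulus_tcons (s : Fˣ) (t : Torus F m) :
    ∏ i, modulus (tcons s t i) = modulus s * ∏ i, modulus (t i) := by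
  rw [Fin.prod_univ_succ]
  simp

theorem prod_modulus_pos {n : ℕ} (t : Torus F n) : 0 < ∏ i, modulus (t i) :=
  Finset.prod_pos fun i _ => modulus_pos (t i)

/-- The exponent 1/2 of |s| is what pairs with the |x|^{1/2} of the transform. The product ∏|t_i|
offsets the Jacobian of the row substitution. -/
theorem matFactor_tsnoc (t : Torus F m) (s : Fˣ) :
    matFactor (tsnoc t s) =
      modulus s ^ (1 / 2 : ℝ) * ((∏ i, modulus (t i)) * matFactor t) := by
  have h1 : deltaHalf (tsnoc t s) =
      deltaHalf t * (∏ i, modulus (t i)) ^ (1 / 2 : ℝ) * modulus s ^ (-(m : ℝ) / 2) := by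
    rw [deltaHalf, Fin.prod_univ_castSucc, tsnoc_last, deltaHalf,
      ← Real.finsetProd_rpow _ _ fun i _ => (modulus_pos (t i)).le, ← Finset.prod_mul_distrib]
    congr 1
    · refine Finset.prod_congr rfl fun i _ => ?_
      rw [tsnoc_castSucc, ← Real.rpow_add (modulus_pos _)]
      congr 1
      push_cast
      rw [Fin.val_castSucc]
      ring
    · congr 1
      push_cast
      ring
  rw [matFactor, matFactor, h1, prod_modulus_tsnoc,
    Real.mul_rpow (prod_modulus_pos t).le (modulus_pos s).le]
  have h2 : modulus s ^ (1 / 2 : ℝ) =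
      modulus s ^ (-(m : ℝ) / 2) * modulus s ^ (((m + 1 : ℕ) : ℝ) / 2) := by
    rw [← Real.rpow_add (modulus_pos s)]
    congr 1
    push_cast
    ring
  have h3 : (∏ i, modulus (t i)) ^ (1 / 2 : ℝ) * (∏ i, modulus (t i)) ^ (((m + 1 : ℕ) : ℝ) / 2) =
      (∏ i, modulus (t i)) * (∏ i, modulus (t i)) ^ ((m : ℝ) / 2) := by
    have h4 := Real.rpow_add (prod_modulus_pos t) 1 ((m : ℝ) / 2)
    rw [Real.rpow_one] at h4
    rw [← h4, ← Real.rpow_add (prod_modulus_pos t)]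
    congr 1
    push_cast
    ring
  rw [h2]
  linear_combination deltaHalf t * modulus s ^ (-(m : ℝ) / 2) *
    modulus s ^ (((m + 1 : ℕ) : ℝ) / 2) * h3

theorem matFactor_tcons (t : Torus F m) (s : Fˣ) :
    matFactor (tcons s t) = modulus s ^ m * modulus s ^ (1 / 2 : ℝ) * matFactor t := by
  have h1 : deltaHalf (tcons s t) =
      modulus s ^ ((m : ℝ) / 2) * (deltaHalf t * (∏ i, modulus (t i)) ^ (-(1 / 2) : ℝ)) := by
    rw [deltaHalf, Fin.prod_univ_succ, tcons_zero, deltaHalf,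
      ← Real.finsetProd_rpow _ _ fun i _ => (modulus_pos (t i)).le, ← Finset.prod_mul_distrib]
    congr 1
    · congr 1
      simp
    · refine Finset.prod_congr rfl fun i _ => ?_
      rw [tcons_succ, ← Real.rpow_add (modulus_pos _)]
      congr 1
      rw [Fin.val_succ]
      push_cast
      ring
  rw [matFactor, matFactor, h1, prod_modulus_tcons,
    Real.mul_rpow (modulus_pos s).le (prod_modulus_pos t).le]
  have h2 : modulus s ^ m * modulus s ^ (1 / 2 : ℝ) =
      modulus s ^ ((m : ℝ) / 2) * modulus s ^ (((m + 1 : ℕ) : ℝ) / 2) := by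
    rw [← Real.rpow_natCast, ← Real.rpow_add (modulus_pos s), ← Real.rpow_add (modulus_pos s)]
    congr 1
    push_cast
    ring
  have h3 : (∏ i, modulus (t i)) ^ (-(1 / 2) : ℝ) *
      (∏ i, modulus (t i)) ^ (((m + 1 : ℕ) : ℝ) / 2) = (∏ i, modulus (t i)) ^ ((m : ℝ) / 2) := by
    rw [← Real.rpow_add (prod_modulus_pos t)]
    congr 1
    push_cast
    ring
  rw [h2]
  linear_combination modulus s ^ ((m : ℝ) / 2) * modulus s ^ (((m + 1 : ℕ) : ℝ) / 2) *
    deltaHalf t * h3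

end torus

end

end Kuznetsov

/-! ### The last transform of a push-forward, and its Fourier dual -/

namespace Kuznetsov

noncomputable section

set_option linter.unusedSectionVars false
set_option synthInstance.maxSize 1000
set_option synthInstance.maxHeartbeats 100000

variable {F : Type*} [NontriviallyNormedField F] [ProperSpace F]
  [MeasureSpace F] [BorelSpace F] [(volume : Measure F).IsAddHaarMeasure] {m : ℕ}
  {ψ : AddChar F Circle} {Φ : Matrix (Fin (m + 1)) (Fin (m + 1)) F → ℂ}

variable (ψ Φ) in
/-- The orbital integrand in split coordinates, times `ψ(δ y)`. -/
def splitIntegrand (δ : F) (t : Torus F m)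
    (p : ((UCoord F m × UCoord F m) × ((Fin m → F) × (Fin m → F))) × F) : ℂ :=
  Φ (Matrix.of (blk (fun i j => bruhat t p.1.1 i j)
      (Matrix.vecMul p.1.2.1 (rightFactor t p.1.1)) ((leftFactor t p.1.1).mulVec p.1.2.2)
      (p.1.2.1 ⬝ᵥ (wt t).mulVec p.1.2.2 + p.2))) *
    (ψ (-(superSum p.1.1.1 + superSum p.1.1.2 +
      (p.1.2.1 ⬝ᵥ firstVec F m + p.1.2.2 ⬝ᵥ lastVec F m)) + p.2 * δ) : ℂ)

theorem integrable_splitIntegrand (hψ : Continuous ψ)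
    (hΦ : IsSB F fun X : Fin (m + 1) → Fin (m + 1) → F => Φ (Matrix.of X)) (δ : F)
    (t : Torus F m) : Integrable (splitIntegrand ψ Φ δ t) := by
  refine integrable_mul_addChar (split_integrable hΦ t) hψ
    (P := fun p : ((UCoord F m × UCoord F m) × ((Fin m → F) × (Fin m → F))) × F =>
      -(superSum p.1.1.1 + superSum p.1.1.2 +
        (p.1.2.1 ⬝ᵥ firstVec F m + p.1.2.2 ⬝ᵥ lastVec F m)) + p.2 * δ) ?_
  have c1 : Continuous fun p : (UCoord F m × UCoord F m) × ((Fin m → F) × (Fin m → F)) =>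
      superSum p.1.1 + superSum p.1.2 :=
    (continuous_superSum.comp (continuous_fst.comp continuous_fst)).add
      (continuous_superSum.comp (continuous_snd.comp continuous_fst))
  have c2 : Continuous fun p : (UCoord F m × UCoord F m) × ((Fin m → F) × (Fin m → F)) =>
      p.2.1 ⬝ᵥ firstVec F m + p.2.2 ⬝ᵥ lastVec F m :=
    ((continuous_fst.comp continuous_snd).dotProduct continuous_const).add
      ((continuous_snd.comp continuous_snd).dotProduct continuous_const)
  exact (((c1.add c2).comp continuous_fst).neg).add (continuous_snd.mul continuous_const)

theorem orbInt_tsnoc_mul (δ : F) (t : Torus F m) (s : Fˣ) :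
    orbInt ψ Φ (tsnoc t s) * (ψ (s * δ) : ℂ) = ∫ p, splitIntegrand ψ Φ δ t (p, s) := by
  rw [orbInt, ← measurePreserving_snocEquiv.integral_comp (snocEquiv F m).measurableEmbedding,
    ← integral_mul_const]
  congr 1 with p
  rw [snocEquiv_apply, bruhat_tsnoc, splitIntegrand, mul_assoc, ← Circle.coe_mul,
    ← AddChar.map_add_eq_mul, superSum_rowU, superSum_colU]
  congr 4
  ring

/-- Fubini brings the corner variable innermost. Translating it by r w t b makes the corner free and
moves the bilinear term into the phase, where `integral_corner_phase` applies for each u. -/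
theorem integral_splitIntegrand (hψ : Continuous ψ) (hψ1 : ∃ x, ψ x ≠ 1)
    (hs : IsSelfDual ψ (volume : Measure F))
    (hΦ : IsSB F fun X : Fin (m + 1) → Fin (m + 1) → F => Φ (Matrix.of X)) (s : F) (hs0 : s ≠ 0)
    (t : Torus F m) :
    ∫ y, ∫ p, splitIntegrand ψ Φ s⁻¹ t (p, y) =
      ((absF s ^ m * (∏ i, modulus (t i))⁻¹ : ℝ) : ℂ) * (ψ (s * lastInv t) : ℂ) *
        ∫ u : UCoord F m × UCoord F m,
          (∫ q, twistedFT ψ s Φ (q, fun i j => bruhat t u i j)) *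
            (ψ (-(superSum u.1 + superSum u.2)) : ℂ) := by
  have hK := integrable_splitIntegrand hψ hΦ s⁻¹ t
  have hG := hK.integral_prod_left
  refine ((integral_prod_symm _ hK).symm.trans (integral_prod _ hK)).trans ?_
  refine (integral_prod _ hG).trans ?_
  rw [← integral_const_mul]
  congr 1 with u
  rw [← mul_assoc, ← integral_corner_phase hψ hψ1 hs hΦ s hs0 t u, ← integral_mul_const]
  congr 1 with q
  have h1 := integral_add_left_eq_self (μ := (volume : Measure F)) (fun y =>
    Φ (Matrix.of (blk (fun i j => bruhat t u i j)
      (Matrix.vecMul q.1 (rightFactor t u)) ((leftFactor t u).mulVec q.2) y)) *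
      ((ψ (y * s⁻¹) : ℂ) * ((ψ (-(s⁻¹ * (q.1 ⬝ᵥ (wt t).mulVec q.2) + q.1 ⬝ᵥ firstVec F m +
        q.2 ⬝ᵥ lastVec F m)) : ℂ) * (ψ (-(superSum u.1 + superSum u.2)) : ℂ))))
    (q.1 ⬝ᵥ (wt t).mulVec q.2)
  have h2 : ∀ y, splitIntegrand ψ Φ s⁻¹ t ((u, q), y) =
      Φ (Matrix.of (blk (fun i j => bruhat t u i j) (Matrix.vecMul q.1 (rightFactor t u))
        ((leftFactor t u).mulVec q.2) (q.1 ⬝ᵥ (wt t).mulVec q.2 + y))) *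
      ((ψ ((q.1 ⬝ᵥ (wt t).mulVec q.2 + y) * s⁻¹) : ℂ) *
        ((ψ (-(s⁻¹ * (q.1 ⬝ᵥ (wt t).mulVec q.2) + q.1 ⬝ᵥ firstVec F m +
        q.2 ⬝ᵥ lastVec F m)) : ℂ) * (ψ (-(superSum u.1 + superSum u.2)) : ℂ))) := by
    intro y
    rw [splitIntegrand, ← Circle.coe_mul, ← Circle.coe_mul, ← AddChar.map_add_eq_mul,
      ← AddChar.map_add_eq_mul]
    congr 3
    ring
  simp only [h2]
  refine h1.trans ?_
  rw [cornerFT, mul_assoc, ← integral_mul_const]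
  congr 1 with y
  ring

theorem negEps_inv_mul_tsnoc (x s : Fˣ) (t : Torus F m) :
    (negEps F (Fin.last m) x)⁻¹ * tsnoc t s = tsnoc t (x * s) := by
  funext i
  induction i using Fin.lastCases with
  | last => simp [negEps]
  | cast i => simp [negEps]

theorem integrable_comp_mul_left {s : F} (hs : s ≠ 0) {f : F → ℂ} (hf : Integrable f) :
    Integrable fun v => f (s * v) := by
  have he : MeasurableEmbedding (s * · : F → F) := (Homeomorph.mulLeft₀ s hs).measurableEmbedding
  refine (he.integrable_map_iff (g := f)).1 ?_
  rw [volume_map_mul_left hs]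
  exact hf.smul_measure ENNReal.ofReal_ne_top

theorem modulus_rpow_half_mul_self (s : Fˣ) :
    modulus s ^ (1 / 2 : ℝ) * modulus s ^ (1 / 2 : ℝ) = modulus s := by
  rw [← Real.rpow_add (modulus_pos s)]
  norm_num

/-- The first transform applied to a push-forward from matrices of size `m + 1` is, up to an explicit
character value, a push-forward from matrices of size `m`. -/
theorem eqFourier_last_pushMat (hψ : Continuous ψ) (hψ1 : ∃ x, ψ x ≠ 1)
    (hs : IsSelfDual ψ (volume : Measure F))
    (hΦ : IsSB F fun X : Fin (m + 1) → Fin (m + 1) → F => Φ (Matrix.of X)) (s : Fˣ)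
    (t : Torus F m) :
    Integrable (eqFourierIntegrand ψ (negEps F (Fin.last m)) (1 / 2) (pushMat ψ volume Φ)
      (tsnoc t s)) (mulHaar volume) ∧
    eqFourier ψ volume (negEps F (Fin.last m)) (1 / 2) (pushMat ψ volume Φ) (tsnoc t s) =
      (ψ (s * lastInv t) : ℂ) * pushMat ψ volume (descend ψ (s : F) Φ) t := by
  -- The corner variable is y = s x, so ψ(x) = ψ(y s⁻¹): the transform along the last coordinate is
  -- taken at frequency s⁻¹.
  let J : F → ℂ := fun y => ∫ p, splitIntegrand ψ Φ (s : F)⁻¹ t (p, y)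
  have hJ : Integrable J := (integrable_splitIntegrand hψ hΦ (s : F)⁻¹ t).integral_prod_right
  let g : F → ℂ := fun x => (matFactor (tsnoc t s) : ℂ) * J (s * x)
  have hg : Integrable g := (integrable_comp_mul_left s.ne_zero hJ).const_mul _
  have h1 : ∀ x : Fˣ, eqFourierIntegrand ψ (negEps F (Fin.last m)) (1 / 2) (pushMat ψ volume Φ)
      (tsnoc t s) x = modulus x * g x := by
    intro x
    have h2 : J (s * x) = orbInt ψ Φ (tsnoc t (x * s)) * (ψ x : ℂ) := by
      have h3 := orbInt_tsnoc_mul (ψ := ψ) (Φ := Φ) (s : F)⁻¹ t (x * s)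
      rw [Units.val_mul, mul_inv_cancel_right₀ s.ne_zero, mul_comm (x : F)] at h3
      exact h3.symm
    have h4 : ((modulus x : ℝ) : ℂ) ^ (1 / 2 : ℂ) = ((modulus x ^ (1 / 2 : ℝ) : ℝ) : ℂ) := by
      rw [Complex.ofReal_cpow (modulus_pos x).le]
      norm_num
    -- One factor |x|^{1/2} comes from the transform and another from `matFactor` at xs; together
    -- they give the |x| that turns d^×x into dx. This is where s = 1/2 is forced.
    have h5 := congrArg (fun r : ℝ => (r : ℂ)) (modulus_rpow_half_mul_self x)
    have h6 : modulus (x * s) ^ (1 / 2 : ℝ) = modulus x ^ (1 / 2 : ℝ) * modulus s ^ (1 / 2 : ℝ) := by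
      rw [modulus_mul, Real.mul_rpow (modulus_pos x).le (modulus_pos s).le]
    simp only [Complex.ofReal_mul] at h5
    rw [eqFourierIntegrand, negEps_inv_mul_tsnoc, pushMat_eq, h4]
    simp only [g]
    rw [h2, matFactor_tsnoc, matFactor_tsnoc, h6, ← h5]
    push_cast
    ring
  refine ⟨integrable_mulHaar hg h1, ?_⟩
  rw [eqFourier, integral_mulHaar h1]
  simp only [g]
  rw [integral_const_mul, integral_comp_mul_left s.ne_zero, absF_coe]
  simp only [J]
  rw [integral_splitIntegrand hψ hψ1 hs hΦ (s : F) s.ne_zero t, pushMat_eq, orbInt, matFactor_tsnoc,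
    absF_coe]
  have h7 : ∀ u : UCoord F m × UCoord F m, descend ψ (s : F) Φ (bruhat t u) *
      (ψ (-(superSum u.1 + superSum u.2)) : ℂ) =
      ((modulus s ^ m * (modulus s ^ (1 / 2 : ℝ))⁻¹ : ℝ) : ℂ) *
        ((∫ q, twistedFT ψ (s : F) Φ (q, fun i j => bruhat t u i j)) *
            (ψ (-(superSum u.1 + superSum u.2)) : ℂ)) := by
    intro u
    rw [descend, absF_coe, mul_assoc]
  rw [integral_congr_ae (.of_forall h7), integral_const_mul]
  -- The powers of |s| left after both Jacobians and dx = |s|⁻¹ dy are exactly the scalar built into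
  -- `descend`.
  have h8 : modulus s ^ (1 / 2 : ℝ) * ((∏ i, modulus (t i)) * matFactor t) * ((modulus s)⁻¹ *
      (modulus s ^ m * (∏ i, modulus (t i))⁻¹)) =
      matFactor t * (modulus s ^ m * (modulus s ^ (1 / 2 : ℝ))⁻¹) := by
    have h9 := (modulus_pos s).ne'
    have h10 := (prod_modulus_pos t).ne'
    have h11 := (Real.rpow_pos_of_pos (modulus_pos s) (1 / 2)).ne'
    have h12 : (modulus s)⁻¹ = (modulus s ^ (1 / 2 : ℝ))⁻¹ * (modulus s ^ (1 / 2 : ℝ))⁻¹ := by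
      rw [← mul_inv, modulus_rpow_half_mul_self]
    rw [h12]
    field_simp
  have h13 := congrArg (fun r : ℝ => (r : ℂ)) h8
  simp only [Complex.ofReal_mul] at h13 ⊢
  linear_combination ((ψ (s * lastInv t) : ℂ) * ∫ u : UCoord F m × UCoord F m,
    (∫ q, twistedFT ψ (s : F) Φ (q, fun i j => bruhat t u i j)) *
            (ψ (-(superSum u.1 + superSum u.2)) : ℂ)) * h13

theorem integral_comp_smul_prod {s : F} (hs : s ≠ 0) (f : (Fin m → F) × (Fin m → F) → ℂ) :
    ∫ q, f (s • q) = ((absF s ^ (m + m))⁻¹ : ℝ) * ∫ q, f q := by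
  have h := volume_measurePreserving_sumPiEquivProdPi (fun _ : Fin m ⊕ Fin m => F)
  have he := (MeasurableEquiv.sumPiEquivProdPi (fun _ : Fin m ⊕ Fin m => F)).measurableEmbedding
  rw [← h.integral_comp he, ← h.integral_comp he]
  have h2 := integral_comp_smul hs fun v : Fin m ⊕ Fin m → F =>
    f (MeasurableEquiv.sumPiEquivProdPi (fun _ : Fin m ⊕ Fin m => F) v)
  rw [Fintype.card_sum, Fintype.card_fin] at h2
  exact h2

theorem tracePairing_add_rankOne (s : F) (X Y : Fin m → Fin m → F) (β γ : Fin m → F) :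
    tracePairing F m X (fun i j => Y i j + s * (β i * γ j)) =
      tracePairing F m X Y + s * (γ ⬝ᵥ (Matrix.of X).mulVec β) := by
  simp only [tracePairing_apply, Matrix.trace, Matrix.diag_apply, Matrix.mul_apply,
    Matrix.of_apply, mul_add, Finset.sum_add_distrib, dotProduct, Matrix.mulVec, Finset.mul_sum]
  congr 1
  refine Finset.sum_congr rfl fun i _ => Finset.sum_congr rfl fun j _ => ?_
  ring

/-- The phase sγXβ is the trace of X against sβγᵗ, so under the Fourier transform in X it becomes a
rank one translation of Y. Fubini holds because the twisted transform is Schwartz–Bruhat in all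
variables. -/
theorem fourierMat_descend (hψ : Continuous ψ) (hψ1 : ∃ x, ψ x ≠ 1)
    (hΦ : IsSB F fun X : Fin (m + 1) → Fin (m + 1) → F => Φ (Matrix.of X)) (s : F)
    (Y : Fin m → Fin m → F) :
    fourierMat ψ volume (descend ψ s Φ) (Matrix.of Y) =
      ((absF s ^ m * (absF s ^ (1 / 2 : ℝ))⁻¹ : ℝ) : ℂ) *
      ∫ q : (Fin m → F) × (Fin m → F),
        fourierMat ψ volume Φ (Matrix.of (blkDual (fun i j => Y i j + s * (q.1 i * q.2 j))
          q.1 q.2 s⁻¹)) * (ψ (s * (q.2 ⬝ᵥ firstVec F m + q.1 ⬝ᵥ lastVec F m)) : ℂ) := by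
  have hT := isSB_twistedFT hψ hψ1 s hΦ
  have hi := integrable_mul_addChar (hT.integrable volume) hψ
    (P := fun p => tracePairing F m p.2 Y)
    ((continuous_pairing_left (tracePairing F m) Y).comp continuous_snd)
  rw [fourierMat_apply]
  simp only [descend, mul_assoc]
  rw [integral_const_mul]
  congr 1
  simp only [← integral_mul_const]
  refine (integral_integral_swap (f := fun X q => twistedFT ψ s Φ (q, X) *
    (ψ (tracePairing F m X Y) : ℂ)) hi.swap).trans ?_
  congr 1 with q
  rw [fourierMat_blkDual hψ hψ1 hΦ, ← integral_mul_const]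
  congr 1 with X
  rw [tracePairing_add_rankOne, twistedFT, mul_assoc, mul_assoc, ← Circle.coe_mul,
    ← Circle.coe_mul, ← AddChar.map_add_eq_mul, ← AddChar.map_add_eq_mul]
  congr 3
  ring

/-- With s⁻¹ in first position, `bruhat_tcons` at (sβ, sγ) has border (β, γ), corner s⁻¹ and rank
one term sβγᵗ, which is the argument in `fourierMat_descend`. The characters of N agree as well
since ψ⁻¹ is evaluated at a negated sum. -/
theorem pushMat_fourierMat_tcons (hψ : Continuous ψ) (hψ1 : ∃ x, ψ x ≠ 1)
    (hΦ : IsSB F fun X : Fin (m + 1) → Fin (m + 1) → F => Φ (Matrix.of X)) (s : Fˣ)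
    (t : Torus F m) :
    pushMat ψ⁻¹ volume (fourierMat ψ volume Φ) (tcons s⁻¹ t) =
      pushMat ψ⁻¹ volume (fourierMat ψ volume (descend ψ (s : F) Φ)) t := by
  have hΨ := isSB_fourierMat hψ hψ1 hΦ
  have hi := orbInt_integrable (continuous_inv_addChar hψ) hΨ (tcons s⁻¹ t)
  have hc := measurePreserving_consEquiv (F := F) (m := m)
  have hi' := (hc.integrable_comp_emb (consEquiv F m).measurableEmbedding).2 hi
  have h1 : orbInt ψ⁻¹ (fourierMat ψ volume Φ) (tcons s⁻¹ t) =
      ((modulus s ^ m * modulus s ^ (1 / 2 : ℝ) : ℝ) : ℂ) *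
        orbInt ψ⁻¹ (fourierMat ψ volume (descend ψ (s : F) Φ)) t := by
    rw [orbInt, ← hc.integral_comp (consEquiv F m).measurableEmbedding]
    refine (integral_prod _ hi').trans ?_
    rw [orbInt, ← integral_const_mul]
    congr 1 with u
    have h2 := integral_comp_smul_prod s.ne_zero fun q : (Fin m → F) × (Fin m → F) =>
      fourierMat ψ volume Φ (bruhat (tcons s⁻¹ t) (consEquiv F m (u, q))) *
        (ψ⁻¹ (-(superSum (consEquiv F m (u, q)).1 + superSum (consEquiv F m (u, q)).2)) : ℂ)
    have h3 : ∀ q : (Fin m → F) × (Fin m → F),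
        fourierMat ψ volume Φ (bruhat (tcons s⁻¹ t) (consEquiv F m (u, (s : F) • q))) *
        (ψ⁻¹ (-(superSum (consEquiv F m (u, (s : F) • q)).1 +
          superSum (consEquiv F m (u, (s : F) • q)).2)) : ℂ) =
        (fourierMat ψ volume Φ (Matrix.of (blkDual
          (fun i j => bruhat t u i j + s * (q.1 i * q.2 j)) q.1 q.2 (s : F)⁻¹)) *
            (ψ (s * (q.2 ⬝ᵥ firstVec F m + q.1 ⬝ᵥ lastVec F m)) : ℂ)) *
          (ψ⁻¹ (-(superSum u.1 + superSum u.2)) : ℂ) := by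
      intro q
      rw [consEquiv_apply]
      simp only [AddChar.inv_apply, neg_neg, bruhat_tcons, superSum_rowU, superSum_colU,
        Prod.smul_fst, Prod.smul_snd, Units.val_inv_eq_inv_val, inv_smul_smul₀ s.ne_zero]
      rw [mul_assoc, ← Circle.coe_mul, ← AddChar.map_add_eq_mul]
      refine congrArg₂ (· * ·) ?_ (congrArg (fun z => (ψ z : ℂ)) ?_)
      · congr 3
        funext i j
        simp only [Pi.smul_apply, smul_eq_mul]
        have := s.ne_zero
        field_simp
      · rw [smul_dotProduct, smul_dotProduct, smul_eq_mul, smul_eq_mul]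
        ring
    simp only [h3] at h2
    rw [integral_mul_const] at h2
    have h4 := fourierMat_descend hψ hψ1 hΦ (s : F) fun i j => bruhat t u i j
    have h5 : fourierMat ψ volume (descend ψ (s : F) Φ) (bruhat t u) = _ := h4
    -- The scalar in the claim times the one in `descend` is |s|^{2m}, the Jacobian of scaling (β,
    -- γ) by s.
    have h6 : modulus s ^ m * modulus s ^ (1 / 2 : ℝ) * (modulus s ^ m *
        (modulus s ^ (1 / 2 : ℝ))⁻¹) = modulus s ^ (m + m) := by
      have h11 := (Real.rpow_pos_of_pos (modulus_pos s) (1 / 2)).ne'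
      field_simp
      ring
    rw [h5, ← mul_assoc, ← mul_assoc, ← Complex.ofReal_mul, absF_coe, h6, mul_assoc, h2, absF_coe,
      ← mul_assoc, ← Complex.ofReal_mul, mul_inv_cancel₀ (pow_ne_zero _ (modulus_pos s).ne'),
      Complex.ofReal_one, one_mul]
    rfl
  rw [pushMat_eq, pushMat_eq, matFactor_tcons, h1]
  have e : modulus s⁻¹ = (modulus s)⁻¹ := by
    rw [← absF_coe, Units.val_inv_eq_inv_val, absF_inv, absF_coe]
  have h6 : modulus s⁻¹ ^ m * modulus s⁻¹ ^ (1 / 2 : ℝ) * matFactor t *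
      (modulus s ^ m * modulus s ^ (1 / 2 : ℝ)) = matFactor t := by
    have h9 := (modulus_pos s).ne'
    have h11 := (Real.rpow_pos_of_pos (modulus_pos s) (1 / 2)).ne'
    rw [e, Real.inv_rpow (modulus_pos s).le, inv_pow]
    field_simp
  rw [← mul_assoc, ← Complex.ofReal_mul, h6]

end

end Kuznetsov

/-! ### Recursion for the composite of transforms -/

namespace Kuznetsov

noncomputable section

set_option linter.unusedSectionVars false
set_option synthInstance.maxSize 1000
set_option synthInstance.maxHeartbeats 100000

variable {F : Type*} [NontriviallyNormedField F] [ProperSpace F]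
  [MeasureSpace F] [BorelSpace F] [(volume : Measure F).IsAddHaarMeasure] {n m : ℕ}
  (ψ : AddChar F Circle)

theorem hankelFrom_of_lt {k : ℕ} (hk : k < n) (f : Torus F n → ℂ) :
    hankelFrom ψ volume k f = hankelStep ψ volume ⟨k, hk⟩ (hankelFrom ψ volume (k + 1) f) := by
  rw [hankelFrom, List.drop_eq_getElem_cons (by simpa using hk), List.foldr_cons]
  simp [hankelFrom]

theorem hankelFrom_of_le {k : ℕ} (hk : n ≤ k) (f : Torus F n → ℂ) :
    hankelFrom ψ volume k f = f := by
  rw [hankelFrom, List.drop_eq_nil_of_le (by simpa using hk), List.foldr_nil]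

theorem mulPsiRoot_last (f : Torus F (m + 1) → ℂ) : mulPsiRoot ψ (Fin.last m) f = f := by
  funext t
  simp [mulPsiRoot]

theorem hankelFrom_last (f : Torus F (m + 1) → ℂ) :
    hankelFrom ψ volume m f = eqFourier ψ volume (negEps F (Fin.last m)) (1 / 2) f := by
  rw [hankelFrom_of_lt ψ (Nat.lt_succ_self m), hankelFrom_of_le ψ le_rfl]
  have h : (⟨m, Nat.lt_succ_self m⟩ : Fin (m + 1)) = Fin.last m := rfl
  rw [h, hankelStep, mulPsiRoot_last]

theorem eqFourierIntegrand_castSucc (i : Fin m) (c : ℂ) (g : Torus F (m + 1) → ℂ) (t : Torus F m)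
    (s x : Fˣ) : eqFourierIntegrand ψ (negEps F i.castSucc) c g (tsnoc t s) x =
      eqFourierIntegrand ψ (negEps F i) c (fun t => g (tsnoc t s)) t x := by
  have h : (negEps F i.castSucc x)⁻¹ * tsnoc t s = tsnoc ((negEps F i x)⁻¹ * t) s := by
    funext j
    induction j using Fin.lastCases with
    | last => simp [negEps, (Fin.castSucc_lt_last i).ne']
    | cast j =>
      by_cases hj : j = i
      · subst hj
        simp [negEps]
      · simp [negEps, Pi.mulSingle_eq_of_ne, hj]
  rw [eqFourierIntegrand, eqFourierIntegrand, h]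

/-- The function on the smaller torus to which the remaining transforms are applied. -/
def innerSlice (f : Torus F (m + 1) → ℂ) (s : Fˣ) : Torus F m → ℂ := fun t =>
  (ψ (-(s * lastInv t)) : ℂ) * hankelFrom ψ volume m f (tsnoc t s)

/-- Transforms along the first m coordinates do not move s, so they act slice by slice, and the only
root factor involving s is the one stored in `innerSlice`. The root factor is part of the statement
because at the last step it is explicit on the left but hidden in the slice on the right. -/
theorem mulPsiRoot_hankelFrom_tsnoc (f : Torus F (m + 1) → ℂ) (s : Fˣ) (i : Fin m)
    (t : Torus F m) :
    mulPsiRoot ψ i.castSucc (hankelFrom ψ volume (i.val + 1) f) (tsnoc t s) =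
      mulPsiRoot ψ i (hankelFrom ψ volume (i.val + 1) (innerSlice ψ f s)) t := by
  -- Downward induction on the index, following the order in which the transforms are applied.
  induction hj : m - (i.val + 1) generalizing i t with
  | zero =>
    have hi : i.val + 1 = m := by omega
    have h1 : i.castSucc.val + 1 < m + 1 := by simp
    have h2 : (⟨i.castSucc.val + 1, h1⟩ : Fin (m + 1)) = Fin.last m := Fin.ext hi
    have h3 : ((tsnoc t s (Fin.last m) : F) / (tsnoc t s i.castSucc : F)) = s * lastInv t := by
      obtain ⟨k, rfl⟩ : ∃ k, m = k + 1 := ⟨i.val, hi.symm⟩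
      have h4 : i = Fin.last k := Fin.ext (by simpa using hi)
      rw [tsnoc_last, tsnoc_castSucc, lastInv_succ, div_eq_mul_inv, h4]
    rw [mulPsiRoot, dif_pos h1, h2, h3, mulPsiRoot, dif_neg (by omega),
      hankelFrom_of_le ψ hi.ge, innerSlice, hi]
  | succ j ih =>
    have hi : i.val + 1 < m := by omega
    have h1 : i.castSucc.val + 1 < m + 1 := by simp
    have h2 : (⟨i.castSucc.val + 1, h1⟩ : Fin (m + 1)) = (⟨i.val + 1, hi⟩ : Fin m).castSucc := rfl
    rw [mulPsiRoot, dif_pos h1, mulPsiRoot, dif_pos hi, h2, tsnoc_castSucc, tsnoc_castSucc]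
    congr 1
    rw [hankelFrom_of_lt ψ (hi.trans (Nat.lt_succ_self m)), hankelFrom_of_lt ψ hi]
    have h3 : (⟨i.val + 1, hi.trans (Nat.lt_succ_self m)⟩ : Fin (m + 1)) =
      (⟨i.val + 1, hi⟩ : Fin m).castSucc := rfl
    rw [h3, hankelStep, hankelStep, eqFourier, eqFourier]
    congr 1 with x
    rw [eqFourierIntegrand_castSucc]
    congr 1
    funext t'
    exact ih ⟨i.val + 1, hi⟩ t' (by simp only; omega)

theorem hankelFormula_tsnoc (f : Torus F (m + 1) → ℂ) (s : Fˣ) (t : Torus F m) :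
    hankelFormula ψ volume f (tsnoc t s) = hankelFormula ψ volume (innerSlice ψ f s) t := by
  rcases Nat.eq_zero_or_pos m with rfl | hm
  · rw [hankelFormula, hankelFormula, hankelFrom_of_le ψ le_rfl, innerSlice]
    simp [lastInv]
  · rw [hankelFormula, hankelFormula, hankelFrom_of_lt ψ (Nat.succ_pos m), hankelFrom_of_lt ψ hm]
    have h3 : (⟨0, Nat.succ_pos m⟩ : Fin (m + 1)) = (⟨0, hm⟩ : Fin m).castSucc := rfl
    rw [h3, hankelStep, hankelStep, eqFourier, eqFourier]
    congr 1 with x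
    rw [eqFourierIntegrand_castSucc]
    congr 1
    funext t'
    exact mulPsiRoot_hankelFrom_tsnoc ψ f s ⟨0, hm⟩ t'

theorem exists_eq_tsnoc (t : Torus F (m + 1)) : ∃ t' s, t = tsnoc t' s :=
  ⟨Fin.init t, t (Fin.last m), by simp [tsnoc]⟩

variable {ψ}

theorem pushMat_fourierMat_zero (Φ : Matrix (Fin 0) (Fin 0) F → ℂ) (t t' : Torus F 0) :
    pushMat ψ⁻¹ volume (fourierMat ψ volume Φ) t = pushMat ψ volume Φ t' := by
  have : IsEmpty {p : Fin 0 × Fin 0 // p.1 < p.2} := ⟨fun p => p.1.1.elim0⟩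
  have h1 : fourierMat ψ volume Φ = Φ := by
    funext Y
    have h2 : ∀ X : Fin 0 → Fin 0 → F,
        Φ (Matrix.of X) * (ψ (Matrix.trace (Matrix.of X * Y)) : ℂ) = Φ Y := fun X => by
      rw [Subsingleton.elim (Matrix.of X) Y]
      simp [Matrix.trace]
    rw [fourierMat, integral_congr_ae (.of_forall h2)]
    simp [measureReal_def]
  rw [h1, Subsingleton.elim t t', pushMat_eq, pushMat_eq, orbInt, orbInt]
  simp [superSum]

/-- The composite of the transforms computes the push-forward of the Fourier transform. -/
theorem hankel_pushMat (hψ : Continuous ψ) (hψ1 : ∃ x, ψ x ≠ 1)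
    (hs : IsSelfDual ψ (volume : Measure F)) {Φ : Matrix (Fin n) (Fin n) F → ℂ}
    (hΦ : IsSB F fun X : Fin n → Fin n → F => Φ (Matrix.of X)) :
    HankelConverges ψ volume (pushMat ψ volume Φ) ∧
      ∀ t, hankelFormula ψ volume (pushMat ψ volume Φ) t =
        pushMat ψ⁻¹ volume (fourierMat ψ volume Φ) (revInv t) := by
  induction n with
  | zero =>
    refine ⟨fun i => i.elim0, fun t => ?_⟩
    rw [pushMat_fourierMat_zero Φ _ t, hankelFormula, hankelFrom_of_le ψ le_rfl]
  | succ m ih =>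
    -- The scalar from the last transform meets ψ(-e^{-α}) and disappears, so each slice is again a
    -- push-forward. The Schwartz function depends on s, but the induction hypothesis is used for
    -- one s at a time.
    have hslice : ∀ s : Fˣ, innerSlice ψ (pushMat ψ volume Φ) s =
        pushMat ψ volume (descend ψ (s : F) Φ) := by
      intro s
      funext t
      rw [innerSlice, hankelFrom_last, (eqFourier_last_pushMat hψ hψ1 hs hΦ s t).2, ← mul_assoc,
        ← Circle.coe_mul, ← AddChar.map_add_eq_mul, neg_add_cancel, AddChar.map_zero_eq_one,
        Circle.coe_one, one_mul]
    constructor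
    · intro i t
      obtain ⟨t, s, rfl⟩ := exists_eq_tsnoc t
      induction i using Fin.lastCases with
      | last =>
        rw [mulPsiRoot_last, hankelFrom_of_le ψ (by simp)]
        exact (eqFourier_last_pushMat hψ hψ1 hs hΦ s t).1
      | cast i =>
        have h1 := (ih (isSB_descend hψ hψ1 (s : F) hΦ)).1 i t
        rw [← hslice] at h1
        convert h1 using 1
        funext x
        rw [eqFourierIntegrand_castSucc]
        congr 1
        funext t'
        exact mulPsiRoot_hankelFrom_tsnoc ψ _ s i t'
    · intro t
      obtain ⟨t, s, rfl⟩ := exists_eq_tsnoc t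
      rw [hankelFormula_tsnoc, hslice, (ih (isSB_descend hψ hψ1 (s : F) hΦ)).2, revInv_tsnoc,
        pushMat_fourierMat_tcons hψ hψ1 hΦ]

end

end Kuznetsov

/-! ### Schwartz half-densities and the isomorphism of images -/

namespace Kuznetsov

noncomputable section

open scoped SchwartzMap

set_option linter.unusedSectionVars false
set_option synthInstance.maxSize 1000
set_option synthInstance.maxHeartbeats 100000

section schwartz

variable {F : Type*} [NontriviallyNormedField F] [ProperSpace F] {n : ℕ}

/-- An ultrametric field is totally disconnected while ℝᵈ is connected. -/
theorem not_isArch_of_isUltrametricDist [IsUltrametricDist F] : ¬IsArch F := by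
  rintro ⟨d, ⟨T⟩⟩
  have h1 : PreconnectedSpace F := T.symm.toHomeomorph.surjective.denseRange.preconnectedSpace
    T.symm.continuous
  have h2 : Subsingleton F := ⟨fun a b =>
    (isPreconnected_univ (α := F)).subsingleton (Set.mem_univ a) (Set.mem_univ b)⟩
  exact zero_ne_one (Subsingleton.elim (0 : F) 1)

theorem isArch_of_continuousAddEquiv {E : Type*} [NormedAddCommGroup E] [NormedSpace ℝ E]
    [FiniteDimensional ℝ E] (e : F ≃ₜ+ E) : IsArch F := by
  let b : E ≃L[ℝ] (Fin (Module.finrank ℝ E) → ℝ) := ContinuousLinearEquiv.ofFinrankEq (by simp)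
  exact ⟨_, ⟨e.trans b.toContinuousAddEquiv⟩⟩

/-- An additive homeomorphism, applied entrywise to matrices. -/
def mapMatEquiv {E : Type*} [NormedAddCommGroup E] (e : F ≃ₜ+ E) (n : ℕ) :
    (Fin n → Fin n → F) ≃ₜ+ (Fin n → Fin n → E) where
  toFun X := fun i j => e (X i j)
  invFun X := fun i j => e.symm (X i j)
  left_inv X := by simp
  right_inv X := by simp
  map_add' X Y := by funext i j; simp
  continuous_toFun := by fun_prop
  continuous_invFun := by fun_prop

/-- A continuous isomorphism of rings as an additive homeomorphism. -/
def ringEquivAdd {E : Type*} [NormedField E] (e : F ≃+* E) (h : Continuous e)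
    (h' : Continuous e.symm) : F ≃ₜ+ E where
  toAddEquiv := e.toAddEquiv
  continuous_toFun := h
  continuous_invFun := h'

theorem IsSB.exists_schwartzMap {Φ : (Fin n → Fin n → F) → ℂ} (hΦ : IsSB F Φ) {E : Type*}
    [NormedAddCommGroup E] [NormedSpace ℝ E] [FiniteDimensional ℝ E] (e : F ≃ₜ+ E) :
    ∃ g : 𝓢(Fin n → Fin n → E, ℂ), ∀ X, Φ X = g (fun i j => e (X i j)) := by
  rcases hΦ with ⟨hF, -⟩ | ⟨hF, k, T, g, hg⟩
  · exact absurd (isArch_of_continuousAddEquiv e) not_isArch_of_isUltrametricDist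
  · exact exists_schwartzMap_of_chart (mapMatEquiv e n) T g hg

/-- The ultrametric and archimedean cases exclude each other, and a Schwartz function in one real
chart is Schwartz in every other, so the conditions quantified over all isomorphisms e reduce to a
single chart. -/
theorem mem_schwartz_iff (hF : IsLocalField F) (Φ : Matrix (Fin n) (Fin n) F → ℂ) :
    Φ ∈ schwartz F n ↔ IsSB F fun X : Fin n → Fin n → F => Φ (Matrix.of X) := by
  constructor
  · rintro ⟨h1, h2, h3⟩
    rcases hF.2 with hu | ⟨e, he, he'⟩ | ⟨e, he, he'⟩
    · exact .inl ⟨hu, h1 hu⟩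
    · obtain ⟨g, hg⟩ := h2 e he he'
      exact .of_chart (isArch_of_continuousAddEquiv (ringEquivAdd e he he'))
        (mapMatEquiv (ringEquivAdd e he he') n) g hg
    · obtain ⟨g, hg⟩ := h3 e he he'
      exact .of_chart (isArch_of_continuousAddEquiv (ringEquivAdd e he he'))
        (mapMatEquiv (ringEquivAdd e he he') n) g hg
  · intro h
    refine ⟨fun hu => ?_, fun e he he' => h.exists_schwartzMap (ringEquivAdd e he he'),
      fun e he he' => h.exists_schwartzMap (ringEquivAdd e he he')⟩
    rcases h with ⟨-, h⟩ | ⟨hF, -⟩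
    · exact h
    · exact absurd hF not_isArch_of_isUltrametricDist

end schwartz

section linear

/-- Two linear maps with the same kernel have isomorphic ranges. -/
theorem exists_linearEquiv_range {R M N N' : Type*} [Ring R] [AddCommGroup M] [Module R M]
    [AddCommGroup N] [Module R N] [AddCommGroup N'] [Module R N'] (A : M →ₗ[R] N) (B : M →ₗ[R] N')
    (h : LinearMap.ker A = LinearMap.ker B) {S : Submodule R N} {S' : Submodule R N'}
    (hS : LinearMap.range A = S) (hS' : LinearMap.range B = S') :
    ∃ H : S ≃ₗ[R] S', ∀ (f : S) (x : M), (f : N) = A x → (H f : N') = B x := by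
  subst hS hS'
  refine ⟨A.quotKerEquivRange.symm.trans ((Submodule.quotEquivOfEq _ _ h).trans
    B.quotKerEquivRange), fun f x hf => ?_⟩
  have h1 : A.quotKerEquivRange.symm f = (LinearMap.ker A).mkQ x := by
    rw [LinearEquiv.symm_apply_eq]
    exact Subtype.ext hf
  simp [h1]

end linear

variable {F : Type*} [NontriviallyNormedField F] [ProperSpace F]
  [MeasureSpace F] [BorelSpace F] [(volume : Measure F).IsAddHaarMeasure] {n : ℕ}
  {ψ : AddChar F Circle}

/-- This is inversion for the trace pairing; symmetry of the trace lets the second transform use the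
same convention as the first. -/
theorem fourierMat_inv_fourierMat (hψ : Continuous ψ) (hψ1 : ∃ x, ψ x ≠ 1)
    (hs : IsSelfDual ψ (volume : Measure F)) {Φ : Matrix (Fin n) (Fin n) F → ℂ}
    (hΦ : IsSB F fun X : Fin n → Fin n → F => Φ (Matrix.of X)) :
    fourierMat ψ⁻¹ volume (fourierMat ψ volume Φ) = Φ := by
  funext X
  refine Eq.trans ?_ (hasInversion_tracePairing hψ hψ1 hs n _ hΦ fun i j => X i j)
  refine (fourierMat_apply _ fun i j => X i j).trans ?_
  congr 1 with Y
  rw [AddChar.inv_apply, tracePairing_apply, tracePairing_apply, Matrix.trace_mul_comm,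
    fourierMat_apply]

section linearity

variable {Φ Ψ : Matrix (Fin n) (Fin n) F → ℂ}

theorem orbInt_add (hψ : Continuous ψ) (hΦ : IsSB F fun X : Fin n → Fin n → F => Φ (Matrix.of X))
    (hΨ : IsSB F fun X : Fin n → Fin n → F => Ψ (Matrix.of X)) (t : Torus F n) :
    orbInt ψ (Φ + Ψ) t = orbInt ψ Φ t + orbInt ψ Ψ t := by
  rw [orbInt, orbInt, orbInt, ← integral_add (orbInt_integrable hψ hΦ t)
    (orbInt_integrable hψ hΨ t)]
  congr 1 with u
  rw [Pi.add_apply, add_mul]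

theorem orbInt_smul (c : ℂ) (t : Torus F n) : orbInt ψ (c • Φ) t = c * orbInt ψ Φ t := by
  rw [orbInt, orbInt, ← integral_const_mul]
  congr 1 with u
  rw [Pi.smul_apply, smul_eq_mul, mul_assoc]

theorem fourierMat_add (hψ : Continuous ψ)
    (hΦ : IsSB F fun X : Fin n → Fin n → F => Φ (Matrix.of X))
    (hΨ : IsSB F fun X : Fin n → Fin n → F => Ψ (Matrix.of X)) :
    fourierMat ψ volume (Φ + Ψ) = fourierMat ψ volume Φ + fourierMat ψ volume Ψ := by
  funext Y
  have hc := continuous_pairing_left (tracePairing F n) fun i j => Y i j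
  refine Eq.trans ?_ (integral_add (integrable_mul_addChar (hΦ.integrable volume) hψ hc)
    (integrable_mul_addChar (hΨ.integrable volume) hψ hc))
  refine (fourierMat_apply _ fun i j => Y i j).trans ?_
  congr 1 with X
  rw [Pi.add_apply, add_mul]
  rfl

theorem fourierMat_smul (c : ℂ) :
    fourierMat ψ volume (c • Φ) = c • fourierMat ψ volume Φ := by
  funext Y
  rw [Pi.smul_apply, fourierMat, fourierMat, smul_eq_mul, ← integral_const_mul]
  congr 1 with X
  rw [Pi.smul_apply, smul_eq_mul, mul_assoc]

/-- The push-forward as a linear map on Schwartz functions. -/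
def pushLin (hF : IsLocalField F) (hψ : Continuous ψ) (n : ℕ) :
    schwartz F n →ₗ[ℂ] (Torus F n → ℂ) where
  toFun Φ := pushMat ψ volume Φ
  map_add' Φ Ψ := by
    funext t
    rw [Submodule.coe_add, Pi.add_apply, pushMat_eq, pushMat_eq, pushMat_eq,
      orbInt_add hψ ((mem_schwartz_iff hF _).1 Φ.2) ((mem_schwartz_iff hF _).1 Ψ.2), mul_add]
  map_smul' c Φ := by
    funext t
    rw [Submodule.coe_smul, RingHom.id_apply, Pi.smul_apply, pushMat_eq, pushMat_eq, orbInt_smul,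
      smul_eq_mul]
    ring

/-- The Fourier transform as a linear map on Schwartz functions. -/
def fourierLin (hF : IsLocalField F) (hψ : Continuous ψ) (hψ1 : ∃ x, ψ x ≠ 1) (n : ℕ) :
    schwartz F n →ₗ[ℂ] schwartz F n where
  toFun Φ := ⟨fourierMat ψ volume Φ,
    (mem_schwartz_iff hF _).2 (isSB_fourierMat hψ hψ1 ((mem_schwartz_iff hF _).1 Φ.2))⟩
  map_add' Φ Ψ := Subtype.ext
    (fourierMat_add hψ ((mem_schwartz_iff hF _).1 Φ.2) ((mem_schwartz_iff hF _).1 Ψ.2))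
  map_smul' c _ := Subtype.ext (fourierMat_smul c)

/-- The dual push-forward as a linear map on Schwartz functions. -/
def pushDualLin (hF : IsLocalField F) (hψ : Continuous ψ) (n : ℕ) :
    schwartz F n →ₗ[ℂ] (Torus F n → ℂ) where
  toFun Φ := pushMatDual ψ volume Φ
  map_add' Φ Ψ := by
    funext t
    have h := congrFun ((pushLin hF (continuous_inv_addChar hψ) n).map_add Φ Ψ) (revInv t)
    rw [Pi.add_apply, pushMatDual_eq hψ ((mem_schwartz_iff hF _).1 Φ.2),
      pushMatDual_eq hψ ((mem_schwartz_iff hF _).1 Ψ.2),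
      pushMatDual_eq hψ ((mem_schwartz_iff hF _).1 (Φ + Ψ).2)]
    exact h
  map_smul' c Φ := by
    funext t
    have h := congrFun ((pushLin hF (continuous_inv_addChar hψ) n).map_smul c Φ) (revInv t)
    rw [RingHom.id_apply, Pi.smul_apply, pushMatDual_eq hψ ((mem_schwartz_iff hF _).1 Φ.2),
      pushMatDual_eq hψ ((mem_schwartz_iff hF _).1 (c • Φ).2)]
    exact h

theorem span_image_eq_range {M N : Type*} [AddCommGroup M] [Module ℂ M] [AddCommGroup N]
    [Module ℂ N] {S : Submodule ℂ M} (f : M → N) (A : S →ₗ[ℂ] N) (h : ∀ x : S, A x = f x) :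
    (LinearMap.range A : Set N) = f '' S ∧ LinearMap.range A = Submodule.span ℂ (f '' S) := by
  have h1 : (LinearMap.range A : Set N) = f '' S := by
    ext y
    constructor
    · rintro ⟨x, rfl⟩
      exact ⟨x, x.2, (h x).symm⟩
    · rintro ⟨x, hx, rfl⟩
      exact ⟨⟨x, hx⟩, h ⟨x, hx⟩⟩
  exact ⟨h1, by rw [← h1, Submodule.span_eq]⟩

end linearity

/-- The theorem for the given measure `volume`. -/
theorem hankel_volume (hF : IsLocalField F) (hψ : Continuous ψ) (hψ1 : ∃ x, ψ x ≠ 1)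
    (hs : IsSelfDual ψ (volume : Measure F)) (n : ℕ) :
    (∀ Φ ∈ schwartz F n, fourierMat ψ volume Φ ∈ schwartz F n) ∧
    (∀ Φ ∈ schwartz F n, ∀ t : Torus F n,
      Integrable (orbitalIntegrand ψ (restrictMat Φ) t) (haarNN volume n) ∧
      Integrable (orbitalIntegrand ψ (restrictMatDual Φ) t) (haarNN volume n)) ∧
    (DStd ψ volume n : Set (Torus F n → ℂ)) = pushMat ψ volume '' (schwartz F n : Set _) ∧
    (DStdDual ψ volume n : Set (Torus F n → ℂ)) =
      pushMatDual ψ volume '' (schwartz F n : Set _) ∧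
    ∃ H : DStd ψ volume n ≃ₗ[ℂ] DStdDual ψ volume n,
      (∀ (f : DStd ψ volume n) (Φ : Matrix (Fin n) (Fin n) F → ℂ), Φ ∈ schwartz F n →
        (f : Torus F n → ℂ) = pushMat ψ volume Φ →
        (H f : Torus F n → ℂ) = pushMatDual ψ volume (fourierMat ψ volume Φ)) ∧
      (∀ f : DStd ψ volume n, HankelConverges ψ volume (f : Torus F n → ℂ) ∧
        (H f : Torus F n → ℂ) = hankelFormula ψ volume (f : Torus F n → ℂ)) := by
  have hψ' := continuous_inv_addChar hψ
  have hψ1' := inv_addChar_ne_one hψ1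
  have hs' := hs.inv
  have sb : ∀ Φ : schwartz F n, IsSB F fun X : Fin n → Fin n → F =>
      (Φ : Matrix (Fin n) (Fin n) F → ℂ) (Matrix.of X) := fun Φ => (mem_schwartz_iff hF _).1 Φ.2
  let A := pushLin hF hψ n
  let D := pushDualLin hF hψ n
  let FT := fourierLin hF hψ hψ1 n
  let FT' := fourierLin hF hψ' hψ1' n
  have hA := span_image_eq_range (S := schwartz F n) (pushMat ψ volume) A fun _ => rfl
  have hD := span_image_eq_range (S := schwartz F n) (pushMatDual ψ volume) D fun _ => rfl
  have inv1 : ∀ Φ, FT' (FT Φ) = Φ := fun Φ =>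
    Subtype.ext (fourierMat_inv_fourierMat hψ hψ1 hs (sb Φ))
  have inv2 : ∀ Φ, FT (FT' Φ) = Φ := fun Φ => Subtype.ext (by
    have := fourierMat_inv_fourierMat hψ' hψ1' hs' (sb Φ)
    rwa [inv_inv] at this)
  have key : ∀ Φ, D (FT Φ) = hankelFormula ψ volume (A Φ) := fun Φ => funext fun t => by
    refine (pushMatDual_eq hψ (sb (FT Φ)) t).trans ?_
    exact ((hankel_pushMat hψ hψ1 hs (sb Φ)).2 t).symm
  -- The same formula for ψ⁻¹ applied to the Fourier transform of Φ; the inverse transform restores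
  -- Φ, so the original push-forward is recovered from the dual one.
  have key' : ∀ Φ t, A Φ (revInv t) = hankelFormula ψ⁻¹ volume
      (pushLin hF hψ' n (FT Φ)) t := fun Φ t => by
    have h1 := (hankel_pushMat hψ' hψ1' hs' (sb (FT Φ))).2 t
    have h2 : fourierMat ψ⁻¹ volume (FT Φ : Matrix (Fin n) (Fin n) F → ℂ) = Φ :=
      congrArg Subtype.val (inv1 Φ)
    rw [h2, inv_inv] at h1
    exact h1.symm
  have hker : LinearMap.ker A = LinearMap.ker (D ∘ₗ FT) := by
    ext Φ
    rw [LinearMap.mem_ker, LinearMap.mem_ker, LinearMap.comp_apply]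
    constructor
    · intro h
      -- That the composite of transforms kills the zero function is read off from the formula at Φ
      -- = 0.
      have h0 := key 0
      rw [FT.map_zero, D.map_zero, A.map_zero] at h0
      rw [key, h]
      exact h0.symm
    · intro h
      have h1 : pushLin hF hψ' n (FT Φ) = 0 := funext fun t => by
        have h2 := pushMatDual_eq hψ (sb (FT Φ)) (revInv t)
        rw [revInv_revInv] at h2
        exact h2.symm.trans (congrFun h (revInv t))
      funext t
      have h3 := key' Φ (revInv t)
      have h4 := key' 0 (revInv t)
      rw [revInv_revInv, h1] at h3
      rw [revInv_revInv, A.map_zero, FT.map_zero, LinearMap.map_zero] at h4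
      exact h3.trans h4.symm
  -- The Fourier transform is onto the Schwartz space by inversion, so composing with it does not
  -- shrink the dual image.
  have hrange : LinearMap.range (D ∘ₗ FT) = DStdDual ψ volume n := by
    rw [LinearMap.range_comp_of_range_eq_top _
      (LinearMap.range_eq_top.2 fun Φ => ⟨FT' Φ, inv2 Φ⟩)]
    exact hD.2
  obtain ⟨H, hH⟩ := exists_linearEquiv_range A (D ∘ₗ FT) hker
    (S := DStd ψ volume n) hA.2 hrange
  refine ⟨fun Φ hΦ => (FT ⟨Φ, hΦ⟩).2, fun Φ hΦ t => orbitalIntegrand_integrable hψ (sb ⟨Φ, hΦ⟩) t,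
    ?_, ?_, H, fun f Φ hΦ hf => hH f ⟨Φ, hΦ⟩ hf, fun f => ?_⟩
  · rw [← hA.1, hA.2]
    rfl
  · rw [← hD.1, hD.2]
    rfl
  · obtain ⟨Φ, hΦ⟩ : ∃ Φ, A Φ = f := by
      have h1 : (f : Torus F n → ℂ) ∈ LinearMap.range A := by
        rw [hA.2]
        exact f.2
      exact h1
    refine ⟨?_, ?_⟩
    · rw [← hΦ]
      exact (hankel_pushMat hψ hψ1 hs (sb Φ)).1
    · rw [hH f Φ hΦ.symm, ← hΦ, ← key]
      rfl

end

end Kuznetsov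

theorem mainTheorem2 {F : Type*} [NontriviallyNormedField F] [LocallyCompactSpace F]
    [MeasurableSpace F] [BorelSpace F] (hF : Kuznetsov.IsLocalField F)
    (ψ : AddChar F Circle) (hψ : Continuous ψ) (hψ1 : ∃ x, ψ x ≠ 1)
    (μ : Measure F) [μ.IsAddHaarMeasure] (hμ : Kuznetsov.IsSelfDual ψ μ) (n : ℕ) :
    -- the Fourier transform maps Schwartz half-densities to Schwartz half-densities
    (∀ Φ ∈ Kuznetsov.schwartz F n, Kuznetsov.fourierMat ψ μ Φ ∈ Kuznetsov.schwartz F n) ∧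
    -- the push-forwards are given by absolutely convergent orbital integrals
    (∀ Φ ∈ Kuznetsov.schwartz F n, ∀ t : Kuznetsov.Torus F n,
      Integrable (Kuznetsov.orbitalIntegrand ψ (Kuznetsov.restrictMat Φ) t)
        (Kuznetsov.haarNN μ n) ∧
      Integrable (Kuznetsov.orbitalIntegrand ψ (Kuznetsov.restrictMatDual Φ) t)
        (Kuznetsov.haarNN μ n)) ∧
    -- the two spaces are precisely the images of the push-forwards
    (Kuznetsov.DStd ψ μ n : Set (Kuznetsov.Torus F n → ℂ)) =
      Kuznetsov.pushMat ψ μ ''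
        (Kuznetsov.schwartz F n : Set (Matrix (Fin n) (Fin n) F → ℂ)) ∧
    (Kuznetsov.DStdDual ψ μ n : Set (Kuznetsov.Torus F n → ℂ)) =
      Kuznetsov.pushMatDual ψ μ ''
        (Kuznetsov.schwartz F n : Set (Matrix (Fin n) (Fin n) F → ℂ)) ∧
    -- the Hankel transform
    ∃ H : Kuznetsov.DStd ψ μ n ≃ₗ[ℂ] Kuznetsov.DStdDual ψ μ n,
      (∀ (f : Kuznetsov.DStd ψ μ n) (Φ : Matrix (Fin n) (Fin n) F → ℂ),
        Φ ∈ Kuznetsov.schwartz F n →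
        (f : Kuznetsov.Torus F n → ℂ) = Kuznetsov.pushMat ψ μ Φ →
        (H f : Kuznetsov.Torus F n → ℂ) =
          Kuznetsov.pushMatDual ψ μ (Kuznetsov.fourierMat ψ μ Φ)) ∧
      (∀ f : Kuznetsov.DStd ψ μ n,
        Kuznetsov.HankelConverges ψ μ (f : Kuznetsov.Torus F n → ℂ) ∧
        (H f : Kuznetsov.Torus F n → ℂ) =
          Kuznetsov.hankelFormula ψ μ (f : Kuznetsov.Torus F n → ℂ)) := by
  have : LocallyCompactSpace F := hF.1
  have : ProperSpace F := ProperSpace.of_locallyCompactSpace F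
  -- The given self-dual measure is installed as the default volume, so that products carry the
  -- product measures used above.
  let _ : MeasureSpace F := { ‹MeasurableSpace F› with volume := μ }
  have : (volume : Measure F).IsAddHaarMeasure := ‹μ.IsAddHaarMeasure›
  exact Kuznetsov.hankel_volume hF hψ hψ1 hμ n
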